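/- **Setting.** An instance $H$ has a finite nonempty set $\mathcal I$ of resource types with initial inventories $c_i\ge 0$, $c_{\min}=\min_i c_i$, requests $j=1,\dots,m$, a finite set $Z$ of request types and a finite set $\mathcal K$ of actions. The type $z(j)$ of request $j$ is drawn independently with known probabilities $(p_{jz})_{z\in Z}$. When request $j$ arrives, $\zeta_i(j)$ units of each resource $i$ arrive; the $\zeta_i(j)$ are independent of each other and of everything else, $\zeta_i(j)\in\{0,w_{ij}\}$, $w_{ij}\ge0$, $\mathbb E\,\zeta_i(j)=q_{ij}$. Choosing action $k$ for request $j$ of type $z$ consumes $A_{ijkz}(l)\in\{0,b_{ijkz}(l)\}$ units of $i$ at the arrival of each request $l\ge j$, where $0\le b_{ijkz}(l)\le 1$ and $A_{ijkz}(l)$ is non-increasing in $l$, and earns an integrable profit $R_{ijkz}\ge 0$ for each objective $i\in\mathcal I$; for fixed $(j,k,z)$ these variables may be correlated, for different $(j,k,z)$ they are independent. Action $k$ may be chosen only if the remaining inventory of each resource $i$ that it uses (i.e. $b_{ijkz}(j)\neq0$) is at least $b_{ijkz}(j)$. A trivial action $k_0$ uses nothing. An online algorithm is given the instance with all its distributions,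 may randomize, sees types and replenishments up to the current request, and sees consumptions and profits of its past actions as they are realized. Its performance is $\mathrm{ALG}(H)=\min_{i}\mathbb E\big[\sum_j R_{ijk(j)z(j)}\big]$. $\mathrm{OPT}(H)$ is the supremum of the same quantity over randomized policies that in addition know all request types and all replenishments in advance. ALG has competitive ratio at least $r$ on a set of instances if $\mathrm{ALG}(H)\ge r\,\mathrm{OPT}(H)$ for all $H$ in it. For a family $\mathcal H$ let $\mathcal H_0$ be its instances without replenishment, and $\mathcal H(c),\mathcal H_0(c)$ the instances with $c_{\min}\ge c$. Assume that $w_{ij}\le M$ throughout $\mathcal H$; that choosing an action for a request uses at most $d\ge1$ resource types; and that $\mathcal H$ is closed in the following sense: removing the replenishment from an instance of $\mathcal H$ gives an instance of $\mathcal H_0$, and adding copies of resource types to an instance of $\mathcal H_0$ gives an instance of $\mathcal H_0$. Here one adds, for some pairs $(i,j)$, a copy $i_j$ of resource $i$ with a positive initial inventory, the duplicates of the actions obtained by replacing the use of resources by the use of their copies, and the same profits (objective $i_j$ earns the profit of objective $i$), except that an action earns $0$ at requests that come before one of the copies it uses is introduced (copy $i_j$ is introduced at request $j$). **Batching extension.**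 Put $\varepsilon(x)=\min\{(\tfrac{3M}{x}\log(xd))^{1/3},1\}$. For $H\in\mathcal H$ let $\varepsilon=\varepsilon(c_{\min})$ and accumulate, for each $i$, the fluid replenishment $(1-\varepsilon)q_{ij}$, $j=1,2,\dots$; whenever the accumulated amount reaches $\varepsilon c_{\min}$ at some request $j$ and is positive, let it be the batch $\zeta_i^B(j)$, and restart from $0$. The batched instance $H_B\in\mathcal H_0$ is $H$ without replenishment, with a copy $i_j$ of inventory $\zeta^B_i(j)$ added for every batch. The batching extension ALG-B runs ALG virtually on $H_B$; for each request it performs the original of the action chosen by ALG if that action uses only copies introduced so far and its original is implementable for the real inventory, and $k_0$ otherwise; in both cases ALG continues as if its action had been performed (if it was not, its outcome is simulated). **Theorem.** For every $M_0>0$ there are constants $C,c_0>0$, depending only on $M_0$, such that the following holds for all $M\ge M_0$, $d\ge1$, $c\ge c_0$, every family $\mathcal H$ as above, every online algorithm ALG, and every function $\alpha$ such that, for all $x>0$, $\alpha(x)\ge0$ and ALG has competitive ratio at least $\alpha(x)$ on $\mathcal H_0(x)$. With $g=\varepsilon(c)\,c$ one has $$g\le C\,M^{1/3}c^{2/3}\log(cd),$$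 and the batching extension ALG-B, which is an online algorithm, has competitive ratio at least $$\alpha(g)\,\bigl(1-C\,M^{1/3}c^{-1/3}\log(cd)\bigr)$$ on $\mathcal H(c)$. -/

import Mathlib

open MeasureTheory

/-- What is revealed by performing one action: for every resource `i` and every request index `l`
the amount of `i` still consumed by the action when request `l` arrives, and for every `i` the
profit earned for objective `i`. -/
abbrev Outcome (I : Type) (m : ℕ) : Type := (I → Fin m → ℝ) × (I → ℝ)

/-- An instance of the online resource allocation framework with stochastic arrivals, stochastic
usage and stochastic replenishment. Requests are indexed by `Fin m`.
* `inv i` is the initial inventory, `p j` the distribution of the type of request `j`;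
* `law j k z` is the joint law of the consumptions `A_{ijkz}(l)` and the rewards `R_{ijkz}`;
  `A_{ijkz}(l)` takes the values `0` and `b i j k z l ≤ 1` and is non-increasing in `l ≥ j`;
* the replenishment `ζ_i(j)` equals `w i j` with probability `ρ i j`, and `0` otherwise. -/
structure AllocInstance : Type 1 where
  I : Type
  K : Type
  Z : Type
  m : ℕ
  [fintypeI : Fintype I]
  [fintypeK : Fintype K]
  [fintypeZ : Fintype Z]
  [nonemptyI : Nonempty I]
  inv : I → ℝ
  inv_nonneg : ∀ i, 0 ≤ inv i
  p : Fin m → PMF Z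
  k₀ : K
  b : I → Fin m → K → Z → Fin m → ℝ
  b_nonneg : ∀ i j k z l, j ≤ l → 0 ≤ b i j k z l
  b_le_one : ∀ i j k z l, j ≤ l → b i j k z l ≤ 1
  b_trivial : ∀ i j z l, j ≤ l → b i j k₀ z l = 0
  law : Fin m → K → Z → Measure (Outcome I m)
  law_prob : ∀ j k z, IsProbabilityMeasure (law j k z)
  law_two_point : ∀ j k z, ∀ᵐ o ∂(law j k z), ∀ i l, j ≤ l → o.1 i l = 0 ∨ o.1 i l = b i j k z l
  law_antitone : ∀ j k z, ∀ᵐ o ∂(law j k z), ∀ i l l', j ≤ l → l ≤ l' → o.1 i l' ≤ o.1 i l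
  reward_nonneg : ∀ j k z, ∀ᵐ o ∂(law j k z), ∀ i, 0 ≤ o.2 i
  reward_integrable : ∀ j k z i, Integrable (fun o : Outcome I m => o.2 i) (law j k z)
  w : I → Fin m → ℝ
  w_nonneg : ∀ i j, 0 ≤ w i j
  ρ : I → Fin m → ℝ
  ρ_nonneg : ∀ i j, 0 ≤ ρ i j
  ρ_le_one : ∀ i j, ρ i j ≤ 1

namespace AllocInstance

attribute [instance] AllocInstance.fintypeI AllocInstance.fintypeK AllocInstance.fintypeZ
  AllocInstance.nonemptyI AllocInstance.law_prob

instance (H : AllocInstance) : MeasurableSpace H.K := ⊤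
instance (H : AllocInstance) : MeasurableSpace H.Z := ⊤
instance (H : AllocInstance) : DiscreteMeasurableSpace H.K := ⟨fun _ => trivial⟩
instance (H : AllocInstance) : DiscreteMeasurableSpace H.Z := ⟨fun _ => trivial⟩

/-- The minimum initial inventory. -/
noncomputable def cMin (H : AllocInstance) : ℝ := ⨅ i, H.inv i

/-- The expected replenishment `q_{ij}`. -/
def q (H : AllocInstance) (i : H.I) (j : Fin H.m) : ℝ := H.ρ i j * H.w i j

/-- The law of the replenishment `ζ_i(j)`. -/
noncomputable def replLaw (H : AllocInstance) (i : H.I) (j : Fin H.m) : Measure ℝ :=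
  ENNReal.ofReal (H.ρ i j) • Measure.dirac (H.w i j)
    + ENNReal.ofReal (1 - H.ρ i j) • Measure.dirac 0

instance (H : AllocInstance) (i : H.I) (j : Fin H.m) : IsProbabilityMeasure (H.replLaw i j) := by
  constructor
  have h1 := H.ρ_nonneg i j
  have h2 := H.ρ_le_one i j
  simp only [replLaw, Measure.coe_add, Measure.coe_smul, Pi.add_apply, Pi.smul_apply,
    measure_univ, smul_eq_mul, mul_one]
  rw [← ENNReal.ofReal_add h1 (by linarith)]
  simp

/-! ### Histories and policies -/

/-- A (possibly partially filled) record of a run: the types of the requests, the replenishments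
`ζ_i(j)` (as `j ↦ i ↦ ζ_i(j)`), and, for each request handled so far, the consumptions and the
rewards of the action performed for it. -/
abbrev Trace (H : AllocInstance) : Type :=
  (Fin H.m → H.Z) × (Fin H.m → H.I → ℝ) × (Fin H.m → H.I → Fin H.m → ℝ) × (Fin H.m → H.I → ℝ)

namespace Trace

variable {H : AllocInstance}

/-- The request types. -/
def types (τ : H.Trace) : Fin H.m → H.Z := τ.1
/-- The replenishments. -/
def repl (τ : H.Trace) : Fin H.m → H.I → ℝ := τ.2.1
/-- `τ.cons t i l`: consumption of resource `i`, at the arrival of request `l`, by the action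
performed for request `t`. -/
def cons (τ : H.Trace) : Fin H.m → H.I → Fin H.m → ℝ := τ.2.2.1
/-- `τ.rew t i`: profit for objective `i` earned at request `t`. -/
def rew (τ : H.Trace) : Fin H.m → H.I → ℝ := τ.2.2.2

/-- Write the outcome of the action performed for request `j` into the record. -/
def record (τ : H.Trace) (j : Fin H.m) (o : Outcome H.I H.m) : H.Trace :=
  (τ.types, τ.repl, Function.update τ.cons j o.1, Function.update τ.rew j o.2)

/-- Remaining inventory of resource `i` when a decision is due for request `j`
(the replenishment of request `j` has arrived). -/
noncomputable def remaining (τ : H.Trace) (j : Fin H.m) (i : H.I) : ℝ :=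
  H.inv i + ∑ t ∈ Finset.Iic j, τ.repl t i - ∑ t ∈ Finset.Iio j, τ.cons t i j

/-- Action `k` is implementable for request `j`: for every resource it uses, the remaining
inventory is at least the maximal consumption. -/
def Implementable (τ : H.Trace) (j : Fin H.m) (k : H.K) : Prop :=
  ∀ i, H.b i j k (τ.types j) j ≠ 0 → H.b i j k (τ.types j) j ≤ τ.remaining j i

/-- Two records agree on the consumptions and rewards that are visible when the decision for
request `j` is taken: those of earlier actions, the consumptions only up to the arrival of `j`. -/
def SameOutcomes (j : Fin H.m) (τ τ' : H.Trace) : Prop :=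
  (∀ t < j, ∀ i, ∀ l ≤ j, τ.cons t i l = τ'.cons t i l) ∧ (∀ t < j, ∀ i, τ.rew t i = τ'.rew t i)

end Trace

/-- A randomized policy that may know the whole sequence of request types and replenishments in
advance, but learns consumptions and rewards only as they are realized. `Seed` carries its internal
randomness; its own past actions are a function of the seed and of the record. Only implementable
actions may be chosen. These are the policies over which the clairvoyant benchmark optimizes. -/
structure Policy (H : AllocInstance) : Type 1 where
  Seed : Type
  [seedSpace : MeasurableSpace Seed]
  seedLaw : Measure Seed
  [seedLaw_prob : IsProbabilityMeasure seedLaw]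
  act : Seed → Fin H.m → H.Trace → H.K
  measurable_act : ∀ j, Measurable fun x : Seed × H.Trace => act x.1 j x.2
  implementable : ∀ u j τ, Trace.Implementable τ j (act u j τ)
  nonanticipating : ∀ u j (τ τ' : H.Trace), τ.types = τ'.types → τ.repl = τ'.repl →
    Trace.SameOutcomes j τ τ' → act u j τ = act u j τ'

attribute [instance] Policy.seedSpace Policy.seedLaw_prob

/-- An online policy: it sees types and replenishments only up to the current request. -/
structure OnlinePolicy (H : AllocInstance) : Type 1 extends Policy H where
  online : ∀ u j (τ τ' : H.Trace), (∀ t ≤ j, τ.types t = τ'.types t) →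
    (∀ t ≤ j, ∀ i, τ.repl t i = τ'.repl t i) → Trace.SameOutcomes j τ τ' → act u j τ = act u j τ'

/-- The law of the sequence of request types. -/
noncomputable def typesLaw (H : AllocInstance) : Measure (Fin H.m → H.Z) :=
  Measure.pi fun j => (H.p j).toMeasure

/-- The law of the replenishments. -/
noncomputable def replsLaw (H : AllocInstance) : Measure (Fin H.m → H.I → ℝ) :=
  Measure.pi fun j => Measure.pi fun i => H.replLaw i j

/-- The law of the table of outcomes, independent over `(j, k, z)`. -/
noncomputable def tableLaw (H : AllocInstance) :
    Measure (Fin H.m → H.K → H.Z → Outcome H.I H.m) :=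
  Measure.pi fun j => Measure.pi fun k => Measure.pi fun z => H.law j k z

instance (H : AllocInstance) : IsProbabilityMeasure H.typesLaw := by
  unfold typesLaw; infer_instance
instance (H : AllocInstance) : IsProbabilityMeasure H.replsLaw := by
  unfold replsLaw; infer_instance
instance (H : AllocInstance) : IsProbabilityMeasure H.tableLaw := by
  unfold tableLaw; infer_instance

namespace Policy

variable {H : AllocInstance}

/-- The record after the first `n` requests, for given types `z`, replenishments `ζ`, outcomes `o`
and seed `u`. -/
def trace (π : Policy H) (z : Fin H.m → H.Z) (ζ : Fin H.m → H.I → ℝ)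
    (o : Fin H.m → H.K → H.Z → Outcome H.I H.m) (u : π.Seed) : ℕ → H.Trace
  | 0 => (z, ζ, 0, 0)
  | n + 1 =>
    if h : n < H.m then
      (π.trace z ζ o u n).record ⟨n, h⟩ (o ⟨n, h⟩ (π.act u ⟨n, h⟩ (π.trace z ζ o u n)) (z ⟨n, h⟩))
    else π.trace z ζ o u n

/-- The expected profit for objective `i` over the whole run. -/
noncomputable def profit (π : Policy H) (i : H.I) : ℝ :=
  ∫ x, ∑ j, (π.trace x.1 x.2.1 x.2.2.1 x.2.2.2 H.m).rew j i
    ∂(H.typesLaw.prod (H.replsLaw.prod (H.tableLaw.prod π.seedLaw)))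

/-- The performance of a policy: the minimum over the objectives of the expected profit,
`min_i ∑_{j,k,z} r_{ijkz} 𝔼[X_{jkz}]`. -/
noncomputable def value (π : Policy H) : ℝ := ⨅ i, π.profit i

end Policy

/-- The clairvoyant benchmark. -/
noncomputable def OPT (H : AllocInstance) : ℝ := sSup {v | ∃ π : Policy H, v = π.value}

/-! ### Adding copies of resources -/

/-- The instance with the replenishment removed. -/
def noRepl (H : AllocInstance) : AllocInstance :=
  { H with w := fun _ _ => 0, w_nonneg := fun _ _ => le_rfl }

/-- The versions of resource `i`: the original (`none`), and a copy `some j`, introduced at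
request `j`, for each `j` with positive stock. -/
abbrev Version (H : AllocInstance) (stock : H.I → Fin H.m → ℝ) (i : H.I) : Type :=
  {v : Option (Fin H.m) // ∀ j, v = some j → 0 < stock i j}

/-- The resource types after adding the copies. -/
abbrev CopyI (H : AllocInstance) (stock : H.I → Fin H.m → ℝ) : Type := Σ i, H.Version stock i

/-- The actions after adding the copies: an original action, with the version of each resource that
is to be used. -/
abbrev CopyK (H : AllocInstance) (stock : H.I → Fin H.m → ℝ) : Type :=
  H.K × ((i : H.I) → H.Version stock i)

/-- All versions of resources that the action uses have been introduced by request `j`. -/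
def Active (H : AllocInstance) {stock : H.I → Fin H.m → ℝ} (j : Fin H.m) (κ : H.CopyK stock)
    (z : H.Z) : Prop :=
  ∀ i, H.b i j κ.1 z j ≠ 0 → ∀ t, (κ.2 i).1 = some t → t ≤ j

open Classical in
/-- The outcome of the original action, read as an outcome of the action `κ`: consumption is charged
to the chosen versions, every version of a resource earns the profit of the original, and actions
using a version that has not been introduced yet earn nothing. -/
noncomputable def lift (H : AllocInstance) {stock : H.I → Fin H.m → ℝ} (j : Fin H.m)
    (κ : H.CopyK stock) (z : H.Z) (o : Outcome H.I H.m) : Outcome (H.CopyI stock) H.m :=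
  (fun x l => if κ.2 x.1 = x.2 then o.1 x.1 l else 0,
   fun x => if H.Active j κ z then o.2 x.1 else 0)

theorem measurable_lift (H : AllocInstance) {stock : H.I → Fin H.m → ℝ} (j : Fin H.m)
    (κ : H.CopyK stock) (z : H.Z) : Measurable (H.lift j κ z) := by
  unfold lift
  refine Measurable.prodMk ?_ ?_
  · refine measurable_pi_lambda _ fun x => measurable_pi_lambda _ fun l => ?_
    split_ifs <;> fun_prop
  · refine measurable_pi_lambda _ fun x => ?_
    split_ifs <;> fun_prop

open Classical in
/-- The fixed-inventory instance in which, for every `i` and `j` with `0 < stock i j`, a copy of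
resource `i` with initial inventory `stock i j` is added, together with the corresponding duplicates
of the actions; duplicates earn rewards only from request `j` on. -/
noncomputable def addCopies (H : AllocInstance) (stock : H.I → Fin H.m → ℝ) : AllocInstance where
  I := H.CopyI stock
  K := H.CopyK stock
  Z := H.Z
  m := H.m
  fintypeI := inferInstance
  fintypeK := inferInstance
  fintypeZ := inferInstance
  nonemptyI := ⟨⟨Classical.arbitrary H.I, ⟨none, by simp⟩⟩⟩
  inv := fun x => x.2.1.elim (H.inv x.1) (fun j => stock x.1 j)
  inv_nonneg := by
    rintro ⟨i, v, hv⟩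
    cases v with
    | none => exact H.inv_nonneg i
    | some j => exact (hv j rfl).le
  p := H.p
  k₀ := (H.k₀, fun _ => ⟨none, by simp⟩)
  b := fun x j κ z l => if κ.2 x.1 = x.2 then H.b x.1 j κ.1 z l else 0
  b_nonneg := by
    intro x j κ z l h
    split_ifs
    exacts [H.b_nonneg _ _ _ _ _ h, le_rfl]
  b_le_one := by
    intro x j κ z l h
    split_ifs
    exacts [H.b_le_one _ _ _ _ _ h, zero_le_one]
  b_trivial := by
    intro x j z l h
    split_ifs
    exacts [H.b_trivial _ _ _ _ h, rfl]
  law := fun j κ z => (H.law j κ.1 z).map (H.lift j κ z)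
  law_prob := fun j κ z =>
    Measure.isProbabilityMeasure_map (H.measurable_lift j κ z).aemeasurable
  law_two_point := by
    intro j κ z
    refine (ae_map_iff (H.measurable_lift j κ z).aemeasurable ?_).2 ?_
    · simp only [Set.ofPred_forall, Set.ofPred_or]
      refine MeasurableSet.iInter fun x => MeasurableSet.iInter fun l => MeasurableSet.iInter fun _ =>
        MeasurableSet.union ?_ ?_ <;>
      exact measurableSet_eq_fun (by fun_prop) measurable_const
    · filter_upwards [H.law_two_point j κ.1 z] with o ho x l hl
      by_cases hx : κ.2 x.1 = x.2
      · simpa [lift, hx] using ho x.1 l hl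
      · simp [lift, hx]
  law_antitone := by
    intro j κ z
    refine (ae_map_iff (H.measurable_lift j κ z).aemeasurable ?_).2 ?_
    · simp only [Set.ofPred_forall]
      refine MeasurableSet.iInter fun x => MeasurableSet.iInter fun l => MeasurableSet.iInter fun l' =>
        MeasurableSet.iInter fun _ => MeasurableSet.iInter fun _ => ?_
      exact measurableSet_le (by fun_prop) (by fun_prop)
    · filter_upwards [H.law_antitone j κ.1 z] with o ho x l l' hl hl'
      by_cases hx : κ.2 x.1 = x.2
      · simpa [lift, hx] using ho x.1 l l' hl hl'
      · simp [lift, hx]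
  reward_nonneg := by
    intro j κ z
    refine (ae_map_iff (H.measurable_lift j κ z).aemeasurable ?_).2 ?_
    · simp only [Set.ofPred_forall]
      refine MeasurableSet.iInter fun x => ?_
      exact measurableSet_le measurable_const (by fun_prop)
    · filter_upwards [H.reward_nonneg j κ.1 z] with o ho x
      by_cases hx : H.Active j κ z
      · simpa [lift, hx] using ho x.1
      · simp [lift, hx]
  reward_integrable := by
    intro j κ z x
    refine (integrable_map_measure (Measurable.aestronglyMeasurable (by fun_prop))
      (H.measurable_lift j κ z).aemeasurable).2 ?_
    by_cases hx : H.Active j κ z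
    · simpa [lift, hx, Function.comp_def] using H.reward_integrable j κ.1 z x.1
    · simp [lift, hx, Function.comp_def]
  w := fun _ _ => 0
  w_nonneg := fun _ _ => le_rfl
  ρ := fun _ _ => 0
  ρ_nonneg := fun _ _ => le_rfl
  ρ_le_one := fun _ _ => zero_le_one

/-! ### The batched instance -/

/-- The parameter `ε` for replenishments at most `M`, minimum inventory `c`, and at most `d`
resource types per action. -/
noncomputable def eps (M : ℝ) (d : ℕ) (c : ℝ) : ℝ :=
  min ((3 * M / c * Real.log (c * d)) ^ (1 / 3 : ℝ)) 1

/-- The fluid replenishment `ζ^F_i(j)`. -/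
noncomputable def fluid (H : AllocInstance) (M : ℝ) (d : ℕ) (i : H.I) (j : Fin H.m) : ℝ :=
  (1 - eps M d H.cMin) * H.q i j

/-- The batching threshold `c_B`. -/
noncomputable def threshold (H : AllocInstance) (M : ℝ) (d : ℕ) : ℝ := eps M d H.cMin * H.cMin

open Classical in
/-- The fluid replenishment of resource `i` accumulated before request number `n` and not yet
batched. -/
noncomputable def pending (H : AllocInstance) (M : ℝ) (d : ℕ) (i : H.I) : ℕ → ℝ
  | 0 => 0
  | n + 1 =>
    if h : n < H.m then
      if H.threshold M d ≤ H.pending M d i n + H.fluid M d i ⟨n, h⟩ then 0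
      else H.pending M d i n + H.fluid M d i ⟨n, h⟩
    else H.pending M d i n

open Classical in
/-- The batched replenishment `ζ^B_i(j)`. -/
noncomputable def batch (H : AllocInstance) (M : ℝ) (d : ℕ) (i : H.I) (j : Fin H.m) : ℝ :=
  if H.threshold M d ≤ H.pending M d i j + H.fluid M d i j then
    H.pending M d i j + H.fluid M d i j
  else 0

/-- The batched instance `H_B`: the (random) replenishment is dropped, and for each positive batched
replenishment `ζ^B_i(j)` a copy of resource `i` with that initial inventory is added. -/
noncomputable def batched (H : AllocInstance) (M : ℝ) (d : ℕ) : AllocInstance :=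
  H.addCopies (H.batch M d)

/-! ### The batching extension -/

section Extension

variable {H : AllocInstance} {M : ℝ} {d : ℕ}

/-- The virtual action `κ` is executed in reality for request `j`: it was introduced by request `j`
and the underlying original action is implementable for the real inventory. -/
def Executable (τ : H.Trace) (j : Fin H.m) (κ : (H.batched M d).K) : Prop :=
  H.Active (stock := H.batch M d) j κ (τ.types j) ∧ Trace.Implementable τ j κ.1

open Classical in
/-- The virtual outcome of the virtual action `κ` at request `j`: the real outcome if the action was
executed, and an outcome drawn from the simulated table `σ` otherwise. -/
noncomputable def virtualOutcome (τ : H.Trace) (σ : Fin H.m → H.K → H.Z → Outcome H.I H.m)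
    (j : Fin H.m) (κ : (H.batched M d).K) : Outcome (H.batched M d).I (H.batched M d).m :=
  H.lift (stock := H.batch M d) j κ (τ.types j)
    (if Executable τ j κ then (τ.cons j, τ.rew j) else σ j κ.1 (τ.types j))

/-- The record of the virtual run of `π` on the batched instance after `n` requests, computed from
the real record `τ`, the seed `u` of `π` and the simulated table `σ`. -/
noncomputable def virtualTrace (π : OnlinePolicy (H.batched M d)) (u : π.Seed)
    (σ : Fin H.m → H.K → H.Z → Outcome H.I H.m) (τ : H.Trace) : ℕ → (H.batched M d).Trace
  | 0 => (τ.types, 0, 0, 0)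
  | n + 1 =>
    if h : n < H.m then
      (virtualTrace π u σ τ n).record ⟨n, h⟩
        (virtualOutcome τ σ ⟨n, h⟩ (π.act u ⟨n, h⟩ (virtualTrace π u σ τ n)))
    else virtualTrace π u σ τ n

/-- The action that `π` chooses for request `j` in the virtual run. -/
noncomputable def virtualAct (π : OnlinePolicy (H.batched M d)) (u : π.Seed)
    (σ : Fin H.m → H.K → H.Z → Outcome H.I H.m) (j : Fin H.m) (τ : H.Trace) :
    (H.batched M d).K :=
  π.act u j (virtualTrace π u σ τ j)

open Classical in
/-- The action performed in reality: the original of the virtual action if it can be executed, and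
the trivial action otherwise. -/
noncomputable def realAct (π : OnlinePolicy (H.batched M d)) (u : π.Seed)
    (σ : Fin H.m → H.K → H.Z → Outcome H.I H.m) (j : Fin H.m) (τ : H.Trace) : H.K :=
  if Executable τ j (virtualAct π u σ j τ) then (virtualAct π u σ j τ).1 else H.k₀

open Classical in
theorem implementable_realAct (π : OnlinePolicy (H.batched M d)) (u : π.Seed)
    (σ : Fin H.m → H.K → H.Z → Outcome H.I H.m) (j : Fin H.m) (τ : H.Trace) :
    Trace.Implementable τ j (realAct π u σ j τ) := by
  by_cases h : Executable τ j (virtualAct π u σ j τ)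
  · simpa only [realAct, if_pos h] using h.2
  · simp only [realAct, if_neg h]
    intro i hi
    exact absurd (H.b_trivial i j _ j le_rfl) hi

theorem measurableSet_executable (j : Fin H.m) (κ : (H.batched M d).K) :
    MeasurableSet {τ : H.Trace | Executable τ j κ} := by
  have hz : Measurable fun τ : H.Trace => τ.types j := by
    unfold Trace.types; fun_prop
  have hrem : ∀ i, Measurable fun τ : H.Trace => Trace.remaining τ j i := by
    intro i
    unfold Trace.remaining Trace.repl Trace.cons
    fun_prop
  have key : {τ : H.Trace | Executable τ j κ} = ⋃ z : H.Z, ({τ : H.Trace | τ.types j = z} ∩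
      {τ : H.Trace | H.Active (stock := H.batch M d) j κ z ∧
        ∀ i, H.b i j κ.1 z j ≠ 0 → H.b i j κ.1 z j ≤ Trace.remaining τ j i}) := by
    ext τ
    simp [Executable, Trace.Implementable]
  rw [key]
  refine MeasurableSet.iUnion fun z => (hz (measurableSet_singleton z)).inter ?_
  have hcap : MeasurableSet {τ : H.Trace |
      ∀ i, H.b i j κ.1 z j ≠ 0 → H.b i j κ.1 z j ≤ Trace.remaining τ j i} := by
    simp only [Set.ofPred_forall]
    exact MeasurableSet.iInter fun i => MeasurableSet.iInter fun _ =>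
      measurableSet_le measurable_const (hrem i)
  exact (MeasurableSet.const _).inter hcap

theorem measurable_virtualOutcome (j : Fin H.m) :
    Measurable fun x : (H.batched M d).K × (Fin H.m → H.K → H.Z → Outcome H.I H.m) × H.Trace =>
      virtualOutcome x.2.2 x.2.1 j x.1 := by
  refine measurable_from_prod_countable_right fun κ => ?_
  have hz : Measurable fun x : (Fin H.m → H.K → H.Z → Outcome H.I H.m) × H.Trace =>
      x.2.types j := by
    unfold Trace.types; fun_prop
  have main : Measurable fun y : H.Z × (Fin H.m → H.K → H.Z → Outcome H.I H.m) × H.Trace =>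
      H.lift (stock := H.batch M d) j κ y.1
        (@ite _ (Executable y.2.2 j κ) (Classical.propDecidable _)
          (y.2.2.cons j, y.2.2.rew j) (y.2.1 j κ.1 y.1)) := by
    refine measurable_from_prod_countable_right fun z => ?_
    refine (H.measurable_lift (stock := H.batch M d) j κ z).comp ?_
    refine Measurable.ite (measurable_snd (measurableSet_executable j κ)) ?_ ?_
    · unfold Trace.cons Trace.rew; fun_prop
    · exact (measurable_pi_apply z).comp ((measurable_pi_apply κ.1).comp
        ((measurable_pi_apply j).comp measurable_fst))
  exact main.comp (hz.prodMk measurable_id)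

theorem measurable_virtualTrace (π : OnlinePolicy (H.batched M d)) (n : ℕ) :
    Measurable fun x : (π.Seed × (Fin H.m → H.K → H.Z → Outcome H.I H.m)) × H.Trace =>
      virtualTrace π x.1.1 x.1.2 x.2 n := by
  induction n with
  | zero =>
    unfold virtualTrace Trace.types
    exact Measurable.prodMk (by fun_prop) measurable_const
  | succ n ih =>
    unfold virtualTrace
    split_ifs with h
    · have hact := (π.measurable_act ⟨n, h⟩).comp ((measurable_fst.comp measurable_fst).prodMk ih)
      have hout := (measurable_virtualOutcome (H := H) (M := M) (d := d) ⟨n, h⟩).comp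
        (hact.prodMk ((measurable_snd.comp measurable_fst).prodMk measurable_snd))
      refine (measurable_fst.comp ih).prodMk
        ((measurable_fst.comp (measurable_snd.comp ih)).prodMk (Measurable.prodMk ?_ ?_))
      · refine measurable_pi_lambda _ fun t => ?_
        by_cases ht : t = ⟨n, h⟩
        · subst ht
          simpa [Function.comp_def] using measurable_fst.comp hout
        · simp only [Function.update_of_ne ht]
          exact (measurable_pi_apply t).comp
            (measurable_fst.comp (measurable_snd.comp (measurable_snd.comp ih)))
      · refine measurable_pi_lambda _ fun t => ?_
        by_cases ht : t = ⟨n, h⟩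
        · subst ht
          simpa [Function.comp_def] using measurable_snd.comp hout
        · simp only [Function.update_of_ne ht]
          exact (measurable_pi_apply t).comp
            (measurable_snd.comp (measurable_snd.comp (measurable_snd.comp ih)))
    · exact ih

theorem measurable_realAct (π : OnlinePolicy (H.batched M d)) (j : Fin H.m) :
    Measurable fun x : (π.Seed × (Fin H.m → H.K → H.Z → Outcome H.I H.m)) × H.Trace =>
      realAct π x.1.1 x.1.2 j x.2 := by
  have hact := (π.measurable_act j).comp
    ((measurable_fst.comp measurable_fst).prodMk (measurable_virtualTrace π j))
  have main : Measurable fun y : (H.batched M d).K × H.Trace =>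
      @ite _ (Executable y.2 j y.1) (Classical.propDecidable _) y.1.1 H.k₀ := by
    refine measurable_from_prod_countable_right fun κ => ?_
    exact Measurable.ite (f := fun _ : H.Trace => κ.1) (g := fun _ : H.Trace => H.k₀)
      (measurableSet_executable j κ) measurable_const measurable_const
  exact main.comp (hact.prodMk measurable_snd)

/-- Two real records that cannot be distinguished online when request `j` is decided. -/
def SameOnline (j : Fin H.m) (τ τ' : H.Trace) : Prop :=
  (∀ t ≤ j, τ.types t = τ'.types t) ∧ (∀ t ≤ j, ∀ i, τ.repl t i = τ'.repl t i) ∧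
    Trace.SameOutcomes j τ τ'

theorem SameOnline.mono {j j' : Fin H.m} (hj : j' ≤ j) {τ τ' : H.Trace}
    (h : SameOnline j τ τ') : SameOnline j' τ τ' :=
  ⟨fun t ht => h.1 t (ht.trans hj), fun t ht => h.2.1 t (ht.trans hj),
    fun t ht i l hl => h.2.2.1 t (ht.trans_le hj) i l (hl.trans hj),
    fun t ht => h.2.2.2 t (ht.trans_le hj)⟩

theorem executable_congr {j : Fin H.m} {τ τ' : H.Trace} (h : SameOnline j τ τ')
    (κ : (H.batched M d).K) : Executable τ j κ ↔ Executable τ' j κ := by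
  have hrem : ∀ i, Trace.remaining τ j i = Trace.remaining τ' j i := by
    intro i
    unfold Trace.remaining
    congr 1
    · congr 1
      exact Finset.sum_congr rfl fun t ht => h.2.1 t (Finset.mem_Iic.1 ht) i
    · exact Finset.sum_congr rfl fun t ht => h.2.2.1 t (Finset.mem_Iio.1 ht) i j le_rfl
  simp only [Executable, Trace.Implementable, h.1 j le_rfl, hrem]

theorem lift_congr (H : AllocInstance) {stock : H.I → Fin H.m → ℝ} (j j' : Fin H.m)
    (κ : H.CopyK stock) {z z' : H.Z} (hz : z = z') {o o' : Outcome H.I H.m}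
    (h1 : ∀ i, ∀ l ≤ j', o.1 i l = o'.1 i l) (h2 : ∀ i, o.2 i = o'.2 i) :
    (∀ x, ∀ l ≤ j', (H.lift j κ z o).1 x l = (H.lift j κ z' o').1 x l) ∧
      ∀ x, (H.lift j κ z o).2 x = (H.lift j κ z' o').2 x := by
  subst hz
  refine ⟨fun x l hl => ?_, fun x => ?_⟩
  · simp only [lift, h1 x.1 l hl]
  · simp only [lift, h2 x.1]

theorem virtualOutcome_congr (σ : Fin H.m → H.K → H.Z → Outcome H.I H.m) {t j : Fin H.m}
    {τ τ' : H.Trace} (h : SameOnline j τ τ') (ht : t < j) {κ : (H.batched M d).K}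
    (he : Executable τ t κ ↔ Executable τ' t κ) :
    (∀ x, ∀ l ≤ j, (virtualOutcome τ σ t κ).1 x l = (virtualOutcome τ' σ t κ).1 x l) ∧
      ∀ x, (virtualOutcome τ σ t κ).2 x = (virtualOutcome τ' σ t κ).2 x := by
  have hz := h.1 t ht.le
  refine lift_congr H (stock := H.batch M d) t j κ hz ?_ ?_
  · intro i l hl
    by_cases hx : Executable τ t κ
    · simpa only [if_pos hx, if_pos (he.1 hx)] using h.2.2.1 t ht i l hl
    · simp only [if_neg hx, if_neg (fun hy => hx (he.2 hy)), hz]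
  · intro i
    by_cases hx : Executable τ t κ
    · simpa only [if_pos hx, if_pos (he.1 hx)] using h.2.2.2 t ht i
    · simp only [if_neg hx, if_neg (fun hy => hx (he.2 hy)), hz]

theorem virtualTrace_congr (π : OnlinePolicy (H.batched M d)) (u : π.Seed)
    (σ : Fin H.m → H.K → H.Z → Outcome H.I H.m) {j : Fin H.m} {τ τ' : H.Trace}
    (h : SameOnline j τ τ') (n : ℕ) (hn : n ≤ j) :
    (∀ t ≤ j, (virtualTrace π u σ τ n).types t = (virtualTrace π u σ τ' n).types t) ∧
    (∀ t i, (virtualTrace π u σ τ n).repl t i = (virtualTrace π u σ τ' n).repl t i) ∧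
    (∀ t i, ∀ l ≤ j, (virtualTrace π u σ τ n).cons t i l = (virtualTrace π u σ τ' n).cons t i l) ∧
    (∀ t i, (virtualTrace π u σ τ n).rew t i = (virtualTrace π u σ τ' n).rew t i) := by
  induction n with
  | zero => exact ⟨h.1, fun _ _ => rfl, fun _ _ _ _ => rfl, fun _ _ => rfl⟩
  | succ n ih =>
    obtain ⟨h1, h2, h3, h4⟩ := ih (by omega)
    have hm : n < H.m := by omega
    have hlt : (⟨n, hm⟩ : Fin H.m) < j := by
      rw [Fin.lt_def]; exact hn
    have hk : π.act u ⟨n, hm⟩ (virtualTrace π u σ τ n) =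
        π.act u ⟨n, hm⟩ (virtualTrace π u σ τ' n) :=
      π.online u ⟨n, hm⟩ _ _ (fun t ht => h1 t (le_trans ht hlt.le)) (fun t _ i => h2 t i)
        ⟨fun t _ i l hl => h3 t i l (le_trans hl hlt.le), fun t _ i => h4 t i⟩
    have hz := h.1 _ hlt.le
    have he := executable_congr (M := M) (d := d) (h.mono hlt.le)
      (π.act u ⟨n, hm⟩ (virtualTrace π u σ τ' n))
    have e1 : ∀ ρ : H.Trace, virtualTrace π u σ ρ (n + 1) =
        (virtualTrace π u σ ρ n).record ⟨n, hm⟩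
          (virtualOutcome ρ σ ⟨n, hm⟩ (π.act u ⟨n, hm⟩ (virtualTrace π u σ ρ n))) := by
      intro ρ
      rw [virtualTrace, dif_pos hm]
    rw [e1 τ, e1 τ', hk]
    generalize π.act u ⟨n, hm⟩ (virtualTrace π u σ τ' n) = κ at he
    obtain ⟨ho1, ho2⟩ := virtualOutcome_congr σ h hlt he
    refine ⟨h1, h2, fun t i l hl => ?_, fun t i => ?_⟩
    · by_cases ht : t = ⟨n, hm⟩
      · subst ht
        simpa [Trace.record, Trace.cons] using ho1 i l hl
      · simpa [Trace.record, Trace.cons, Function.update_of_ne ht] using h3 t i l hl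
    · by_cases ht : t = ⟨n, hm⟩
      · subst ht
        simpa [Trace.record, Trace.rew] using ho2 i
      · simpa [Trace.record, Trace.rew, Function.update_of_ne ht] using h4 t i

theorem realAct_congr (π : OnlinePolicy (H.batched M d)) (u : π.Seed)
    (σ : Fin H.m → H.K → H.Z → Outcome H.I H.m) {j : Fin H.m} {τ τ' : H.Trace}
    (h : SameOnline j τ τ') : realAct π u σ j τ = realAct π u σ j τ' := by
  obtain ⟨h1, h2, h3, h4⟩ := virtualTrace_congr π u σ h j le_rfl
  have hk : virtualAct π u σ j τ = virtualAct π u σ j τ' :=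
    π.online u j _ _ h1 (fun t _ i => h2 t i) ⟨fun t _ i l hl => h3 t i l hl, fun t _ i => h4 t i⟩
  have he := executable_congr h (virtualAct π u σ j τ')
  unfold realAct
  rw [hk]
  by_cases hx : Executable τ j (virtualAct π u σ j τ')
  · rw [if_pos hx, if_pos (he.1 hx)]
  · rw [if_neg hx, if_neg (fun hy => hx (he.2 hy))]

/-- The batching extension of a policy `π` for the batched instance, as an online policy for `H`.
Its internal randomness is the seed of `π` and an independent simulated table of outcomes. -/
noncomputable def extend (π : OnlinePolicy (H.batched M d)) : OnlinePolicy H where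
  Seed := π.Seed × (Fin H.m → H.K → H.Z → Outcome H.I H.m)
  seedLaw := π.seedLaw.prod H.tableLaw
  act := fun u j τ => realAct π u.1 u.2 j τ
  measurable_act := fun j => measurable_realAct π j
  implementable := fun u j τ => implementable_realAct π u.1 u.2 j τ
  nonanticipating := fun u _ _ _ hz hr ho => realAct_congr π u.1 u.2
    ⟨fun t _ => congrFun hz t, fun t _ i => congrFun (congrFun hr t) i, ho⟩
  online := fun u _ _ _ hz hr ho => realAct_congr π u.1 u.2 ⟨hz, hr, ho⟩

end Extension

/-! ### Algorithms, families of instances, competitive ratios -/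

/-- An online algorithm: it is given the instance, with all its distributions, in advance. -/
abbrev Algorithm : Type 1 := (H : AllocInstance) → OnlinePolicy H

/-- The batching extension of an algorithm: run it on the batched instance. -/
noncomputable def batchingExtension (M : ℝ) (d : ℕ) (ALG : Algorithm) : Algorithm :=
  fun H => extend (ALG (H.batched M d))

/-- `ALG` has competitive ratio at least `r` on the set `S` of instances. -/
def HasRatio (ALG : Algorithm) (S : Set AllocInstance) (r : ℝ) : Prop :=
  ∀ H ∈ S, r * H.OPT ≤ (ALG H).value

/-- The instances of a family with minimum initial inventory at least `c`. -/
def withInventory (F : Set AllocInstance) (c : ℝ) : Set AllocInstance := {H ∈ F | c ≤ H.cMin}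

/-- The instances of a family without replenishment. -/
def withoutReplenishment (F : Set AllocInstance) : Set AllocInstance :=
  {H ∈ F | ∀ i j, H.q i j = 0}

/-- Every replenishment in the family is at most `M`. -/
def ReplBoundedBy (F : Set AllocInstance) (M : ℝ) : Prop := ∀ H ∈ F, ∀ i j, H.w i j ≤ M

/-- Every action in the family uses at most `d` resource types. -/
def UsesAtMost (F : Set AllocInstance) (d : ℕ) : Prop :=
  ∀ H ∈ F, ∀ j k z, {i | H.b i j k z j ≠ 0}.ncard ≤ d

/-- The family is closed under dropping the replenishment and, among its instances without
replenishment, under adding copies of resource types. -/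
def ClosedFamily (F : Set AllocInstance) : Prop :=
  (∀ H ∈ F, H.noRepl ∈ F) ∧
    ∀ H ∈ withoutReplenishment F, ∀ stock, H.addCopies stock ∈ withoutReplenishment F

end AllocInstance

/-! Write `ε` for `eps M d H.cMin`. The batched instance mediates between `H` and the
fixed-inventory guarantee. Two comparisons carry the proof. By `mul_value_le_extend`, the extension
earns on `H` at least `1 - ε` times what the algorithm earns on `H.batched M d`. By
`mul_OPT_le_OPT_batched`, the benchmark of the batched instance is at least `(1 - 3ε)(1 - ε)` times
that of `H`. Every inventory of the batched instance is at least `ε * H.cMin`, which is at least `g`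
by `eps_mul_mono`, so the hypothesis on the algorithm connects the two with the factor `α g`. The
losses multiply to at least `1 - 5ε`, and `ε` is at most twice `M^(1/3) c^(-1/3) log (c d)`. When
that quantity is not small, the claimed ratio is nonpositive and nothing has to be shown.

First comparison. For any fixed types and replenishments, the virtual run has exactly the law of a
run on the batched instance (`lintegral_virtualRun`): whether an outcome is real or simulated is
decided before it is drawn. Hence the virtual run is independent of the real replenishment.
Pathwise, real consumption never exceeds virtual consumption, so a virtual action that could earn
anything is executed unless, for one of its at most `d` resources, the real replenishment lags
behind the batches (`executable_of_batch_le`). The batches total at most a `1 - ε` fraction of the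
mean replenishment, and none occurs before a mean of `ε * H.cMin` has accumulated, so a Chernoff
bound makes each lag exponentially unlikely (`replsLaw_shortage_le`). A union bound over the used
resources gives `profitAt_extend`.

Second comparison. The choices of a clairvoyant policy satisfy the inventory constraints in
expectation (`sum_meanCons_le`). On the batched instance, proposals are drawn independently from its
conditional choice laws given the current type, thinned by `1 - 3ε`, and served whenever each used
resource has an introduced version with a unit left. If no version has a unit left, the usage is at
least the total introduced stock minus one unit per version. Batching delay and this fragmentation
together cost a fraction of at most `2ε` of the fluid capacity, so thinning leaves a margin `ε`, and
a Chernoff bound makes scarcity unlikely (`exponent_le`, `tableLaw_scarce_le`). Scarcity is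
controlled by earlier proposals, which are independent of the current one, so the loss factors out
(`proposalMean_le_profitAt`).

Profits are handled as Lebesgue integrals in `ℝ≥0∞`, so that orders of integration can be changed
freely; `profit_eq` translates back. -/

open scoped ENNReal

/-! ### Integrals over finite product spaces -/

section Pi

variable {ι : Type*} [Fintype ι] {X : ι → Type*} [∀ i, MeasurableSpace (X i)]
  (μ : ∀ i, Measure (X i)) [∀ i, IsProbabilityMeasure (μ i)]

theorem lintegral_pi_eval (i : ι) {f : X i → ℝ≥0∞} (hf : Measurable f) :
    ∫⁻ x, f (x i) ∂Measure.pi μ = ∫⁻ y, f y ∂μ i :=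
  (measurePreserving_eval μ i).lintegral_comp hf

variable [DecidableEq ι]

/-- Resampling one coordinate does not change an integral over a product space. -/
theorem lintegral_pi_update (i : ι) {f : (∀ i, X i) → ℝ≥0∞} (hf : Measurable f) :
    ∫⁻ x, f x ∂Measure.pi μ = ∫⁻ x, ∫⁻ y, f (Function.update x i y) ∂μ i ∂Measure.pi μ := by
  obtain ⟨x₀⟩ : Nonempty (∀ i, X i) := (Measure.pi μ).nonempty_of_neZero
  have hg : Measurable fun x : ∀ i, X i => ∫⁻ y, f (Function.update x i y) ∂μ i := by
    have h : Measurable fun p : (∀ i, X i) × X i => f (Function.update p.1 i p.2) :=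
      hf.comp measurable_update'
    exact h.lintegral_prod_right'
  -- Both integrals become marginals over all coordinates, with coordinate `i` integrated first. On
  -- the right the integrand no longer depends on that coordinate, so integrating it again has no
  -- effect.
  rw [lintegral_eq_lmarginal_univ x₀, lintegral_eq_lmarginal_univ x₀,
    lmarginal_erase' f hf (Finset.mem_univ i), lmarginal_erase' _ hg (Finset.mem_univ i)]
  simp

theorem lintegral_pi_prod (s : Finset ι) {f : ∀ i, X i → ℝ≥0∞} (hf : ∀ i, Measurable (f i)) :
    ∫⁻ x, ∏ i ∈ s, f i (x i) ∂Measure.pi μ = ∏ i ∈ s, ∫⁻ y, f i y ∂μ i := by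
  induction s using Finset.induction_on with
  | empty => simp
  | insert a s ha ih =>
    rw [lintegral_pi_update μ a (by fun_prop), Finset.prod_insert ha, ← ih]
    have h : ∀ (x : ∀ i, X i) (y : X a),
        ∏ i ∈ insert a s, f i (Function.update x a y i) = f a y * ∏ i ∈ s, f i (x i) := by
      intro x y
      rw [Finset.prod_insert ha, Function.update_self]
      congr 1
      refine Finset.prod_congr rfl fun i hi => ?_
      rw [Function.update_of_ne (ne_of_mem_of_not_mem hi ha)]
    simp_rw [h]
    rw [← lintegral_const_mul _ (by fun_prop)]
    refine lintegral_congr fun x => ?_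
    rw [lintegral_mul_const _ (hf a)]

end Pi

namespace AllocInstance

/-! ### Tables of outcomes -/

/-- A table of outcomes of all actions, for all requests and request types. -/
abbrev Table (H : AllocInstance) : Type := Fin H.m → H.K → H.Z → Outcome H.I H.m

/-- The properties that hold almost surely for the outcome of action `k` at request `j` of
type `z`. -/
def IsOutcome (H : AllocInstance) (j : Fin H.m) (k : H.K) (z : H.Z) (o : Outcome H.I H.m) : Prop :=
  (∀ i l, j ≤ l → o.1 i l = 0 ∨ o.1 i l = H.b i j k z l) ∧
    (∀ i l l', j ≤ l → l ≤ l' → o.1 i l' ≤ o.1 i l) ∧ ∀ i, 0 ≤ o.2 i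

theorem ae_isOutcome (H : AllocInstance) (j : Fin H.m) (k : H.K) (z : H.Z) :
    ∀ᵐ o ∂(H.law j k z), H.IsOutcome j k z o := by
  filter_upwards [H.law_two_point j k z, H.law_antitone j k z, H.reward_nonneg j k z]
    with o h1 h2 h3 using ⟨h1, h2, h3⟩

theorem IsOutcome.nonneg {H : AllocInstance} {j : Fin H.m} {k : H.K} {z : H.Z}
    {o : Outcome H.I H.m} (h : H.IsOutcome j k z o) (i : H.I) {l : Fin H.m} (hl : j ≤ l) :
    0 ≤ o.1 i l := by
  rcases h.1 i l hl with e | e <;> rw [e]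
  exact H.b_nonneg i j k z l hl

/-- Consumption never increases, so the maximal amount at the request itself bounds all later
consumption. This is why testing implementability once, at the request, suffices for the whole run.
-/
theorem IsOutcome.le {H : AllocInstance} {j : Fin H.m} {k : H.K} {z : H.Z}
    {o : Outcome H.I H.m} (h : H.IsOutcome j k z o) (i : H.I) {l : Fin H.m} (hl : j ≤ l) :
    o.1 i l ≤ H.b i j k z j := by
  refine (h.2.1 i j l le_rfl hl).trans ?_
  rcases h.1 i j le_rfl with e | e <;> rw [e]
  exact H.b_nonneg i j k z j le_rfl

theorem IsOutcome.le_one {H : AllocInstance} {j : Fin H.m} {k : H.K} {z : H.Z}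
    {o : Outcome H.I H.m} (h : H.IsOutcome j k z o) (i : H.I) {l : Fin H.m} (hl : j ≤ l) :
    o.1 i l ≤ 1 :=
  (h.le i hl).trans (H.b_le_one i j k z j le_rfl)

theorem IsOutcome.eq_zero {H : AllocInstance} {j : Fin H.m} {k : H.K} {z : H.Z}
    {o : Outcome H.I H.m} (h : H.IsOutcome j k z o) {i : H.I} (hi : H.b i j k z j = 0)
    {l : Fin H.m} (hl : j ≤ l) : o.1 i l = 0 :=
  le_antisymm ((h.le i hl).trans hi.le) (h.nonneg i hl)

/-- A table all of whose entries have the almost sure properties of outcomes. -/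
def IsTable (H : AllocInstance) (o : H.Table) : Prop := ∀ j k z, H.IsOutcome j k z (o j k z)

theorem ae_isTable (H : AllocInstance) : ∀ᵐ o ∂H.tableLaw, H.IsTable o := by
  simp only [IsTable, Filter.eventually_all]
  intro j k z
  have h1 := Measure.tendsto_eval_ae_ae
    (μ := fun j => Measure.pi fun k => Measure.pi fun z => H.law j k z) (i := j)
  have h2 := Measure.tendsto_eval_ae_ae
    (μ := fun k => Measure.pi fun z => H.law j k z) (i := k)
  have h3 := Measure.tendsto_eval_ae_ae (μ := fun z => H.law j k z) (i := z)
  exact (h3.comp (h2.comp h1)).eventually (H.ae_isOutcome j k z)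

/-- If the choice of an action and the integrand do not depend on row `n` of the table, then the
outcome of that action at request `n` can be integrated separately. -/
theorem lintegral_table_entry (H : AllocInstance) (n : Fin H.m) (z : H.Z) {κ : H.Table → H.K}
    (hκ : Measurable κ) {F : H.Table × Outcome H.I H.m → ℝ≥0∞} (hF : Measurable F)
    (hκ' : ∀ o r, κ (Function.update o n r) = κ o)
    (hF' : ∀ o r y, F (Function.update o n r, y) = F (o, y)) :
    ∫⁻ o, F (o, o n (κ o) z) ∂H.tableLaw =
      ∫⁻ o, ∫⁻ y, F (o, y) ∂(H.law n (κ o) z) ∂H.tableLaw := by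
  have hentry : Measurable fun o : H.Table => o n (κ o) z := by
    have : Measurable fun p : H.K × H.Table => p.2 n p.1 z :=
      measurable_from_prod_countable_right fun k => by dsimp only; fun_prop
    exact this.comp (hκ.prodMk measurable_id)
  unfold tableLaw
  have hcomp : Measurable fun o : H.Table => F (o, o n (κ o) z) :=
    hF.comp (measurable_id.prodMk hentry)
  -- The whole row `n` is resampled. The selected action and the first argument of `F` do not see
  -- the new row, so only the selected entry of the fresh row remains to be integrated.
  rw [lintegral_pi_update _ n hcomp]
  refine lintegral_congr fun o => ?_
  simp only [hκ', hF', Function.update_self]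
  rw [lintegral_pi_eval (fun k => Measure.pi fun z => H.law n k z) (κ o)
    (f := fun r => F (o, r z)) (by fun_prop),
    lintegral_pi_eval (fun z => H.law n (κ o) z) z (f := fun y => F (o, y)) (by fun_prop)]

/-! ### Records of runs -/

namespace Trace

variable {H : AllocInstance}

@[simp] theorem types_record (τ : H.Trace) (j : Fin H.m) (o : Outcome H.I H.m) :
    (τ.record j o).types = τ.types := rfl
@[simp] theorem repl_record (τ : H.Trace) (j : Fin H.m) (o : Outcome H.I H.m) :
    (τ.record j o).repl = τ.repl := rfl
theorem cons_record (τ : H.Trace) (j : Fin H.m) (o : Outcome H.I H.m) :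
    (τ.record j o).cons = Function.update τ.cons j o.1 := rfl
theorem rew_record (τ : H.Trace) (j : Fin H.m) (o : Outcome H.I H.m) :
    (τ.record j o).rew = Function.update τ.rew j o.2 := rfl
@[simp] theorem cons_record_self (τ : H.Trace) (j : Fin H.m) (o : Outcome H.I H.m) :
    (τ.record j o).cons j = o.1 := by simp [cons_record]
@[simp] theorem rew_record_self (τ : H.Trace) (j : Fin H.m) (o : Outcome H.I H.m) :
    (τ.record j o).rew j = o.2 := by simp [rew_record]
theorem cons_record_of_ne (τ : H.Trace) {j t : Fin H.m} (h : t ≠ j) (o : Outcome H.I H.m) :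
    (τ.record j o).cons t = τ.cons t := by simp [cons_record, h]
theorem rew_record_of_ne (τ : H.Trace) {j t : Fin H.m} (h : t ≠ j) (o : Outcome H.I H.m) :
    (τ.record j o).rew t = τ.rew t := by simp [rew_record, h]

theorem sameOutcomes_record (τ : H.Trace) {t j : Fin H.m} (h : t ≤ j) (o : Outcome H.I H.m) :
    SameOutcomes t (τ.record j o) τ :=
  ⟨fun s hs i l _ => by rw [cons_record_of_ne τ (hs.trans_le h).ne],
    fun s hs i => by rw [rew_record_of_ne τ (hs.trans_le h).ne]⟩

theorem remaining_congr {τ τ' : H.Trace} {j : Fin H.m} (hr : τ.repl = τ'.repl)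
    (h : SameOutcomes j τ τ') (i : H.I) : τ.remaining j i = τ'.remaining j i := by
  unfold remaining
  rw [hr]
  congr 1
  exact Finset.sum_congr rfl fun t ht => h.1 t (Finset.mem_Iio.1 ht) i j le_rfl

theorem implementable_congr {τ τ' : H.Trace} {j : Fin H.m} (hz : τ.types = τ'.types)
    (hr : τ.repl = τ'.repl) (h : SameOutcomes j τ τ') (k : H.K) :
    Implementable τ j k ↔ Implementable τ' j k := by
  simp only [Implementable, hz, remaining_congr hr h]

theorem implementable_record (τ : H.Trace) {t j : Fin H.m} (h : t ≤ j) (o : Outcome H.I H.m)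
    (k : H.K) : Implementable (τ.record j o) t k ↔ Implementable τ t k :=
  implementable_congr (τ := τ.record j o) (τ' := τ) rfl rfl (sameOutcomes_record τ h o) k

theorem measurable_types : Measurable (types : H.Trace → _) := by unfold types; fun_prop
theorem measurable_cons : Measurable (cons : H.Trace → _) := by unfold cons; fun_prop
theorem measurable_rew : Measurable (rew : H.Trace → _) := by unfold rew; fun_prop

theorem measurable_remaining (j : Fin H.m) (i : H.I) :
    Measurable fun τ : H.Trace => τ.remaining j i := by
  unfold remaining repl cons
  fun_prop

theorem measurable_record (j : Fin H.m) :
    Measurable fun x : H.Trace × Outcome H.I H.m => x.1.record j x.2 := by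
  unfold record types repl cons rew
  refine Measurable.prodMk (by fun_prop) (Measurable.prodMk (by fun_prop) (Measurable.prodMk ?_ ?_))
  · exact (measurable_update' (a := j)).comp
      (f := fun x : H.Trace × Outcome H.I H.m => (x.1.2.2.1, x.2.1)) (by fun_prop)
  · exact (measurable_update' (a := j)).comp
      (f := fun x : H.Trace × Outcome H.I H.m => (x.1.2.2.2, x.2.2)) (by fun_prop)

theorem measurableSet_implementable (j : Fin H.m) (k : H.K) :
    MeasurableSet {τ : H.Trace | Implementable τ j k} := by
  have key : {τ : H.Trace | Implementable τ j k} = ⋃ z : H.Z, ({τ : H.Trace | τ.types j = z} ∩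
      {τ : H.Trace | ∀ i, H.b i j k z j ≠ 0 → H.b i j k z j ≤ τ.remaining j i}) := by
    ext τ
    simp [Implementable]
  rw [key]
  refine MeasurableSet.iUnion fun z => MeasurableSet.inter ?_ ?_
  · exact ((measurable_pi_apply j).comp measurable_types) (measurableSet_singleton z)
  · simp only [Set.ofPred_forall]
    exact MeasurableSet.iInter fun i => MeasurableSet.iInter fun _ =>
      measurableSet_le measurable_const (measurable_remaining j i)

/-- The first `n` requests were handled by implementable actions with regular outcomes. -/
def Feasible (τ : H.Trace) (n : ℕ) : Prop :=
  ∀ t : Fin H.m, t.1 < n → ∃ k, Implementable τ t k ∧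
    H.IsOutcome t k (τ.types t) (τ.cons t, τ.rew t)

theorem Feasible.record {τ : H.Trace} {n : Fin H.m} (h : τ.Feasible n) {k : H.K}
    (hk : Implementable τ n k) {o : Outcome H.I H.m} (ho : H.IsOutcome n k (τ.types n) o) :
    (τ.record n o).Feasible (n + 1) := by
  intro t ht
  rcases Nat.lt_succ_iff_lt_or_eq.1 ht with h1 | h1
  · obtain ⟨k', hk', ho'⟩ := h t h1
    have hne : t ≠ n := fun e => h1.ne (congrArg Fin.val e)
    refine ⟨k', (implementable_record τ h1.le o k').2 hk', ?_⟩
    rwa [cons_record_of_ne τ hne, rew_record_of_ne τ hne]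
  · obtain rfl : t = n := Fin.ext h1
    refine ⟨k, (implementable_record τ le_rfl o k).2 hk, ?_⟩
    simpa using ho

theorem Feasible.mono {τ : H.Trace} {n n' : ℕ} (h : τ.Feasible n) (hn : n' ≤ n) :
    τ.Feasible n' := fun t ht => h t (ht.trans_le hn)

theorem Feasible.cons_nonneg {τ : H.Trace} {n : ℕ} (h : τ.Feasible n) {t l : Fin H.m}
    (ht : t.1 < n) (hl : t ≤ l) (i : H.I) : 0 ≤ τ.cons t i l := by
  obtain ⟨k, -, ho⟩ := h t ht
  exact ho.nonneg i hl

/-- From one request to the next, earlier consumptions shrink, replenishment only adds, and the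
newest action fits into what was left because it was implementable. Induction on the request then
keeps the inventory nonnegative. -/
theorem Feasible.remaining_nonneg {τ : H.Trace} {j : Fin H.m} (h : τ.Feasible j)
    (hr : ∀ t i, 0 ≤ τ.repl t i) (i : H.I) : 0 ≤ τ.remaining j i := by
  obtain ⟨n, hn⟩ := j
  induction n with
  | zero =>
    have h0 : Finset.Iio (⟨0, hn⟩ : Fin H.m) = ∅ := by
      ext t; simp [Fin.lt_def]
    simp only [remaining, h0, Finset.sum_empty, sub_zero]
    exact add_nonneg (H.inv_nonneg i) (Finset.sum_nonneg fun t _ => hr t i)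
  | succ n ih =>
    have hn' : n < H.m := by omega
    have h1 := ih hn' (h.mono (by simp))
    set j : Fin H.m := ⟨n, hn'⟩ with hj
    have hIio : Finset.Iio (⟨n + 1, hn⟩ : Fin H.m) = insert j (Finset.Iio j) := by
      ext t; simp only [Finset.mem_Iio, Finset.mem_insert, Fin.lt_def, Fin.ext_iff, hj]; omega
    have hIic : Finset.Iic (⟨n + 1, hn⟩ : Fin H.m) = insert ⟨n + 1, hn⟩ (Finset.Iic j) := by
      ext t; simp only [Finset.mem_Iic, Finset.mem_insert, Fin.le_def, Fin.ext_iff, hj]; omega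
    have hnm : (⟨n + 1, hn⟩ : Fin H.m) ∉ Finset.Iic j := by simp [Fin.le_def, hj]
    have hjj : j ≤ ⟨n + 1, hn⟩ := by simp [Fin.le_def, hj]
    obtain ⟨k, hk, ho⟩ := h j (by simp [hj])
    have h2 : ∑ t ∈ Finset.Iio j, τ.cons t i ⟨n + 1, hn⟩ ≤ ∑ t ∈ Finset.Iio j, τ.cons t i j := by
      refine Finset.sum_le_sum fun t ht => ?_
      have ht' := Finset.mem_Iio.1 ht
      obtain ⟨k', -, ho'⟩ := h t (lt_trans ht' (by simp [hj]))
      exact ho'.2.1 i j _ ht'.le hjj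
    have h3 : τ.cons j i ⟨n + 1, hn⟩ ≤ τ.remaining j i := by
      by_cases hb : H.b i j k (τ.types j) j = 0
      · exact (ho.eq_zero hb hjj).trans_le h1
      · exact (ho.le i hjj).trans (hk i hb)
    have h4 := hr ⟨n + 1, hn⟩ i
    unfold remaining at h3 ⊢
    rw [hIio, hIic, Finset.sum_insert hnm, Finset.sum_insert (by simp)]
    linarith

end Trace

namespace Policy

variable {H : AllocInstance} (π : Policy H)

@[simp] theorem trace_zero (z : Fin H.m → H.Z) (ζ : Fin H.m → H.I → ℝ) (o : H.Table) (u : π.Seed) :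
    π.trace z ζ o u 0 = (z, ζ, 0, 0) := rfl

theorem measurable_trace (n : ℕ) :
    Measurable fun x : (Fin H.m → H.Z) × (Fin H.m → H.I → ℝ) × H.Table × π.Seed =>
      π.trace x.1 x.2.1 x.2.2.1 x.2.2.2 n := by
  induction n with
  | zero =>
    simp only [trace_zero]
    exact measurable_fst.prodMk ((measurable_fst.comp measurable_snd).prodMk measurable_const)
  | succ n ih =>
    unfold trace
    split_ifs with h
    · have hact := (π.measurable_act ⟨n, h⟩).comp
        ((measurable_snd.comp (measurable_snd.comp measurable_snd)).prodMk ih)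
      have hentry : Measurable fun p : (H.K × H.Z) × H.Table => p.2 ⟨n, h⟩ p.1.1 p.1.2 :=
        measurable_from_prod_countable_right fun k => by dsimp only; fun_prop
      exact (Trace.measurable_record ⟨n, h⟩).comp (ih.prodMk (hentry.comp ((hact.prodMk
        ((measurable_pi_apply _).comp measurable_fst)).prodMk
          (measurable_fst.comp (measurable_snd.comp measurable_snd)))))
    · exact ih

theorem measurable_act_trace (j : Fin H.m) (n : ℕ) :
    Measurable fun x : (Fin H.m → H.Z) × (Fin H.m → H.I → ℝ) × H.Table × π.Seed =>
      π.act x.2.2.2 j (π.trace x.1 x.2.1 x.2.2.1 x.2.2.2 n) :=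
  (π.measurable_act j).comp
    ((measurable_snd.comp (measurable_snd.comp measurable_snd)).prodMk (π.measurable_trace n))

variable (z : Fin H.m → H.Z) (ζ : Fin H.m → H.I → ℝ) (o : H.Table) (u : π.Seed)

theorem trace_succ (n : Fin H.m) : π.trace z ζ o u (n + 1) =
    (π.trace z ζ o u n).record n (o n (π.act u n (π.trace z ζ o u n)) (z n)) := by
  rw [trace, dif_pos n.2]

@[simp] theorem types_trace (n : ℕ) : (π.trace z ζ o u n).types = z := by
  induction n with
  | zero => rfl
  | succ n ih =>
    unfold trace
    split_ifs <;> simpa using ih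

@[simp] theorem repl_trace (n : ℕ) : (π.trace z ζ o u n).repl = ζ := by
  induction n with
  | zero => rfl
  | succ n ih =>
    unfold trace
    split_ifs <;> simpa using ih

/-- Step `t` of a run reads only row `t` of the table. This is the source of the independence
between the record before a request and the outcome at it. -/
theorem trace_update {n : ℕ} {j : Fin H.m} (hn : n ≤ j) (r : H.K → H.Z → Outcome H.I H.m) :
    π.trace z ζ (Function.update o j r) u n = π.trace z ζ o u n := by
  induction n with
  | zero => rfl
  | succ n ih =>
    have hne : (⟨n, by omega⟩ : Fin H.m) ≠ j := fun e => by
      have := congrArg Fin.val e; simp at this; omega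
    rw [trace_succ π z ζ _ u ⟨n, by omega⟩, trace_succ π z ζ _ u ⟨n, by omega⟩]
    simp only [ih (by omega), Function.update_of_ne hne]

theorem rew_trace {n : ℕ} {j : Fin H.m} (hn : j < n) :
    (π.trace z ζ o u n).rew j = (π.trace z ζ o u (j + 1)).rew j := by
  induction n with
  | zero => omega
  | succ n ih =>
    rcases Nat.lt_succ_iff_lt_or_eq.1 hn with h | h
    · rw [← ih h, trace]
      split_ifs with hm
      · rw [Trace.rew_record_of_ne]
        exact fun e => by subst e; simp at h
      · rfl
    · rw [← h]

theorem cons_trace {n : ℕ} {j : Fin H.m} (hn : j < n) :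
    (π.trace z ζ o u n).cons j = (π.trace z ζ o u (j + 1)).cons j := by
  induction n with
  | zero => omega
  | succ n ih =>
    rcases Nat.lt_succ_iff_lt_or_eq.1 hn with h | h
    · rw [← ih h, trace]
      split_ifs with hm
      · rw [Trace.cons_record_of_ne]
        exact fun e => by subst e; simp at h
      · rfl
    · rw [← h]

theorem rew_trace_succ (j : Fin H.m) : (π.trace z ζ o u (j + 1)).rew j =
    (o j (π.act u j (π.trace z ζ o u j)) (z j)).2 := by
  rw [trace_succ, Trace.rew_record_self]

theorem feasible_trace (ho : H.IsTable o) {n : ℕ} (hn : n ≤ H.m) :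
    (π.trace z ζ o u n).Feasible n := by
  induction n with
  | zero => exact fun t ht => absurd ht (by simp)
  | succ n ih =>
    rw [trace_succ π z ζ o u ⟨n, hn⟩]
    refine Trace.Feasible.record (n := ⟨n, hn⟩) (ih (by omega)) (π.implementable u ⟨n, hn⟩ _) ?_
    rw [types_trace]
    exact ho _ _ _

theorem measurable_trace_table (n : ℕ) : Measurable fun o : H.Table => π.trace z ζ o u n :=
  (π.measurable_trace n).comp
    (f := fun o : H.Table => ((z, ζ, o, u) :
      (Fin H.m → H.Z) × (Fin H.m → H.I → ℝ) × H.Table × π.Seed)) (by fun_prop)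

theorem measurable_act_trace_table (j : Fin H.m) (n : ℕ) :
    Measurable fun o : H.Table => π.act u j (π.trace z ζ o u n) :=
  (π.measurable_act_trace j n).comp
    (f := fun o : H.Table => ((z, ζ, o, u) :
      (Fin H.m → H.Z) × (Fin H.m → H.I → ℝ) × H.Table × π.Seed)) (by fun_prop)

/-- One step of a run: the outcome of the action chosen for request `n` is drawn from its law,
independently of the record. -/
theorem lintegral_trace_step (n : Fin H.m) {F : H.Trace × Outcome H.I H.m → ℝ≥0∞}
    (hF : Measurable F) :
    ∫⁻ o, F (π.trace z ζ o u n, o n (π.act u n (π.trace z ζ o u n)) (z n)) ∂H.tableLaw =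
      ∫⁻ o, ∫⁻ y, F (π.trace z ζ o u n, y) ∂(H.law n (π.act u n (π.trace z ζ o u n)) (z n))
        ∂H.tableLaw := by
  refine H.lintegral_table_entry n (z n) (κ := fun o => π.act u n (π.trace z ζ o u n))
    (F := fun p => F (π.trace z ζ p.1 u n, p.2)) (π.measurable_act_trace_table z ζ u n n) ?_ ?_ ?_
  · have := π.measurable_trace_table z ζ u n
    fun_prop
  · intro o r
    rw [trace_update π z ζ o u le_rfl]
  · intro o r y
    simp only [trace_update π z ζ o u le_rfl]

end Policy

/-! ### Expected profits as Lebesgue integrals -/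

/-- The expected profit `r_{ijkz}`. -/
noncomputable def meanReward (H : AllocInstance) (i : H.I) (j : Fin H.m) (k : H.K) (z : H.Z) :
    ℝ≥0∞ := ∫⁻ y, ENNReal.ofReal (y.2 i) ∂(H.law j k z)

theorem meanReward_ne_top (H : AllocInstance) (i : H.I) (j : Fin H.m) (k : H.K) (z : H.Z) :
    H.meanReward i j k z ≠ ⊤ := by
  have h := (H.reward_integrable j k z i).lintegral_lt_top
  exact h.ne

namespace Policy

variable {H : AllocInstance} (π : Policy H)

/-- The expected profit for objective `i` earned at request `j`. -/
noncomputable def profitAt (i : H.I) (j : Fin H.m) : ℝ≥0∞ :=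
  ∫⁻ z, ∫⁻ ζ, ∫⁻ u, ∫⁻ o, ENNReal.ofReal ((π.trace z ζ o u (j + 1)).rew j i)
    ∂H.tableLaw ∂π.seedLaw ∂H.replsLaw ∂H.typesLaw

/-- Given the record, the outcome at `j` is a fresh draw from the law of the chosen action, so only
its mean profit matters. From here on a policy enters its profit only through the joint law of its
action and the type. -/
theorem profitAt_eq (i : H.I) (j : Fin H.m) : π.profitAt i j =
    ∫⁻ z, ∫⁻ ζ, ∫⁻ u, ∫⁻ o, H.meanReward i j (π.act u j (π.trace z ζ o u j)) (z j)
      ∂H.tableLaw ∂π.seedLaw ∂H.replsLaw ∂H.typesLaw := by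
  unfold profitAt
  refine lintegral_congr fun z => lintegral_congr fun ζ => lintegral_congr fun u => ?_
  simp only [rew_trace_succ]
  exact π.lintegral_trace_step z ζ u j (F := fun p => ENNReal.ofReal (p.2.2 i)) (by fun_prop)

/-- This crude bound is uniform in the policy; it provides finiteness of profits and boundedness of
the set whose supremum is `OPT`. -/
theorem profitAt_le (i : H.I) (j : Fin H.m) :
    π.profitAt i j ≤ ∑ k, ∑ z, H.meanReward i j k z := by
  rw [profitAt_eq]
  calc _ ≤ ∫⁻ _, ∫⁻ _, ∫⁻ _, ∫⁻ _, ∑ k, ∑ z, H.meanReward i j k z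
      ∂H.tableLaw ∂π.seedLaw ∂H.replsLaw ∂H.typesLaw := by
        refine lintegral_mono fun z => lintegral_mono fun ζ => lintegral_mono fun u =>
          lintegral_mono fun o => ?_
        refine le_trans ?_ (Finset.single_le_sum (f := fun k => ∑ z, H.meanReward i j k z)
          (fun _ _ => zero_le) (Finset.mem_univ (π.act u j (π.trace z ζ o u j))))
        exact Finset.single_le_sum (f := fun z' => H.meanReward i j _ z')
          (fun _ _ => zero_le) (Finset.mem_univ (z j))
    _ = _ := by simp

theorem profitAt_ne_top (i : H.I) (j : Fin H.m) : π.profitAt i j ≠ ⊤ := by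
  refine ne_top_of_le_ne_top ?_ (π.profitAt_le i j)
  simp [ENNReal.sum_eq_top, meanReward_ne_top]

theorem lintegral_run {f : (Fin H.m → H.Z) × (Fin H.m → H.I → ℝ) × H.Table × π.Seed → ℝ≥0∞}
    (hf : Measurable f) :
    ∫⁻ x, f x ∂(H.typesLaw.prod (H.replsLaw.prod (H.tableLaw.prod π.seedLaw))) =
      ∫⁻ z, ∫⁻ ζ, ∫⁻ u, ∫⁻ o, f (z, ζ, o, u)
        ∂H.tableLaw ∂π.seedLaw ∂H.replsLaw ∂H.typesLaw := by
  rw [lintegral_prod _ hf.aemeasurable]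
  refine lintegral_congr fun z => ?_
  have hz := hf.comp (measurable_prodMk_left (x := z))
  refine (lintegral_prod _ hz.aemeasurable).trans (lintegral_congr fun ζ => ?_)
  exact lintegral_prod_symm _ (hz.comp (measurable_prodMk_left (x := ζ))).aemeasurable

/-- Profits are nonnegative almost surely, so the Bochner integral is a Lebesgue integral, and the
reward entry of request `j` is final once step `j` is done. -/
theorem profit_eq (i : H.I) : π.profit i = (∑ j, π.profitAt i j).toReal := by
  have hm : ∀ (j : Fin H.m) (n : ℕ),
      Measurable fun x : (Fin H.m → H.Z) × (Fin H.m → H.I → ℝ) × H.Table × π.Seed =>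
        (π.trace x.1 x.2.1 x.2.2.1 x.2.2.2 n).rew j i := fun j n =>
    (measurable_pi_apply i).comp ((measurable_pi_apply j).comp
      (Trace.measurable_rew.comp (π.measurable_trace n)))
  have hnn : ∀ᵐ x ∂(H.typesLaw.prod (H.replsLaw.prod (H.tableLaw.prod π.seedLaw))),
      ∀ j, 0 ≤ (π.trace x.1 x.2.1 x.2.2.1 x.2.2.2 H.m).rew j i := by
    have h : ∀ᵐ x ∂(H.typesLaw.prod (H.replsLaw.prod (H.tableLaw.prod π.seedLaw))),
        H.IsTable x.2.2.1 :=
      (Measure.quasiMeasurePreserving_fst.comp (Measure.quasiMeasurePreserving_snd.comp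
        Measure.quasiMeasurePreserving_snd)).ae H.ae_isTable
    filter_upwards [h] with x hx j
    rw [rew_trace _ _ _ _ _ j.2, rew_trace_succ]
    exact (hx _ _ _).2.2 i
  unfold profit
  rw [integral_eq_lintegral_of_nonneg_ae
    (by filter_upwards [hnn] with x hx using Finset.sum_nonneg fun j _ => hx j)
    (Finset.measurable_sum _ fun j _ => hm j _).aestronglyMeasurable]
  congr 1
  rw [lintegral_congr_ae (g := fun x => ∑ j, ENNReal.ofReal
    ((π.trace x.1 x.2.1 x.2.2.1 x.2.2.2 H.m).rew j i))
    (by filter_upwards [hnn] with x hx using ENNReal.ofReal_sum_of_nonneg fun j _ => hx j),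
    lintegral_finsetSum _ fun j _ => (hm j _).ennreal_ofReal]
  refine Finset.sum_congr rfl fun j _ => ?_
  simp only [rew_trace π _ _ _ _ j.2]
  exact π.lintegral_run (hm j (j + 1)).ennreal_ofReal

theorem profit_nonneg (i : H.I) : 0 ≤ π.profit i := by
  rw [profit_eq]; positivity

theorem value_nonneg : 0 ≤ π.value := Real.iInf_nonneg π.profit_nonneg

theorem value_le_profit (i : H.I) : π.value ≤ π.profit i :=
  ciInf_le (Set.finite_range _).bddBelow i

end Policy

/-- Needed because the real `sSup` of an unbounded set would be the default value `0`, and no policy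
could be compared with it. -/
theorem bddAbove_values (H : AllocInstance) : BddAbove {v | ∃ π : Policy H, v = π.value} := by
  let i : H.I := Classical.arbitrary _
  refine ⟨(∑ j, ∑ k, ∑ z, H.meanReward i j k z).toReal, ?_⟩
  rintro _ ⟨π, rfl⟩
  refine (π.value_le_profit i).trans ?_
  rw [π.profit_eq]
  refine ENNReal.toReal_mono ?_ (Finset.sum_le_sum fun j _ => π.profitAt_le i j)
  simp [ENNReal.sum_eq_top, meanReward_ne_top]

theorem OPT_nonneg (H : AllocInstance) : 0 ≤ H.OPT :=
  Real.sSup_nonneg (by rintro _ ⟨π, rfl⟩; exact π.value_nonneg)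

end AllocInstance

namespace AllocInstance

/-! ### Copies of resources -/

section Copies

variable {H : AllocInstance} {stock : H.I → Fin H.m → ℝ}

theorem addCopies_b_self (j : Fin H.m) (κ : H.CopyK stock) (z : H.Z) (l : Fin H.m) (i : H.I) :
    (H.addCopies stock).b ⟨i, κ.2 i⟩ j κ z l = H.b i j κ.1 z l := by
  simp [addCopies]

theorem addCopies_b_of_ne (j : Fin H.m) (κ : H.CopyK stock) (z : H.Z) (l : Fin H.m) {i : H.I}
    {v : H.Version stock i} (h : κ.2 i ≠ v) : (H.addCopies stock).b ⟨i, v⟩ j κ z l = 0 := by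
  simp [addCopies, h]

theorem IsOutcome.lift {j : Fin H.m} {κ : H.CopyK stock} {z : H.Z} {o : Outcome H.I H.m}
    (h : H.IsOutcome j κ.1 z o) : (H.addCopies stock).IsOutcome j κ z (H.lift j κ z o) := by
  refine ⟨?_, ?_, ?_⟩
  · rintro ⟨i, v⟩ l hl
    by_cases hv : κ.2 i = v
    · subst hv
      have e : (H.addCopies stock).b ⟨i, κ.2 i⟩ j κ z l = H.b i j κ.1 z l := addCopies_b_self j κ z l i
      have e' : (H.lift j κ z o).1 ⟨i, κ.2 i⟩ l = o.1 i l := if_pos rfl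
      exact (h.1 i l hl).imp (fun h => e'.trans h) fun h => e'.trans (h.trans e.symm)
    · simp [AllocInstance.lift, hv]
  · rintro ⟨i, v⟩ l l' hl hl'
    by_cases hv : κ.2 i = v
    · subst hv
      simpa [AllocInstance.lift] using h.2.1 i l l' hl hl'
    · simp [AllocInstance.lift, hv]
  · rintro ⟨i, v⟩
    by_cases ha : H.Active j κ z
    · simpa [AllocInstance.lift, ha] using h.2.2 i
    · simp [AllocInstance.lift, ha]

open Classical in
/-- The versions of resource `i` that have been introduced by request `j`. -/
noncomputable def introduced (stock : H.I → Fin H.m → ℝ) (i : H.I) (j : Fin H.m) :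
    Finset (H.Version stock i) :=
  Finset.univ.filter fun v => ∀ t, v.1 = some t → t ≤ j

theorem mem_introduced {i : H.I} {j : Fin H.m} {v : H.Version stock i} :
    v ∈ introduced stock i j ↔ ∀ t, v.1 = some t → t ≤ j := by
  simp [introduced]

open Classical in
theorem sum_introduced (i : H.I) (j : Fin H.m) (f : Option (Fin H.m) → ℝ) :
    ∑ v ∈ introduced stock i j, f v.1 =
      f none + ∑ t ∈ Finset.Iic j, if 0 < stock i t then f (some t) else 0 := by
  have h1 : ∑ v ∈ introduced stock i j, f v.1 =
      ∑ v : H.Version stock i, if ∀ t, v.1 = some t → t ≤ j then f v.1 else 0 := by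
    rw [introduced, Finset.sum_filter]
  rw [h1, ← Finset.sum_subtype (Finset.univ.filter fun v : Option (Fin H.m) =>
      ∀ j, v = some j → 0 < stock i j) (by simp)
      (fun v => if ∀ t, v = some t → t ≤ j then f v else 0),
    Finset.sum_filter, Fintype.sum_option]
  congr 1
  · simp
  · rw [← Finset.sum_filter_add_sum_filter_not Finset.univ (fun t => t ≤ j)]
    have h2 : Finset.univ.filter (fun t => t ≤ j) = Finset.Iic j := by ext; simp
    rw [h2, Finset.sum_eq_zero (s := Finset.univ.filter fun t => ¬ t ≤ j), add_zero]
    · refine Finset.sum_congr rfl fun t ht => ?_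
      have := Finset.mem_Iic.1 ht
      simp [this]
    · intro t ht
      simp only [Finset.mem_filter, Finset.mem_univ, true_and] at ht
      simp [ht]

theorem sum_introduced_inv (hs : ∀ i j, 0 ≤ stock i j) (i : H.I) (j : Fin H.m) :
    ∑ v ∈ introduced stock i j, (H.addCopies stock).inv ⟨i, v⟩ =
      H.inv i + ∑ t ∈ Finset.Iic j, stock i t := by
  have := sum_introduced (stock := stock) i j fun v => v.elim (H.inv i) (stock i)
  refine this.trans ?_
  congr 1
  refine Finset.sum_congr rfl fun t _ => ?_
  split_ifs with h
  · rfl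
  -- A nonnegative stock without a copy is zero, so the missing copies contribute nothing to the
  -- total.
  · exact le_antisymm (hs i t) (not_lt.1 h)

/-- The consumption of all introduced versions of a resource. -/
theorem sum_introduced_lift (j l : Fin H.m) (κ : H.CopyK stock) (z : H.Z) (o : Outcome H.I H.m)
    (i : H.I) (s : Finset (H.Version stock i)) (h : κ.2 i ∈ s) :
    ∑ v ∈ s, (H.lift j κ z o).1 ⟨i, v⟩ l = o.1 i l := by
  classical
  simp only [AllocInstance.lift]
  rw [Finset.sum_ite_eq s (κ.2 i) (fun _ => o.1 i l), if_pos h]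

theorem ae_repl_addCopies : ∀ᵐ ζ ∂(H.addCopies stock).replsLaw, ζ = 0 := by
  have h : ∀ᵐ ζ ∂(H.addCopies stock).replsLaw, ∀ j i, ζ j i = 0 := by
    rw [Filter.eventually_all]; intro j
    rw [Filter.eventually_all]; intro i
    have h1 := Measure.tendsto_eval_ae_ae
      (μ := fun j => Measure.pi fun i => (H.addCopies stock).replLaw i j) (i := j)
    have h2 := Measure.tendsto_eval_ae_ae (μ := fun i => (H.addCopies stock).replLaw i j) (i := i)
    refine (h2.comp h1).eventually (p := fun x => x = 0) ?_
    have h3 : (H.addCopies stock).replLaw i j = Measure.dirac 0 := by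
      simp [replLaw, addCopies]
    rw [h3]
    exact (ae_dirac_iff (measurableSet_eq)).2 rfl
  filter_upwards [h] with ζ hζ
  funext j i
  exact hζ j i

theorem profitAt_addCopies (π : Policy (H.addCopies stock)) (x : (H.addCopies stock).I)
    (j : Fin H.m) : π.profitAt x j = ∫⁻ z, ∫⁻ u, ∫⁻ o,
      ENNReal.ofReal ((π.trace z 0 o u (j + 1)).rew j x)
        ∂(H.addCopies stock).tableLaw ∂π.seedLaw ∂(H.addCopies stock).typesLaw := by
  unfold Policy.profitAt
  refine lintegral_congr fun z => ?_
  rw [lintegral_congr_ae (g := fun _ => ∫⁻ u, ∫⁻ o,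
      ENNReal.ofReal ((π.trace z 0 o u (j + 1)).rew j x)
        ∂(H.addCopies stock).tableLaw ∂π.seedLaw)
    (by filter_upwards [ae_repl_addCopies] with ζ hζ; rw [hζ])]
  simp

end Copies

/-! ### The virtual run of the batching extension -/

section Virtual

set_option synthInstance.maxSize 1000

variable {H : AllocInstance} {M : ℝ} {d : ℕ} (π : OnlinePolicy (H.batched M d)) (u : π.Seed)

theorem executable_record (τ : H.Trace) {t j : Fin H.m} (h : t ≤ j) (o : Outcome H.I H.m)
    (κ : (H.batched M d).K) : Executable (τ.record j o) t κ ↔ Executable τ t κ := by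
  unfold Executable
  rw [Trace.implementable_record τ h, Trace.types_record]

theorem virtualOutcome_of_executable {τ : H.Trace} (σ : H.Table) {j : Fin H.m}
    {κ : (H.batched M d).K} (h : Executable τ j κ) : virtualOutcome τ σ j κ =
      H.lift (stock := H.batch M d) j κ (τ.types j) (τ.cons j, τ.rew j) :=
  congrArg (H.lift (stock := H.batch M d) j κ (τ.types j)) (if_pos h)

theorem virtualOutcome_of_not_executable {τ : H.Trace} (σ : H.Table) {j : Fin H.m}
    {κ : (H.batched M d).K} (h : ¬ Executable τ j κ) : virtualOutcome τ σ j κ =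
      H.lift (stock := H.batch M d) j κ (τ.types j) (σ j κ.1 (τ.types j)) :=
  congrArg (H.lift (stock := H.batch M d) j κ (τ.types j)) (if_neg h)

theorem virtualOutcome_record (σ : H.Table) (τ : H.Trace) {t j : Fin H.m} (h : t < j)
    (o : Outcome H.I H.m) (κ : (H.batched M d).K) :
    virtualOutcome (τ.record j o) σ t κ = virtualOutcome τ σ t κ := by
  have he := executable_record τ h.le o κ
  by_cases hx : Executable τ t κ
  · rw [virtualOutcome_of_executable σ hx, virtualOutcome_of_executable σ (he.2 hx),
      Trace.types_record, Trace.cons_record_of_ne τ h.ne, Trace.rew_record_of_ne τ h.ne]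
  · rw [virtualOutcome_of_not_executable σ hx,
      virtualOutcome_of_not_executable σ (fun hy => hx (he.1 hy)), Trace.types_record]

theorem virtualOutcome_update (σ : H.Table) (τ : H.Trace) {t j : Fin H.m} (h : t ≠ j)
    (r : H.K → H.Z → Outcome H.I H.m) (κ : (H.batched M d).K) :
    virtualOutcome τ (Function.update σ j r) t κ = virtualOutcome τ σ t κ := by
  by_cases hx : Executable τ t κ
  · rw [virtualOutcome_of_executable _ hx, virtualOutcome_of_executable _ hx]
  · rw [virtualOutcome_of_not_executable _ hx, virtualOutcome_of_not_executable _ hx,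
      Function.update_of_ne h]

theorem virtualTrace_succ (σ : H.Table) (τ : H.Trace) (n : Fin H.m) :
    virtualTrace π u σ τ (n + 1) = (virtualTrace π u σ τ n).record n
      (virtualOutcome τ σ n (π.act u n (virtualTrace π u σ τ n))) := by
  rw [virtualTrace, dif_pos n.2]
  rfl

theorem virtualTrace_record (σ : H.Table) (τ : H.Trace) {n : ℕ} {j : Fin H.m} (hn : n ≤ j)
    (o : Outcome H.I H.m) : virtualTrace π u σ (τ.record j o) n = virtualTrace π u σ τ n := by
  induction n with
  | zero => rfl
  | succ n ih =>
    have hlt : (⟨n, by omega⟩ : Fin H.m) < j := hn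
    rw [virtualTrace_succ π u σ _ ⟨n, by omega⟩, virtualTrace_succ π u σ _ ⟨n, by omega⟩]
    simp only [ih (by omega), virtualOutcome_record σ τ hlt]

theorem virtualTrace_update (σ : H.Table) (τ : H.Trace) {n : ℕ} {j : Fin H.m} (hn : n ≤ j)
    (r : H.K → H.Z → Outcome H.I H.m) :
    virtualTrace π u (Function.update σ j r) τ n = virtualTrace π u σ τ n := by
  induction n with
  | zero => rfl
  | succ n ih =>
    have hlt : (⟨n, by omega⟩ : Fin H.m) < j := hn
    rw [virtualTrace_succ π u _ _ ⟨n, by omega⟩, virtualTrace_succ π u _ _ ⟨n, by omega⟩]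
    simp only [ih (by omega), virtualOutcome_update σ τ hlt.ne]

theorem realAct_update (σ : H.Table) (τ : H.Trace) {t j : Fin H.m} (h : t ≤ j)
    (r : H.K → H.Z → Outcome H.I H.m) :
    realAct π u (Function.update σ j r) t τ = realAct π u σ t τ := by
  have hv : virtualAct π u (Function.update σ j r) t τ = virtualAct π u σ t τ := by
    unfold virtualAct
    rw [virtualTrace_update π u σ τ h]
  unfold realAct
  rw [hv]

variable (z : Fin H.m → H.Z) (ζ : Fin H.m → H.I → ℝ) (o σ : H.Table)

/-- The record of the batching extension after `n` requests. -/
noncomputable def realRun (n : ℕ) : H.Trace := (extend π).trace z ζ o (u, σ) n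

/-- The record of the virtual run when the batching extension has handled `n` requests. -/
noncomputable def virtualRun (n : ℕ) : (H.batched M d).Trace :=
  virtualTrace π u σ (realRun π u z ζ o σ n) n

theorem realRun_succ (n : Fin H.m) : realRun π u z ζ o σ (n + 1) =
    (realRun π u z ζ o σ n).record n
      (o n (realAct π u σ n (realRun π u z ζ o σ n)) (z n)) :=
  (extend π).trace_succ z ζ o _ n

@[simp] theorem types_realRun (n : ℕ) : (realRun π u z ζ o σ n).types = z :=
  (extend π).types_trace z ζ o _ n

@[simp] theorem repl_realRun (n : ℕ) : (realRun π u z ζ o σ n).repl = ζ :=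
  (extend π).repl_trace z ζ o _ n

theorem realRun_update {n : ℕ} {j : Fin H.m} (hn : n ≤ j) (r : H.K → H.Z → Outcome H.I H.m) :
    realRun π u z ζ (Function.update o j r) σ n = realRun π u z ζ o σ n :=
  (extend π).trace_update z ζ o _ hn r

theorem realRun_update_sim {n : ℕ} {j : Fin H.m} (hn : n ≤ j)
    (r : H.K → H.Z → Outcome H.I H.m) :
    realRun π u z ζ o (Function.update σ j r) n = realRun π u z ζ o σ n := by
  induction n with
  | zero => rfl
  | succ n ih =>
    have hlt : (⟨n, by omega⟩ : Fin H.m) < j := hn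
    rw [realRun_succ π u z ζ o _ ⟨n, by omega⟩, realRun_succ π u z ζ o _ ⟨n, by omega⟩]
    simp only [ih (by omega), realAct_update π u σ _ hlt.le]

open Classical in
-- The virtual run is a recursion reading one entry per step, from the real table if the action is
-- executed and from the simulated one otherwise. The choice of table depends only on what precedes
-- row `n`, which makes the entry a fresh draw from the same law in both cases.
theorem virtualRun_succ (n : Fin H.m) : virtualRun π u z ζ o σ (n + 1) =
    (virtualRun π u z ζ o σ n).record n
      (H.lift (stock := H.batch M d) n (π.act u n (virtualRun π u z ζ o σ n)) (z n)
        (if Executable (realRun π u z ζ o σ n) n (π.act u n (virtualRun π u z ζ o σ n))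
          then o n (π.act u n (virtualRun π u z ζ o σ n)).1 (z n)
          else σ n (π.act u n (virtualRun π u z ζ o σ n)).1 (z n))) := by
  unfold virtualRun
  rw [virtualTrace_succ, realRun_succ]
  set τ := realRun π u z ζ o σ n with hτ
  have hz : τ.types = z := types_realRun π u z ζ o σ n
  -- The virtual record is recomputed from the extended real record; the newly written outcome does
  -- not affect its first `n` steps.
  rw [virtualTrace_record π u σ τ le_rfl]
  refine congrArg (Trace.record _ _) ?_
  have he := executable_record τ (le_refl n) (o n (realAct π u σ n τ) (z n))
    (π.act u n (virtualTrace π u σ τ n))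
  by_cases h : Executable τ n (π.act u n (virtualTrace π u σ τ n))
  · have hact : realAct π u σ n τ = (π.act u n (virtualTrace π u σ τ n)).1 := if_pos h
    rw [virtualOutcome_of_executable σ (he.2 h), Trace.types_record, hz, Trace.cons_record_self,
      Trace.rew_record_self, hact]
    exact congrArg (H.lift (stock := H.batch M d) n _ (z n)) (if_pos h).symm
  · rw [virtualOutcome_of_not_executable σ (fun hy => h (he.1 hy)), Trace.types_record, hz]
    exact congrArg (H.lift (stock := H.batch M d) n _ (z n)) (if_neg h).symm

theorem virtualRun_zero : virtualRun π u z ζ o σ 0 = (z, 0, 0, 0) := rfl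

theorem types_virtualRun (n : ℕ) (hn : n ≤ H.m) : (virtualRun π u z ζ o σ n).types = z := by
  induction n with
  | zero => rfl
  | succ n ih =>
    rw [virtualRun_succ π u z ζ o σ ⟨n, hn⟩]
    exact ih (by omega)

theorem repl_virtualRun (n : ℕ) (hn : n ≤ H.m) : (virtualRun π u z ζ o σ n).repl = 0 := by
  induction n with
  | zero => rfl
  | succ n ih =>
    rw [virtualRun_succ π u z ζ o σ ⟨n, hn⟩]
    exact ih (by omega)

theorem virtualRun_update {n : ℕ} {j : Fin H.m} (hn : n ≤ j)
    (r : H.K → H.Z → Outcome H.I H.m) :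
    virtualRun π u z ζ (Function.update o j r) σ n = virtualRun π u z ζ o σ n := by
  unfold virtualRun
  rw [realRun_update π u z ζ o σ hn]

theorem virtualRun_update_sim {n : ℕ} {j : Fin H.m} (hn : n ≤ j)
    (r : H.K → H.Z → Outcome H.I H.m) :
    virtualRun π u z ζ o (Function.update σ j r) n = virtualRun π u z ζ o σ n := by
  unfold virtualRun
  rw [realRun_update_sim π u z ζ o σ hn, virtualTrace_update π u σ _ hn]

theorem measurable_realRun (n : ℕ) :
    Measurable fun p : H.Table × H.Table => realRun π u z ζ p.1 p.2 n :=
  ((extend π).measurable_trace n).comp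
    (f := fun p : H.Table × H.Table => ((z, ζ, p.1, u, p.2) :
      (Fin H.m → H.Z) × (Fin H.m → H.I → ℝ) × H.Table × (π.Seed × H.Table)))
    (measurable_const.prodMk (measurable_const.prodMk (measurable_fst.prodMk
      (measurable_const.prodMk measurable_snd))))

theorem measurable_virtualRun (n : ℕ) :
    Measurable fun p : H.Table × H.Table => virtualRun π u z ζ p.1 p.2 n :=
  (measurable_virtualTrace π n).comp
    (f := fun p : H.Table × H.Table => (((u, p.2), realRun π u z ζ p.1 p.2 n) :
      (π.Seed × H.Table) × H.Trace))
    ((measurable_const.prodMk measurable_snd).prodMk (measurable_realRun π u z ζ n))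

theorem measurable_act_virtualRun (j : Fin H.m) (n : ℕ) :
    Measurable fun p : H.Table × H.Table => π.act u j (virtualRun π u z ζ p.1 p.2 n) :=
  (π.measurable_act j).comp (measurable_const.prodMk (measurable_virtualRun π u z ζ n))

theorem measurableSet_executable_virtualRun (n : Fin H.m) :
    MeasurableSet {p : H.Table × H.Table | Executable (realRun π u z ζ p.1 p.2 n) n
      (π.act u n (virtualRun π u z ζ p.1 p.2 n))} := by
  have h : Measurable fun x : (H.batched M d).K × H.Trace => Executable x.2 n x.1 :=
    measurable_from_prod_countable_right fun κ =>
      measurableSet_setOfPred.1 (measurableSet_executable n κ)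
  exact measurableSet_setOfPred.2
    (h.comp ((measurable_act_virtualRun π u z ζ n n).prodMk (measurable_realRun π u z ζ n)))

/-- Given the types and the replenishments, the virtual run has the law of a run on the batched
instance. -/
theorem lintegral_virtualRun {n : ℕ} (hn : n ≤ H.m) {F : (H.batched M d).Trace → ℝ≥0∞}
    (hF : Measurable F) :
    ∫⁻ σ, ∫⁻ o, F (virtualRun π u z ζ o σ n) ∂H.tableLaw ∂H.tableLaw =
      ∫⁻ o, F (π.trace z 0 o u n) ∂(H.batched M d).tableLaw := by
  classical
  induction n generalizing F with
  | zero =>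
    have h : F (z, 0, 0, 0) = ∫⁻ o, F (π.trace z 0 o u 0) ∂(H.batched M d).tableLaw := by
      exact (by simp : F (z, 0, 0, 0) = ∫⁻ _, F (z, 0, 0, 0) ∂(H.batched M d).tableLaw)
    rw [← h]
    simp [virtualRun_zero]
    rfl
  | succ n ih =>
    let j : Fin H.m := ⟨n, hn⟩
    have hG : Measurable fun x : (H.batched M d).K × (H.batched M d).Trace × Outcome H.I H.m =>
        F (x.2.1.record j (H.lift (stock := H.batch M d) j x.1 (z j) x.2.2)) :=
      measurable_from_prod_countable_right fun κ => by
        have h1 : Measurable fun p : (H.batched M d).Trace × Outcome H.I H.m =>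
            (p.1, H.lift (stock := H.batch M d) j κ (z j) p.2) :=
          measurable_fst.prodMk
            ((H.measurable_lift (stock := H.batch M d) j κ (z j)).comp measurable_snd)
        exact hF.comp ((Trace.measurable_record (H := H.batched M d) j).comp h1)
    set G : (H.batched M d).K → (H.batched M d).Trace → Outcome H.I H.m → ℝ≥0∞ :=
      fun κ τ y => F (τ.record j (H.lift (stock := H.batch M d) j κ (z j) y)) with hGdef
    have hF' : Measurable fun τ : (H.batched M d).Trace =>
        ∫⁻ y, G (π.act u j τ) τ y ∂(H.law j (π.act u j τ).1 (z j)) := by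
      have h1 : Measurable fun x : (H.batched M d).K × (H.batched M d).Trace =>
          ∫⁻ y, G x.1 x.2 y ∂(H.law j x.1.1 (z j)) :=
        measurable_from_prod_countable_right fun κ =>
          (Measurable.lintegral_prod_right' (ν := H.law j κ.1 (z j))
            (f := fun p : (H.batched M d).Trace × Outcome H.I H.m => G κ p.1 p.2)
            (hG.comp (measurable_const.prodMk measurable_id)))
      exact h1.comp (((π.measurable_act j).comp (measurable_const.prodMk measurable_id)).prodMk
        measurable_id)
    -- The outcome law of the batched instance is the image of the original law under `lift`, so the
    -- new draw may be taken among original outcomes, as in the virtual run.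
    have hR : ∫⁻ o, F (π.trace z 0 o u (n + 1)) ∂(H.batched M d).tableLaw =
        ∫⁻ o, ∫⁻ y, G (π.act u j (π.trace z 0 o u n)) (π.trace z 0 o u n) y
          ∂(H.law j (π.act u j (π.trace z 0 o u n)).1 (z j)) ∂(H.batched M d).tableLaw := by
      have h1 : ∀ o, π.trace z 0 o u (n + 1) = _ := fun o => π.toPolicy.trace_succ z 0 o u j
      simp only [h1]
      refine (π.toPolicy.lintegral_trace_step z 0 u j (F := fun p => F (p.1.record j p.2))
        (hF.comp (Trace.measurable_record (H := H.batched M d) j))).trans ?_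
      refine lintegral_congr fun o => ?_
      exact lintegral_map (hF.comp ((Trace.measurable_record (H := H.batched M d) j).comp
        (measurable_const.prodMk measurable_id)))
        (H.measurable_lift (stock := H.batch M d) j _ (z j))
    rw [hR, ← ih (by omega) hF']
    let V : H.Table → H.Table → (H.batched M d).Trace := fun o σ => virtualRun π u z ζ o σ n
    let E : Set (H.Table × H.Table) := {p | Executable (realRun π u z ζ p.1 p.2 j) j
      (π.act u j (virtualRun π u z ζ p.1 p.2 j))}
    have hE : MeasurableSet E := measurableSet_executable_virtualRun π u z ζ j
    have hV : Measurable fun p : H.Table × H.Table => V p.1 p.2 := measurable_virtualRun π u z ζ n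
    have hact : Measurable fun p : H.Table × H.Table => π.act u j (V p.1 p.2) :=
      measurable_act_virtualRun π u z ζ j n
    have hentry : Measurable fun p : (H.K × H.Table) => p.2 j p.1 (z j) :=
      measurable_from_prod_countable_right fun k => by dsimp only; fun_prop
    have hfst : Measurable fun κ : (H.batched M d).K => κ.1 := measurable_of_countable _
    -- On the event `E` that the virtual action is executed, the next outcome comes from the real
    -- table `o`; off `E` it comes from the simulated table `σ`. `A` and `B` are these two
    -- contributions, and `A'` and `B'` have the entry replaced by an independent draw.
    let A : H.Table → H.Table → ℝ≥0∞ := fun o σ =>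
      E.indicator 1 (o, σ) * G (π.act u j (V o σ)) (V o σ) (o j (π.act u j (V o σ)).1 (z j))
    let B : H.Table → H.Table → ℝ≥0∞ := fun o σ =>
      Eᶜ.indicator 1 (o, σ) * G (π.act u j (V o σ)) (V o σ) (σ j (π.act u j (V o σ)).1 (z j))
    let A' : H.Table → H.Table → ℝ≥0∞ := fun o σ =>
      ∫⁻ y, E.indicator 1 (o, σ) * G (π.act u j (V o σ)) (V o σ) y
        ∂(H.law j (π.act u j (V o σ)).1 (z j))
    let B' : H.Table → H.Table → ℝ≥0∞ := fun o σ =>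
      ∫⁻ y, Eᶜ.indicator 1 (o, σ) * G (π.act u j (V o σ)) (V o σ) y
        ∂(H.law j (π.act u j (V o σ)).1 (z j))
    have hGm : Measurable fun p : (H.Table × H.Table) × Outcome H.I H.m =>
        G (π.act u j (V p.1.1 p.1.2)) (V p.1.1 p.1.2) p.2 :=
      hG.comp ((hact.comp measurable_fst).prodMk ((hV.comp measurable_fst).prodMk measurable_snd))
    have hIE : Measurable (E.indicator (1 : H.Table × H.Table → ℝ≥0∞)) :=
      measurable_one.indicator hE
    have hIE' : Measurable (Eᶜ.indicator (1 : H.Table × H.Table → ℝ≥0∞)) :=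
      measurable_one.indicator hE.compl
    have hA : Measurable fun p : H.Table × H.Table => A p.1 p.2 :=
      hIE.mul (hGm.comp (measurable_id.prodMk
        (hentry.comp ((hfst.comp hact).prodMk measurable_fst))))
    have hB : Measurable fun p : H.Table × H.Table => B p.1 p.2 :=
      hIE'.mul (hGm.comp (measurable_id.prodMk
        (hentry.comp ((hfst.comp hact).prodMk measurable_snd))))
    have hA' : Measurable fun p : H.Table × H.Table => A' p.1 p.2 := by
      have h1 : Measurable fun x : H.K × H.Table × H.Table =>
          ∫⁻ y, E.indicator 1 x.2 * G (π.act u j (V x.2.1 x.2.2)) (V x.2.1 x.2.2) y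
            ∂(H.law j x.1 (z j)) :=
        measurable_from_prod_countable_right fun k =>
          Measurable.lintegral_prod_right' (ν := H.law j k (z j))
            (f := fun p : (H.Table × H.Table) × Outcome H.I H.m =>
              E.indicator 1 p.1 * G (π.act u j (V p.1.1 p.1.2)) (V p.1.1 p.1.2) p.2)
            ((hIE.comp measurable_fst).mul hGm)
      exact h1.comp ((hfst.comp hact).prodMk measurable_id)
    have hB' : Measurable fun p : H.Table × H.Table => B' p.1 p.2 := by
      have h1 : Measurable fun x : H.K × H.Table × H.Table =>
          ∫⁻ y, Eᶜ.indicator 1 x.2 * G (π.act u j (V x.2.1 x.2.2)) (V x.2.1 x.2.2) y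
            ∂(H.law j x.1 (z j)) :=
        measurable_from_prod_countable_right fun k =>
          Measurable.lintegral_prod_right' (ν := H.law j k (z j))
            (f := fun p : (H.Table × H.Table) × Outcome H.I H.m =>
              Eᶜ.indicator 1 p.1 * G (π.act u j (V p.1.1 p.1.2)) (V p.1.1 p.1.2) p.2)
            ((hIE'.comp measurable_fst).mul hGm)
      exact h1.comp ((hfst.comp hact).prodMk measurable_id)
    have hVo : ∀ o σ r, V (Function.update o j r) σ = V o σ := fun o σ r =>
      virtualRun_update π u z ζ o σ le_rfl r
    have hVσ : ∀ o σ r, V o (Function.update σ j r) = V o σ := fun o σ r =>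
      virtualRun_update_sim π u z ζ o σ le_rfl r
    have hEo : ∀ o σ r, (Function.update o j r, σ) ∈ E ↔ (o, σ) ∈ E := by
      intro o σ r
      simp only [E, Set.mem_ofPred_eq, virtualRun_update π u z ζ o σ le_rfl,
        realRun_update π u z ζ o σ le_rfl]
    have hEσ : ∀ o σ r, (o, Function.update σ j r) ∈ E ↔ (o, σ) ∈ E := by
      intro o σ r
      simp only [E, Set.mem_ofPred_eq, virtualRun_update_sim π u z ζ o σ le_rfl,
        realRun_update_sim π u z ζ o σ le_rfl]
    have hsplit : ∀ o σ, F (virtualRun π u z ζ o σ (n + 1)) = A o σ + B o σ := by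
      intro o σ
      rw [virtualRun_succ π u z ζ o σ j]
      by_cases h : (o, σ) ∈ E
      · have h' : Executable (realRun π u z ζ o σ j) j
          (π.act u j (virtualRun π u z ζ o σ j)) := h
        simp only [if_pos h', A, B, hGdef, V, Set.indicator_of_mem h,
          Set.indicator_of_notMem (Set.notMem_compl_iff.2 h), Pi.one_apply, one_mul, zero_mul,
          add_zero]
        rfl
      · have h' : ¬ Executable (realRun π u z ζ o σ j) j
          (π.act u j (virtualRun π u z ζ o σ j)) := h
        simp only [if_neg h', A, B, hGdef, V, Set.indicator_of_notMem h,
          Set.indicator_of_mem (Set.mem_compl h), Pi.one_apply, one_mul, zero_mul, zero_add]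
        rfl
    have hjoin : ∀ o σ, ∫⁻ y, G (π.act u j (V o σ)) (V o σ) y
        ∂(H.law j (π.act u j (V o σ)).1 (z j)) = A' o σ + B' o σ := by
      intro o σ
      by_cases h : (o, σ) ∈ E
      · simp only [A', B', Set.indicator_of_mem h,
          Set.indicator_of_notMem (Set.notMem_compl_iff.2 h), Pi.one_apply, one_mul, zero_mul,
          lintegral_zero, add_zero]
      · simp only [A', B', Set.indicator_of_notMem h, Set.indicator_of_mem (Set.mem_compl h),
          Pi.one_apply, one_mul, zero_mul, lintegral_zero, zero_add]
    -- With `σ` fixed, neither `E` nor the virtual record before `j` sees row `j` of `o`, so its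
    -- selected entry can be integrated separately.
    have hAA : ∫⁻ σ, ∫⁻ o, A o σ ∂H.tableLaw ∂H.tableLaw =
        ∫⁻ σ, ∫⁻ o, A' o σ ∂H.tableLaw ∂H.tableLaw := by
      refine lintegral_congr fun σ => ?_
      refine H.lintegral_table_entry j (z j) (κ := fun o => (π.act u j (V o σ)).1)
        (F := fun p => E.indicator 1 (p.1, σ) * G (π.act u j (V p.1 σ)) (V p.1 σ) p.2)
        (hfst.comp (hact.comp measurable_prodMk_right)) ?_ ?_ ?_
      · exact ((hIE.comp measurable_fst).mul hGm).comp
          (((measurable_fst.prodMk measurable_const)).prodMk measurable_snd)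
      · intro o r; simp only [hVo]
      · intro o r y
        simp only [hVo, Set.indicator_apply, hEo, Pi.one_apply]
    have hBB : ∫⁻ σ, ∫⁻ o, B o σ ∂H.tableLaw ∂H.tableLaw =
        ∫⁻ σ, ∫⁻ o, B' o σ ∂H.tableLaw ∂H.tableLaw := by
      -- The simulated entry has to be integrated first, so the order of the two tables is exchanged
      -- and `o` is the one held fixed.
      rw [lintegral_lintegral_swap (f := fun σ o => B o σ) (hB.comp measurable_swap).aemeasurable,
        lintegral_lintegral_swap (f := fun σ o => B' o σ) (hB'.comp measurable_swap).aemeasurable]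
      refine lintegral_congr fun o => ?_
      refine H.lintegral_table_entry j (z j) (κ := fun σ => (π.act u j (V o σ)).1)
        (F := fun p => Eᶜ.indicator 1 (o, p.1) * G (π.act u j (V o p.1)) (V o p.1) p.2)
        (hfst.comp (hact.comp measurable_prodMk_left)) ?_ ?_ ?_
      · exact ((hIE'.comp measurable_fst).mul hGm).comp
          (((measurable_const.prodMk measurable_fst)).prodMk measurable_snd)
      · intro σ r; simp only [hVσ]
      · intro σ r y
        simp only [hVσ, Set.indicator_apply, Set.mem_compl_iff, hEσ, Pi.one_apply]
    have hadd : ∀ (f g : H.Table → H.Table → ℝ≥0∞),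
        (Measurable fun p : H.Table × H.Table => f p.1 p.2) →
        ∫⁻ σ, ∫⁻ o, f o σ + g o σ ∂H.tableLaw ∂H.tableLaw =
          ∫⁻ σ, ∫⁻ o, f o σ ∂H.tableLaw ∂H.tableLaw +
            ∫⁻ σ, ∫⁻ o, g o σ ∂H.tableLaw ∂H.tableLaw := by
      intro f g hf
      rw [← lintegral_add_left]
      · refine lintegral_congr fun σ => ?_
        exact lintegral_add_left (hf.comp measurable_prodMk_right) _
      · exact (hf.comp measurable_swap).lintegral_prod_right'
    simp only [hsplit]
    rw [hadd A B hA, hAA, hBB, ← hadd A' B' hA']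
    exact lintegral_congr fun σ => lintegral_congr fun o => (hjoin o σ).symm

end Virtual

end AllocInstance

/-! ### A union bound on a product space. -/

open Classical in
theorem sum_indicator_le {I Ω : Type*} [Fintype I] {U : I → Set Ω} {d : ℕ} {x : Ω}
    (hd : {i | x ∈ U i}.ncard ≤ d) (f : Ω → ℝ≥0∞) : ∑ i, (U i).indicator f x ≤ d * f x := by
  have h : ∑ i, (U i).indicator f x = ({i | x ∈ U i}.ncard : ℝ≥0∞) * f x := by
    simp only [Set.indicator_apply]
    rw [← Finset.sum_filter, Finset.sum_const, nsmul_eq_mul, Set.ncard_eq_toFinset_card']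
    congr 3
    ext i
    simp
  rw [h]
  gcongr

/-- A union bound: if at most `d` of the bad events `S i`, each of probability at most `p`, matter
at every point, then excluding them costs at most the fraction `d * p` of an integral. -/
theorem lintegral_le_add_of_union_bound {I Ω Ω' : Type*} [Fintype I] [MeasurableSpace Ω]
    [MeasurableSpace Ω'] (P : Measure Ω) [IsProbabilityMeasure P] (ν : Measure Ω')
    {f : Ω' → ℝ≥0∞} (hf : Measurable f) {U : I → Set Ω'} {S : I → Set Ω}
    (hU : ∀ i, MeasurableSet (U i)) (hS : ∀ i, MeasurableSet (S i)) {p : ℝ≥0∞}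
    (hp : ∀ i, P (S i) ≤ p) {d : ℕ} (hd : ∀ x, {i | x ∈ U i}.ncard ≤ d) :
    ∫⁻ x, f x ∂ν ≤ ∫⁻ ω, ∫⁻ x, {x | ∀ i, x ∈ U i → ω ∉ S i}.indicator f x ∂ν ∂P
      + d * p * ∫⁻ x, f x ∂ν := by
  -- For fixed `ω`, a point `x` that is cut away lies in some `U i` with `ω ∈ S i`, and that single
  -- term of the sum already pays for `f x`. Since `S i` depends only on `ω` and `U i` only on `x`,
  -- the two factors integrate independently.
  have h1 : ∀ ω, ∫⁻ x, f x ∂ν ≤ ∫⁻ x, {x | ∀ i, x ∈ U i → ω ∉ S i}.indicator f x ∂ν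
      + ∑ i, (S i).indicator 1 ω * ∫⁻ x, (U i).indicator f x ∂ν := by
    intro ω
    have h2 : ∑ i, (S i).indicator 1 ω * ∫⁻ x, (U i).indicator f x ∂ν =
        ∫⁻ x, ∑ i, (S i).indicator 1 ω * (U i).indicator f x ∂ν := by
      rw [lintegral_finsetSum _ fun i _ => (hf.indicator (hU i)).const_mul _]
      refine Finset.sum_congr rfl fun i _ => ?_
      rw [lintegral_const_mul _ (hf.indicator (hU i))]
    rw [h2, ← lintegral_add_right _
      (Finset.measurable_sum _ fun i _ => (hf.indicator (hU i)).const_mul _)]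
    refine lintegral_mono fun x => ?_
    by_cases hx : ∀ i, x ∈ U i → ω ∉ S i
    · rw [Set.indicator_of_mem (s := {x | ∀ i, x ∈ U i → ω ∉ S i}) hx]
      exact le_self_add
    · push Not at hx
      obtain ⟨i, hi, hi'⟩ := hx
      refine le_add_left (le_trans ?_ (Finset.single_le_sum
        (f := fun i => (S i).indicator 1 ω * (U i).indicator f x)
        (fun _ _ => zero_le) (Finset.mem_univ i)))
      simp [hi, hi']
  have hm : Measurable fun ω => ∑ i, (S i).indicator (1 : Ω → ℝ≥0∞) ω *
      ∫⁻ x, (U i).indicator f x ∂ν :=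
    Finset.measurable_sum _ fun i _ => (measurable_one.indicator (hS i)).mul_const _
  calc ∫⁻ x, f x ∂ν = ∫⁻ _, ∫⁻ x, f x ∂ν ∂P := by simp
    _ ≤ _ := lintegral_mono h1
    _ = _ := lintegral_add_right _ hm
    _ ≤ _ := by
      gcongr
      rw [lintegral_finsetSum _ fun i _ => (measurable_one.indicator (hS i)).mul_const _]
      have h3 : ∀ i, ∫⁻ ω, (S i).indicator 1 ω * ∫⁻ x, (U i).indicator f x ∂ν ∂P ≤
          p * ∫⁻ x, (U i).indicator f x ∂ν := by
        intro i
        rw [lintegral_mul_const _ (measurable_one.indicator (hS i)), lintegral_indicator_one (hS i)]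
        gcongr
        exact hp i
      refine (Finset.sum_le_sum fun i _ => h3 i).trans ?_
      rw [← Finset.mul_sum, ← lintegral_finsetSum _ fun i _ => hf.indicator (hU i),
        mul_comm (d : ℝ≥0∞) p, mul_assoc, ← lintegral_const_mul _ hf]
      gcongr with x
      exact sum_indicator_le (hd x) f

/-! ### Execution of the virtual actions in reality. -/

namespace AllocInstance

/-- The total remaining inventory of the versions of a resource introduced so far. -/
theorem sum_introduced_remaining {H : AllocInstance} {stock : H.I → Fin H.m → ℝ}
    (hs : ∀ i j, 0 ≤ stock i j) {τ : (H.addCopies stock).Trace} (hr : τ.repl = 0) (i : H.I)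
    (j : Fin H.m) : ∑ v ∈ introduced stock i j,
        Trace.remaining (H := H.addCopies stock) τ j ⟨i, v⟩ =
      H.inv i + ∑ t ∈ Finset.Iic j, stock i t - ∑ t ∈ Finset.Iio j,
        ∑ v ∈ introduced stock i j, τ.cons t ⟨i, v⟩ j := by
  unfold Trace.remaining
  rw [Finset.sum_sub_distrib, Finset.sum_add_distrib, hr]
  refine congrArg₂ (· - ·) ?_ Finset.sum_comm
  refine Eq.trans (add_eq_left.2 ?_) (sum_introduced_inv hs i j)
  exact Finset.sum_eq_zero fun v _ => Finset.sum_eq_zero fun t _ => rfl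

section Execution

variable {H : AllocInstance} {M : ℝ} {d : ℕ} (π : OnlinePolicy (H.batched M d)) (u : π.Seed)
  (z : Fin H.m → H.Z) (ζ : Fin H.m → H.I → ℝ) {o σ : H.Table}

theorem feasible_virtualRun (ho : H.IsTable o) (hσ : H.IsTable σ) {n : ℕ} (hn : n ≤ H.m) :
    (virtualRun π u z ζ o σ n).Feasible n := by
  induction n with
  | zero => exact fun t ht => absurd ht (by simp)
  | succ n ih =>
    rw [virtualRun_succ π u z ζ o σ ⟨n, hn⟩]
    refine Trace.Feasible.record (H := H.batched M d) (n := ⟨n, hn⟩) (ih (by omega))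
      (π.implementable u ⟨n, hn⟩ _) ?_
    rw [types_virtualRun π u z ζ o σ n (by omega)]
    refine IsOutcome.lift (stock := H.batch M d) ?_
    split_ifs
    · exact ho _ _ _
    · exact hσ _ _ _

/-- A real action is either the original of the virtual one, with the same outcome charged to a
chosen version, or the trivial action, which consumes nothing. So the real run never holds more of a
resource than the virtual run does. -/
theorem cons_realRun_le (ho : H.IsTable o) (hσ : H.IsTable σ) {n : ℕ} (hn : n ≤ H.m)
    {t l : Fin H.m} (ht : t < n) (hl : t ≤ l) (i : H.I) :
    (realRun π u z ζ o σ n).cons t i l ≤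
      ∑ v ∈ introduced (H.batch M d) i l, (virtualRun π u z ζ o σ n).cons t ⟨i, v⟩ l := by
  classical
  induction n with
  | zero => omega
  | succ n ih =>
    have hfeas := feasible_virtualRun π u z ζ ho hσ hn
    have hnn : 0 ≤ ∑ v ∈ introduced (H.batch M d) i l,
        (virtualRun π u z ζ o σ (n + 1)).cons t ⟨i, v⟩ l :=
      Finset.sum_nonneg fun v _ => hfeas.cons_nonneg (H := H.batched M d) ht hl _
    rcases Nat.lt_succ_iff_lt_or_eq.1 ht with h | h
    · have hne : t ≠ ⟨n, hn⟩ := fun e => by subst e; simp at h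
      have e1 : (realRun π u z ζ o σ (n + 1)).cons t = (realRun π u z ζ o σ n).cons t := by
        rw [realRun_succ π u z ζ o σ ⟨n, hn⟩, Trace.cons_record_of_ne _ hne]
      have e2 : (virtualRun π u z ζ o σ (n + 1)).cons t = (virtualRun π u z ζ o σ n).cons t := by
        rw [virtualRun_succ π u z ζ o σ ⟨n, hn⟩]
        exact Trace.cons_record_of_ne (H := H.batched M d) _ hne _
      rw [e1, e2]
      exact ih (by omega) h
    · obtain rfl : n = t := h.symm
      set κ := π.act u t (virtualRun π u z ζ o σ t) with hκ
      have e1 : (realRun π u z ζ o σ (t + 1)).cons t =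
          (o t (realAct π u σ t (realRun π u z ζ o σ t)) (z t)).1 := by
        rw [realRun_succ, Trace.cons_record_self]
      rw [e1]
      by_cases hx : Executable (realRun π u z ζ o σ t) t κ
      · have hact : realAct π u σ t (realRun π u z ζ o σ t) = κ.1 := if_pos hx
        have e2 : (virtualRun π u z ζ o σ (t + 1)).cons t =
            (H.lift (stock := H.batch M d) t κ (z t) (o t κ.1 (z t))).1 := by
          rw [virtualRun_succ]
          refine (Trace.cons_record_self (H := H.batched M d) _ _ _).trans ?_
          exact congrArg (fun y => (H.lift (stock := H.batch M d) t κ (z t) y).1) (if_pos hx)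
        rw [hact]
        by_cases hv : κ.2 i ∈ introduced (H.batch M d) i l
        · refine le_of_eq ?_
          refine (sum_introduced_lift t l κ (z t) (o t κ.1 (z t)) i _ hv).symm.trans ?_
          exact Finset.sum_congr rfl fun v _ => (congrFun (congrFun e2 ⟨i, v⟩) l).symm
        -- An executed action is active, so a version it really uses was introduced by request `t`,
        -- hence by `l`. A version outside the sum therefore belongs to an unused resource.
        · have hb : H.b i t κ.1 (z t) t = 0 := by
            by_contra hb
            refine hv (mem_introduced.2 fun s hs => le_trans ?_ hl)
            have := hx.1 i
            rw [types_realRun] at this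
            exact this hb s hs
          rw [(ho t κ.1 (z t)).eq_zero hb hl]
          exact hnn
      · have hact : realAct π u σ t (realRun π u z ζ o σ t) = H.k₀ := if_neg hx
        rw [hact, (ho t H.k₀ (z t)).eq_zero (H.b_trivial i t _ t le_rfl) hl]
        exact hnn

/-- If the replenishment has kept up with the batches, then the virtual action can be executed. -/
theorem executable_of_batch_le (ho : H.IsTable o) (hσ : H.IsTable σ)
    (hbatch : ∀ i j, 0 ≤ H.batch M d i j) {j : Fin H.m}
    (hact : H.Active (stock := H.batch M d) j (π.act u j (virtualRun π u z ζ o σ j)) (z j))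
    (hζ : ∀ i, H.b i j (π.act u j (virtualRun π u z ζ o σ j)).1 (z j) j ≠ 0 →
      ∑ t ∈ Finset.Iic j, H.batch M d i t ≤ ∑ t ∈ Finset.Iic j, ζ t i) :
    Executable (realRun π u z ζ o σ j) j (π.act u j (virtualRun π u z ζ o σ j)) := by
  set κ := π.act u j (virtualRun π u z ζ o σ j) with hκ
  refine ⟨by rwa [types_realRun], fun i hi => ?_⟩
  rw [types_realRun] at hi ⊢
  have hfeas := feasible_virtualRun π u z ζ ho hσ j.2.le
  have hrepl := repl_virtualRun π u z ζ o σ j j.2.le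
  have hv : κ.2 i ∈ introduced (H.batch M d) i j := mem_introduced.2 fun s hs => hact i hi s hs
  have hb : (H.batched M d).b ⟨i, κ.2 i⟩ j κ (z j) j = H.b i j κ.1 (z j) j :=
    addCopies_b_self j κ (z j) j i
  have h1 : H.b i j κ.1 (z j) j ≤
      Trace.remaining (H := H.batched M d) (virtualRun π u z ζ o σ j) j ⟨i, κ.2 i⟩ := by
    have := π.implementable u j (virtualRun π u z ζ o σ j) ⟨i, κ.2 i⟩
    rw [types_virtualRun π u z ζ o σ j j.2.le] at this
    rw [← hb] at hi ⊢
    exact this hi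
  have h2 : ∀ v, 0 ≤ Trace.remaining (H := H.batched M d) (virtualRun π u z ζ o σ j) j ⟨i, v⟩ :=
    fun v => hfeas.remaining_nonneg (H := H.batched M d) (by rw [hrepl]; intro _ _; rfl) _
  -- The virtual action needs room in one version only. The other introduced versions have
  -- nonnegative remainders, so the total remainder is enough as well, and the total can be compared
  -- with the real inventory.
  have h3 := Finset.single_le_sum (f := fun v =>
    Trace.remaining (H := H.batched M d) (virtualRun π u z ζ o σ j) j ⟨i, v⟩)
    (fun v _ => h2 v) hv
  have h4 : ∑ v ∈ introduced (H.batch M d) i j,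
      Trace.remaining (H := H.batched M d) (virtualRun π u z ζ o σ j) j ⟨i, v⟩ =
      H.inv i + ∑ t ∈ Finset.Iic j, H.batch M d i t - ∑ t ∈ Finset.Iio j,
        ∑ v ∈ introduced (H.batch M d) i j, (virtualRun π u z ζ o σ j).cons t ⟨i, v⟩ j :=
    sum_introduced_remaining hbatch hrepl i j
  have h5 : ∑ t ∈ Finset.Iio j, (realRun π u z ζ o σ j).cons t i j ≤ ∑ t ∈ Finset.Iio j,
      ∑ v ∈ introduced (H.batch M d) i j, (virtualRun π u z ζ o σ j).cons t ⟨i, v⟩ j :=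
    Finset.sum_le_sum fun t ht => cons_realRun_le π u z ζ ho hσ j.2.le
      (Fin.lt_def.1 (Finset.mem_Iio.1 ht)) (Finset.mem_Iio.1 ht).le i
  have h6 := hζ i hi
  unfold Trace.remaining
  rw [repl_realRun]
  have h7 := h1.trans h3
  rw [h4] at h7
  linarith

open Classical in
/-- While the replenishment keeps up with the batches, the batching extension earns what the virtual
run earns. -/
theorem rew_virtualRun_le (ho : H.IsTable o) (hσ : H.IsTable σ)
    (hbatch : ∀ i j, 0 ≤ H.batch M d i j) (j : Fin H.m) (i : H.I)
    (v : H.Version (H.batch M d) i) :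
    (if ∀ i, H.b i j (π.act u j (virtualRun π u z ζ o σ (j + 1))).1 (z j) j ≠ 0 →
        ∑ t ∈ Finset.Iic j, H.batch M d i t ≤ ∑ t ∈ Finset.Iic j, ζ t i
      then (virtualRun π u z ζ o σ (j + 1)).rew j ⟨i, v⟩ else 0) ≤
      (realRun π u z ζ o σ (j + 1)).rew j i := by
  have hact : π.act u j (virtualRun π u z ζ o σ (j + 1)) =
      π.act u j (virtualRun π u z ζ o σ j) := by
    rw [virtualRun_succ]
    exact π.nonanticipating u j _ _ rfl rfl
      (Trace.sameOutcomes_record (H := H.batched M d) _ le_rfl _)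
  rw [hact]
  set κ := π.act u j (virtualRun π u z ζ o σ j) with hκ
  have e1 : (realRun π u z ζ o σ (j + 1)).rew j =
      (o j (realAct π u σ j (realRun π u z ζ o σ j)) (z j)).2 := by
    rw [realRun_succ, Trace.rew_record_self]
  have hnn : 0 ≤ (realRun π u z ζ o σ (j + 1)).rew j i := by
    rw [e1]; exact (ho _ _ _).2.2 i
  split_ifs with hζ
  · by_cases ha : H.Active (stock := H.batch M d) j κ (z j)
    · have hx : Executable (realRun π u z ζ o σ j) j κ :=
        executable_of_batch_le π u z ζ ho hσ hbatch ha hζ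
      have hact : realAct π u σ j (realRun π u z ζ o σ j) = κ.1 := if_pos hx
      have e2 : (virtualRun π u z ζ o σ (j + 1)).rew j =
          (H.lift (stock := H.batch M d) j κ (z j) (o j κ.1 (z j))).2 := by
        rw [virtualRun_succ]
        refine (Trace.rew_record_self (H := H.batched M d) _ _ _).trans ?_
        exact congrArg (fun y => (H.lift (stock := H.batch M d) j κ (z j) y).2) (if_pos hx)
      rw [e1, e2, hact]
      exact (if_pos ha).le
    -- An inactive virtual action is not executed, but it earns nothing on the batched instance
    -- either.
    · refine le_trans (le_of_eq ?_) hnn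
      rw [virtualRun_succ]
      refine (congrFun (Trace.rew_record_self (H := H.batched M d) _ _ _) _).trans ?_
      exact if_neg ha
  · exact hnn

end Execution

set_option synthInstance.maxSize 1000 in
-- Given the types, the replenishment is independent of the virtual run, whose law does not involve
-- it. Profit is lost only if a used resource runs short, and each of the at most `d` shortages has
-- probability at most `p` independently of the profit at stake.
theorem profitAt_extend {H : AllocInstance} {M : ℝ} {d : ℕ} (π : OnlinePolicy (H.batched M d))
    (hd : ∀ j k z, {i | H.b i j k z j ≠ 0}.ncard ≤ d) (hbatch : ∀ i j, 0 ≤ H.batch M d i j)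
    {p : ℝ≥0∞} (hp : ∀ i j, H.replsLaw
      {ζ | ∑ t ∈ Finset.Iic j, ζ t i < ∑ t ∈ Finset.Iic j, H.batch M d i t} ≤ p)
    (j : Fin H.m) (i : H.I) (v : H.Version (H.batch M d) i) :
    π.profitAt ⟨i, v⟩ j ≤ (extend π).profitAt i j + d * p * π.profitAt ⟨i, v⟩ j := by
  classical
  let ν := π.seedLaw.prod (H.batched M d).tableLaw
  let f : (Fin H.m → H.Z) → π.Seed × (H.batched M d).Table → ℝ≥0∞ := fun z x =>
    ENNReal.ofReal ((π.trace z 0 x.2 x.1 (j + 1)).rew j ⟨i, v⟩)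
  let U : (Fin H.m → H.Z) → H.I → Set (π.Seed × (H.batched M d).Table) := fun z i' =>
    {x | H.b i' j (π.act x.1 j (π.trace z 0 x.2 x.1 (j + 1))).1 (z j) j ≠ 0}
  let S : H.I → Set (Fin H.m → H.I → ℝ) := fun i' =>
    {ζ | ∑ t ∈ Finset.Iic j, ζ t i' < ∑ t ∈ Finset.Iic j, H.batch M d i' t}
  have hinj : ∀ z : Fin H.m → H.Z, Measurable fun x : π.Seed × (H.batched M d).Table =>
      ((z, 0, x.2, x.1) : (Fin (H.batched M d).m → (H.batched M d).Z) ×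
        (Fin (H.batched M d).m → (H.batched M d).I → ℝ) × (H.batched M d).Table × π.Seed) :=
    fun z => measurable_const.prodMk
      (measurable_const.prodMk (measurable_snd.prodMk measurable_fst))
  have htr : ∀ z, Measurable fun x : π.Seed × (H.batched M d).Table =>
      π.trace z 0 x.2 x.1 (j + 1) := fun z =>
    (π.toPolicy.measurable_trace (j + 1)).comp (hinj z)
  have hact : ∀ z, Measurable fun x : π.Seed × (H.batched M d).Table =>
      π.act x.1 j (π.trace z 0 x.2 x.1 (j + 1)) := fun z =>
    (π.toPolicy.measurable_act_trace j (j + 1)).comp (hinj z)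
  have hrew : Measurable fun τ : (H.batched M d).Trace => ENNReal.ofReal (τ.rew j ⟨i, v⟩) :=
    ((measurable_pi_apply (⟨i, v⟩ : (H.batched M d).I)).comp ((measurable_pi_apply j).comp
      (Trace.measurable_rew (H := H.batched M d)))).ennreal_ofReal
  have hf : ∀ z, Measurable (f z) := fun z => hrew.comp (htr z)
  have hU : ∀ z i', MeasurableSet (U z i') := fun z i' =>
    hact z (MeasurableSet.of_discrete (s := {κ : (H.batched M d).K | H.b i' j κ.1 (z j) j ≠ 0}))
  have hS : ∀ i', MeasurableSet (S i') := fun i' =>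
    measurableSet_lt (by fun_prop) measurable_const
  -- The shortages `S` live on the replenishments, the used resources `U` and the profit on the seed
  -- and table of the batched run; the union bound is applied to this product for each type
  -- sequence.
  have hbound := fun z => lintegral_le_add_of_union_bound H.replsLaw ν (hf z) (hU z) hS
    (fun i' => hp i' j) (d := d) (fun x => hd j _ (z j))
  have hgood : ∀ z ζ, ∫⁻ x, {x | ∀ i', x ∈ U z i' → ζ ∉ S i'}.indicator (f z) x ∂ν ≤
      ∫⁻ w, ∫⁻ o, ENNReal.ofReal (((extend π).trace z ζ o w (j + 1)).rew j i)
        ∂H.tableLaw ∂(extend π).seedLaw := by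
    intro z ζ
    have hGm : MeasurableSet {x | ∀ i', x ∈ U z i' → ζ ∉ S i'} := by
      simp only [Set.ofPred_forall]
      exact MeasurableSet.iInter fun i' => by
        by_cases h : ζ ∈ S i'
        · have e : {x | x ∈ U z i' → ζ ∉ S i'} = (U z i')ᶜ := by ext; simp [h]
          rw [e]
          exact (hU z i').compl
        · simp [h]
    have h1 : ∫⁻ x, {x | ∀ i', x ∈ U z i' → ζ ∉ S i'}.indicator (f z) x ∂ν =
        ∫⁻ u, ∫⁻ o, {x | ∀ i', x ∈ U z i' → ζ ∉ S i'}.indicator (f z) (u, o)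
          ∂(H.batched M d).tableLaw ∂π.seedLaw :=
      lintegral_prod _ ((hf z).indicator hGm).aemeasurable
    have hm : Measurable fun w : (π.Seed × H.Table) × H.Table =>
        ENNReal.ofReal (((extend π).trace z ζ w.2 w.1 (j + 1)).rew j i) := by
      have h2 : Measurable fun w : (π.Seed × H.Table) × H.Table =>
          ((z, ζ, w.2, w.1) : (Fin H.m → H.Z) × (Fin H.m → H.I → ℝ) × H.Table ×
            (π.Seed × H.Table)) :=
        measurable_const.prodMk (measurable_const.prodMk (measurable_snd.prodMk measurable_fst))
      exact ((measurable_pi_apply i).comp ((measurable_pi_apply j).comp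
        (Trace.measurable_rew.comp (((extend π).measurable_trace (j + 1)).comp h2)))).ennreal_ofReal
    have h2 : ∫⁻ w, ∫⁻ o, ENNReal.ofReal (((extend π).trace z ζ o w (j + 1)).rew j i)
        ∂H.tableLaw ∂(extend π).seedLaw =
        ∫⁻ u, ∫⁻ σ, ∫⁻ o, ENNReal.ofReal ((realRun π u z ζ o σ (j + 1)).rew j i)
          ∂H.tableLaw ∂H.tableLaw ∂π.seedLaw :=
      lintegral_prod (μ := π.seedLaw) (ν := H.tableLaw) _
        (hm.lintegral_prod_right').aemeasurable
    rw [h1, h2]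
    refine lintegral_mono fun u => ?_
    let F : (H.batched M d).Trace → ℝ≥0∞ := fun τ =>
      if ∀ i', H.b i' j (π.act u j τ).1 (z j) j ≠ 0 →
        ∑ t ∈ Finset.Iic j, H.batch M d i' t ≤ ∑ t ∈ Finset.Iic j, ζ t i'
      then ENNReal.ofReal (τ.rew j ⟨i, v⟩) else 0
    have hF : Measurable F := by
      refine Measurable.ite ?_ hrew measurable_const
      exact ((π.measurable_act j).comp (measurable_const.prodMk measurable_id))
        (MeasurableSet.of_discrete (s := {κ : (H.batched M d).K | ∀ i', H.b i' j κ.1 (z j) j ≠ 0 →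
          ∑ t ∈ Finset.Iic j, H.batch M d i' t ≤ ∑ t ∈ Finset.Iic j, ζ t i'}))
    have h3 : ∀ o, {x | ∀ i', x ∈ U z i' → ζ ∉ S i'}.indicator (f z) (u, o) =
        F (π.trace z 0 o u (j + 1)) := by
      intro o
      simp only [Set.indicator_apply, F, f, U, S, Set.mem_ofPred_eq, not_lt]
    simp only [h3]
    -- With `z`, `ζ` and the seed fixed, the run on the batched instance is replaced by the virtual
    -- run, which shares its tables with the real run and can be compared with it pointwise.
    rw [← lintegral_virtualRun π u z ζ j.2 hF]
    refine lintegral_mono_ae ?_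
    filter_upwards [H.ae_isTable] with σ hσ
    refine lintegral_mono_ae ?_
    filter_upwards [H.ae_isTable] with o ho
    have h4 := rew_virtualRun_le π u z ζ ho hσ hbatch j i v
    simp only [F]
    split_ifs at h4 ⊢ with h5
    · exact ENNReal.ofReal_le_ofReal h4
    · exact zero_le
  have hprof : π.profitAt ⟨i, v⟩ j = ∫⁻ z, ∫⁻ x, f z x ∂ν ∂H.typesLaw := by
    refine (profitAt_addCopies π.toPolicy ⟨i, v⟩ j).trans ?_
    refine lintegral_congr fun z => ?_
    exact (lintegral_prod (ν := (H.batched M d).tableLaw) _ (hf z).aemeasurable).symm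
  calc π.profitAt ⟨i, v⟩ j = ∫⁻ z, ∫⁻ x, f z x ∂ν ∂H.typesLaw := hprof
    _ ≤ _ := lintegral_mono hbound
    _ = ∫⁻ z, ∫⁻ ζ, ∫⁻ x, {x | ∀ i', x ∈ U z i' → ζ ∉ S i'}.indicator (f z) x ∂ν
          ∂H.replsLaw ∂H.typesLaw + d * p * ∫⁻ z, ∫⁻ x, f z x ∂ν ∂H.typesLaw := by
        rw [lintegral_add_right _ (measurable_of_countable _),
          lintegral_const_mul _ (measurable_of_countable _)]
    _ ≤ _ := by
        rw [hprof]
        gcongr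
        exact lintegral_mono fun z => lintegral_mono fun ζ => hgood z ζ

end AllocInstance

namespace AllocInstance

/-! ### Batches -/

section Batches

variable (H : AllocInstance) (M : ℝ) (d : ℕ) (i : H.I)

theorem q_nonneg (j : Fin H.m) : 0 ≤ H.q i j := mul_nonneg (H.ρ_nonneg i j) (H.w_nonneg i j)

theorem eps_le_one (M : ℝ) (d : ℕ) (c : ℝ) : eps M d c ≤ 1 := min_le_right _ _

theorem fluid_nonneg (j : Fin H.m) : 0 ≤ H.fluid M d i j :=
  mul_nonneg (sub_nonneg.2 (eps_le_one _ _ _)) (H.q_nonneg i j)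

theorem pending_nonneg (n : ℕ) : 0 ≤ H.pending M d i n := by
  induction n with
  | zero => exact le_rfl
  | succ n ih =>
    unfold pending
    split_ifs
    exacts [le_rfl, add_nonneg ih (H.fluid_nonneg M d i _), ih]

theorem batch_nonneg (j : Fin H.m) : 0 ≤ H.batch M d i j := by
  unfold batch
  split_ifs
  exacts [add_nonneg (H.pending_nonneg M d i _) (H.fluid_nonneg M d i _), le_rfl]

theorem threshold_le_batch {j : Fin H.m} (h : 0 < H.batch M d i j) :
    H.threshold M d ≤ H.batch M d i j := by
  unfold batch at h ⊢
  split_ifs with h1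
  · exact h1
  · rw [if_neg h1] at h
    exact absurd h (lt_irrefl _)

theorem pending_le (h : 0 ≤ H.threshold M d) (n : ℕ) : H.pending M d i n ≤ H.threshold M d := by
  induction n with
  | zero => exact h
  | succ n ih =>
    unfold pending
    split_ifs with h1 h2
    exacts [h, (not_le.1 h2).le, ih]

/-- Conservation of fluid: each restart of the accumulation releases exactly what had been
accumulated. Together with `pending_le`, the batches lag behind the fluid by at most one threshold.
-/
theorem sum_batch_add_pending (j : Fin H.m) :
    ∑ t ∈ Finset.Iic j, H.batch M d i t + H.pending M d i (j + 1) =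
      ∑ t ∈ Finset.Iic j, H.fluid M d i t := by
  have hstep : ∀ j : Fin H.m, H.batch M d i j + H.pending M d i (j + 1) =
      H.pending M d i j + H.fluid M d i j := by
    intro j
    rw [pending, dif_pos j.2]
    unfold batch
    split_ifs <;> simp
  obtain ⟨n, hn⟩ := j
  induction n with
  | zero =>
    have h0 : Finset.Iic (⟨0, hn⟩ : Fin H.m) = {⟨0, hn⟩} := by
      ext t; simp only [Finset.mem_Iic, Finset.mem_singleton, Fin.le_def, Fin.ext_iff]; omega
    have := hstep ⟨0, hn⟩
    rw [h0, Finset.sum_singleton, Finset.sum_singleton, this]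
    simp [pending]
  | succ n ih =>
    have hn' : n < H.m := by omega
    have hIic : Finset.Iic (⟨n + 1, hn⟩ : Fin H.m) = insert ⟨n + 1, hn⟩ (Finset.Iic ⟨n, hn'⟩) := by
      ext t; simp only [Finset.mem_Iic, Finset.mem_insert, Fin.le_def, Fin.ext_iff]; omega
    have hnm : (⟨n + 1, hn⟩ : Fin H.m) ∉ Finset.Iic ⟨n, hn'⟩ := by simp [Fin.le_def]
    have h1 := hstep ⟨n + 1, hn⟩
    have h2 := ih hn'
    rw [hIic, Finset.sum_insert hnm, Finset.sum_insert hnm]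
    simp only at h1 h2 ⊢
    linarith

theorem sum_fluid (j : Fin H.m) : ∑ t ∈ Finset.Iic j, H.fluid M d i t =
    (1 - eps M d H.cMin) * ∑ t ∈ Finset.Iic j, H.q i t := by
  unfold fluid
  rw [Finset.mul_sum]

theorem sum_batch_le (j : Fin H.m) : ∑ t ∈ Finset.Iic j, H.batch M d i t ≤
    (1 - eps M d H.cMin) * ∑ t ∈ Finset.Iic j, H.q i t := by
  rw [← sum_fluid, ← sum_batch_add_pending]
  linarith [H.pending_nonneg M d i (j + 1)]

theorem le_sum_batch (h : 0 ≤ H.threshold M d) (j : Fin H.m) :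
    (1 - eps M d H.cMin) * ∑ t ∈ Finset.Iic j, H.q i t - H.threshold M d ≤
      ∑ t ∈ Finset.Iic j, H.batch M d i t := by
  rw [← sum_fluid, ← sum_batch_add_pending]
  linarith [H.pending_le M d i h (j + 1)]

end Batches

/-! ### Concentration of the replenishment -/

/-- Invert the quadratic lower bound for `exp y`; the product `(1 + y + y²/2)(1 - y + y²/2) = 1 +
y⁴/4` is at least `1`. -/
theorem exp_neg_le {y : ℝ} (hy : 0 ≤ y) : Real.exp (-y) ≤ 1 - y + y ^ 2 / 2 := by
  have h1 := Real.quadratic_le_exp_of_nonneg hy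
  have h2 : 0 < 1 + y + y ^ 2 / 2 := by positivity
  rw [Real.exp_neg]
  refine (inv_anti₀ h2 h1).trans ?_
  rw [inv_le_iff_one_le_mul₀ h2]
  nlinarith [sq_nonneg (y ^ 2)]

section Replenishment

variable (H : AllocInstance)

theorem ae_repl_nonneg : ∀ᵐ ζ ∂H.replsLaw, ∀ j i, 0 ≤ ζ j i := by
  rw [Filter.eventually_all]; intro j
  rw [Filter.eventually_all]; intro i
  have h1 := Measure.tendsto_eval_ae_ae (μ := fun j => Measure.pi fun i => H.replLaw i j) (i := j)
  have h2 := Measure.tendsto_eval_ae_ae (μ := fun i => H.replLaw i j) (i := i)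
  refine (h2.comp h1).eventually (p := fun x => 0 ≤ x) ?_
  rw [replLaw, ae_add_measure_iff]
  exact ⟨Measure.ae_smul_measure ((ae_dirac_iff measurableSet_Ici).2 (H.w_nonneg i j)) _,
    Measure.ae_smul_measure ((ae_dirac_iff measurableSet_Ici).2 (le_refl (0 : ℝ))) _⟩

theorem lintegral_replLaw (i : H.I) (j : Fin H.m) (f : ℝ → ℝ≥0∞) :
    ∫⁻ x, f x ∂H.replLaw i j =
      ENNReal.ofReal (H.ρ i j) * f (H.w i j) + ENNReal.ofReal (1 - H.ρ i j) * f 0 := by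
  simp [replLaw, lintegral_add_measure, lintegral_smul_measure]

theorem lintegral_replsLaw_eval (i : H.I) (j : Fin H.m) {f : ℝ → ℝ≥0∞} (hf : Measurable f) :
    ∫⁻ ζ, f (ζ j i) ∂H.replsLaw = ∫⁻ x, f x ∂H.replLaw i j := by
  unfold replsLaw
  rw [lintegral_pi_eval (fun j => Measure.pi fun i => H.replLaw i j) j
    (f := fun r => f (r i)) (by fun_prop), lintegral_pi_eval (fun i => H.replLaw i j) i hf]

/-- The second-order term uses `w² ≤ M w`, which turns it into a multiple of the mean `q`; then `1 -
x ≤ exp (-x)`. Only the mean and the bound `M` survive. -/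
theorem lintegral_exp_neg_replLaw_le {M l : ℝ} (hl : 0 ≤ l) (i : H.I) (j : Fin H.m)
    (hw : H.w i j ≤ M) : ∫⁻ x, ENNReal.ofReal (Real.exp (-(l * x))) ∂H.replLaw i j ≤
      ENNReal.ofReal (Real.exp (-(H.q i j * (l - l ^ 2 * M / 2)))) := by
  have h0 := H.ρ_nonneg i j
  have h1 := sub_nonneg.2 (H.ρ_le_one i j)
  have h2 := H.w_nonneg i j
  rw [lintegral_replLaw, ← ENNReal.ofReal_mul h0, ← ENNReal.ofReal_mul h1,
    ← ENNReal.ofReal_add (by positivity) (by positivity)]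
  refine ENNReal.ofReal_le_ofReal ?_
  have h3 := exp_neg_le (mul_nonneg hl h2)
  have h4 : (l * H.w i j) ^ 2 ≤ l ^ 2 * M * H.w i j := by
    have : l ^ 2 * (H.w i j * H.w i j) ≤ l ^ 2 * (M * H.w i j) := by gcongr
    nlinarith
  have h5 : Real.exp (-(l * H.w i j)) ≤ 1 - H.w i j * (l - l ^ 2 * M / 2) := by nlinarith
  have h6 : H.ρ i j * Real.exp (-(l * H.w i j)) ≤
      H.ρ i j * (1 - H.w i j * (l - l ^ 2 * M / 2)) := by gcongr
  have h7 := Real.add_one_le_exp (-(H.q i j * (l - l ^ 2 * M / 2)))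
  simp only [mul_zero, neg_zero, Real.exp_zero, q] at h7 ⊢
  nlinarith

/-- The Chernoff bound for the lower tail of the replenishment. -/
theorem replsLaw_sum_lt_le {M e B : ℝ} (hM : 0 < M) (he : 0 ≤ e) (hw : ∀ i j, H.w i j ≤ M)
    (i : H.I) (j : Fin H.m) (hB : B ≤ (1 - e) * ∑ t ∈ Finset.Iic j, H.q i t) :
    H.replsLaw {ζ | ∑ t ∈ Finset.Iic j, ζ t i < B} ≤
      ENNReal.ofReal (Real.exp (-(e ^ 2 * (∑ t ∈ Finset.Iic j, H.q i t) / (2 * M)))) := by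
  -- The exponent is at most `-l e Q + l² M Q / 2`, with `Q` the total mean replenishment; this
  -- choice of `l` minimizes it, with value `-e² Q / (2M)`.
  set l := e / M with hl
  have hl0 : 0 ≤ l := by positivity
  have hS : MeasurableSet {ζ : Fin H.m → H.I → ℝ | ∑ t ∈ Finset.Iic j, ζ t i < B} :=
    measurableSet_lt (by fun_prop) measurable_const
  rw [← lintegral_indicator_one hS]
  calc ∫⁻ ζ, {ζ : Fin H.m → H.I → ℝ | ∑ t ∈ Finset.Iic j, ζ t i < B}.indicator 1 ζ ∂H.replsLaw
      ≤ ∫⁻ ζ, ENNReal.ofReal (Real.exp (l * B)) *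
          ∏ t ∈ Finset.Iic j, ENNReal.ofReal (Real.exp (-(l * ζ t i))) ∂H.replsLaw := by
        refine lintegral_mono fun ζ => ?_
        rw [← ENNReal.ofReal_prod_of_nonneg fun t _ => (Real.exp_pos _).le,
          ← ENNReal.ofReal_mul (Real.exp_pos _).le, ← Real.exp_sum, ← Real.exp_add]
        rw [Set.indicator_apply]
        split_ifs with h
        · rw [Pi.one_apply, ENNReal.one_le_ofReal, Real.one_le_exp_iff, Finset.sum_neg_distrib,
            ← Finset.mul_sum]
          have := mul_le_mul_of_nonneg_left (le_of_lt (Set.mem_ofPred_eq ▸ h)) hl0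
          linarith
        · exact zero_le
    _ = ENNReal.ofReal (Real.exp (l * B)) *
          ∏ t ∈ Finset.Iic j, ∫⁻ x, ENNReal.ofReal (Real.exp (-(l * x))) ∂H.replLaw i t := by
        rw [lintegral_const_mul _ (Finset.measurable_fun_prod _ fun t _ => by fun_prop)]
        congr 1
        unfold replsLaw
        rw [lintegral_pi_prod (fun j => Measure.pi fun i => H.replLaw i j) (Finset.Iic j)
          (f := fun _ r => ENNReal.ofReal (Real.exp (-(l * r i)))) (fun t => by fun_prop)]
        refine Finset.prod_congr rfl fun t _ => ?_
        exact lintegral_pi_eval (fun i => H.replLaw i t) i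
          (f := fun x => ENNReal.ofReal (Real.exp (-(l * x)))) (by fun_prop)
    _ ≤ ENNReal.ofReal (Real.exp (l * B)) * ∏ t ∈ Finset.Iic j,
          ENNReal.ofReal (Real.exp (-(H.q i t * (l - l ^ 2 * M / 2)))) := by
        gcongr with t _
        exact H.lintegral_exp_neg_replLaw_le hl0 i t (hw i t)
    _ ≤ _ := by
        rw [← ENNReal.ofReal_prod_of_nonneg fun t _ => (Real.exp_pos _).le,
          ← ENNReal.ofReal_mul (Real.exp_pos _).le, ← Real.exp_sum, ← Real.exp_add]
        refine ENNReal.ofReal_le_ofReal (Real.exp_le_exp.2 ?_)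
        rw [Finset.sum_neg_distrib, ← Finset.sum_mul]
        have h1 := mul_le_mul_of_nonneg_left hB hl0
        refine (add_le_add_left h1 _).trans (le_of_eq ?_)
        rw [hl]
        field_simp
        ring

/-- Once a positive batch exists, at least one threshold `ε * H.cMin` of mean replenishment has
accumulated, so the Chernoff exponent is at least `ε³ * H.cMin / (2M)`, uniformly in time. Before
that the batches require nothing, and a shortage has probability zero. -/
theorem replsLaw_shortage_le {M : ℝ} {d : ℕ} (hM : 0 < M) (he : 0 < eps M d H.cMin)
    (hw : ∀ i j, H.w i j ≤ M) (i : H.I) (j : Fin H.m) :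
    H.replsLaw {ζ | ∑ t ∈ Finset.Iic j, ζ t i < ∑ t ∈ Finset.Iic j, H.batch M d i t} ≤
      ENNReal.ofReal (Real.exp (-(eps M d H.cMin ^ 3 * H.cMin / (2 * M)))) := by
  set e := eps M d H.cMin with hedef
  have he1 : e ≤ 1 := eps_le_one _ _ _
  by_cases hpos : ∃ t ∈ Finset.Iic j, 0 < H.batch M d i t
  · obtain ⟨t, ht, hb⟩ := hpos
    have h1 : e * H.cMin ≤ ∑ t ∈ Finset.Iic j, H.batch M d i t :=
      (H.threshold_le_batch M d i hb).trans
        (Finset.single_le_sum (fun t _ => H.batch_nonneg M d i t) ht)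
    have h2 := H.sum_batch_le M d i j
    have hQ : 0 ≤ ∑ t ∈ Finset.Iic j, H.q i t := Finset.sum_nonneg fun t _ => H.q_nonneg i t
    have h3 : e * H.cMin ≤ ∑ t ∈ Finset.Iic j, H.q i t := by
      rw [← hedef] at h2
      nlinarith
    refine (H.replsLaw_sum_lt_le hM he.le hw i j h2).trans ?_
    refine ENNReal.ofReal_le_ofReal (Real.exp_le_exp.2 (neg_le_neg ?_))
    refine div_le_div_of_nonneg_right ?_ (by positivity)
    calc e ^ 3 * H.cMin = e ^ 2 * (e * H.cMin) := by ring
      _ ≤ _ := by gcongr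
  · push Not at hpos
    have h0 : ∑ t ∈ Finset.Iic j, H.batch M d i t ≤ 0 := Finset.sum_nonpos hpos
    have : H.replsLaw {ζ | ∑ t ∈ Finset.Iic j, ζ t i < ∑ t ∈ Finset.Iic j, H.batch M d i t} = 0 := by
      refine measure_mono_null ?_ (ae_iff.1 H.ae_repl_nonneg)
      intro ζ hζ hn
      have h1 : 0 ≤ ∑ t ∈ Finset.Iic j, ζ t i := Finset.sum_nonneg fun t _ => hn t i
      exact absurd (h1.trans_lt hζ) (not_lt.2 h0)
    rw [this]
    exact zero_le

end Replenishment

end AllocInstance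

namespace AllocInstance

/-! ### The fluid relaxation of the clairvoyant benchmark -/

/-- The expected consumption of resource `i`, at the arrival of request `l`, by action `k` performed
for request `j` of type `z`. -/
noncomputable def meanCons (H : AllocInstance) (i : H.I) (l j : Fin H.m) (k : H.K) (z : H.Z) :
    ℝ≥0∞ := ∫⁻ y, ENNReal.ofReal (y.1 i l) ∂(H.law j k z)

/-- The probabilities of the request types. -/
noncomputable def typeProb (H : AllocInstance) (j : Fin H.m) (z : H.Z) : ℝ≥0∞ :=
  (H.p j).toMeasure {z}

theorem sum_typeProb (H : AllocInstance) (j : Fin H.m) : ∑ z, H.typeProb j z = 1 := by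
  have h := lintegral_fintype (μ := (H.p j).toMeasure) (fun _ => 1)
  simpa [typeProb] using h.symm

theorem typeProb_ne_top (H : AllocInstance) (j : Fin H.m) (z : H.Z) : H.typeProb j z ≠ ⊤ :=
  measure_ne_top _ _

namespace Policy

variable {H : AllocInstance} (π : Policy H)

/-- The joint law of the action chosen for request `j` and of the type of this request. -/
noncomputable def choiceLaw (j : Fin H.m) : Measure (H.K × H.Z) :=
  (H.typesLaw.prod (H.replsLaw.prod (H.tableLaw.prod π.seedLaw))).map fun x =>
    (π.act x.2.2.2 j (π.trace x.1 x.2.1 x.2.2.1 x.2.2.2 j), x.1 j)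

theorem measurable_choice (j : Fin H.m) :
    Measurable fun x : (Fin H.m → H.Z) × (Fin H.m → H.I → ℝ) × H.Table × π.Seed =>
      (π.act x.2.2.2 j (π.trace x.1 x.2.1 x.2.2.1 x.2.2.2 j), x.1 j) :=
  (π.measurable_act_trace j j).prodMk ((measurable_pi_apply j).comp measurable_fst)

theorem lintegral_choice (j : Fin H.m) (g : H.K × H.Z → ℝ≥0∞) :
    ∫⁻ z, ∫⁻ ζ, ∫⁻ u, ∫⁻ o, g (π.act u j (π.trace z ζ o u j), z j)
      ∂H.tableLaw ∂π.seedLaw ∂H.replsLaw ∂H.typesLaw =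
      ∑ x, g x * π.choiceLaw j {x} := by
  have hg : Measurable g := measurable_of_countable _
  rw [← lintegral_fintype, choiceLaw, lintegral_map hg (π.measurable_choice j)]
  exact (π.lintegral_run (hg.comp (π.measurable_choice j))).symm

theorem profitAt_eq_sum (i : H.I) (j : Fin H.m) :
    π.profitAt i j = ∑ x, H.meanReward i j x.1 x.2 * π.choiceLaw j {x} := by
  rw [profitAt_eq]
  exact π.lintegral_choice j fun x => H.meanReward i j x.1 x.2

theorem sum_choiceLaw (j : Fin H.m) (z : H.Z) :
    ∑ k, π.choiceLaw j {(k, z)} = H.typeProb j z := by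
  classical
  have h := π.lintegral_choice j fun x => ({z} : Set H.Z).indicator 1 x.2
  have h1 : ∑ x, ({z} : Set H.Z).indicator 1 x.2 * π.choiceLaw j {x} =
      ∑ k, π.choiceLaw j {(k, z)} := by
    rw [Fintype.sum_prod_type]
    simp [Set.indicator_apply]
  rw [← h1, ← h]
  simp only [lintegral_const, measure_univ, mul_one]
  unfold typesLaw typeProb
  rw [lintegral_pi_eval (fun j => (H.p j).toMeasure) j (f := ({z} : Set H.Z).indicator 1)
    (measurable_of_countable _), lintegral_indicator_one (measurableSet_singleton z)]

theorem sum_choiceLaw_eq_one (j : Fin H.m) : ∑ x, π.choiceLaw j {x} = 1 := by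
  rw [Fintype.sum_prod_type_right]
  simp only [sum_choiceLaw, sum_typeProb]

/-- The expected choices of a policy satisfy the inventory constraints in expectation. -/
theorem sum_meanCons_le (i : H.I) (j : Fin H.m) :
    ∑ t ∈ Finset.Iio j, ∑ x, H.meanCons i j t x.1 x.2 * π.choiceLaw t {x} ≤
      ENNReal.ofReal (H.inv i + ∑ t ∈ Finset.Iic j, H.q i t) := by
  let P := H.typesLaw.prod (H.replsLaw.prod (H.tableLaw.prod π.seedLaw))
  have hentry : ∀ t : Fin H.m,
      Measurable fun x : (Fin H.m → H.Z) × (Fin H.m → H.I → ℝ) × H.Table × π.Seed =>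
      x.2.2.1 t (π.act x.2.2.2 t (π.trace x.1 x.2.1 x.2.2.1 x.2.2.2 t)) (x.1 t) := by
    intro t
    have h : Measurable fun p : (H.K × H.Z) × H.Table => p.2 t p.1.1 p.1.2 :=
      measurable_from_prod_countable_right fun k => by dsimp only; fun_prop
    exact h.comp ((π.measurable_choice t).prodMk
      (measurable_fst.comp (measurable_snd.comp measurable_snd)))
  have hc : ∀ t : Fin H.m,
      Measurable fun x : (Fin H.m → H.Z) × (Fin H.m → H.I → ℝ) × H.Table × π.Seed =>
      ENNReal.ofReal ((x.2.2.1 t (π.act x.2.2.2 t (π.trace x.1 x.2.1 x.2.2.1 x.2.2.2 t))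
        (x.1 t)).1 i j) := fun t =>
    ((measurable_pi_apply j).comp ((measurable_pi_apply i).comp
      (measurable_fst.comp (hentry t)))).ennreal_ofReal
  have h1 : ∀ t, ∑ x, H.meanCons i j t x.1 x.2 * π.choiceLaw t {x} =
      ∫⁻ x, ENNReal.ofReal ((x.2.2.1 t (π.act x.2.2.2 t (π.trace x.1 x.2.1 x.2.2.1 x.2.2.2 t))
        (x.1 t)).1 i j) ∂P := by
    intro t
    rw [π.lintegral_run (hc t), ← π.lintegral_choice t fun x => H.meanCons i j t x.1 x.2]
    refine lintegral_congr fun z => lintegral_congr fun ζ => lintegral_congr fun u => ?_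
    exact (π.lintegral_trace_step z ζ u t (F := fun p => ENNReal.ofReal (p.2.1 i j))
      (by fun_prop)).symm
  simp only [h1]
  rw [← lintegral_finsetSum _ fun t _ => hc t]
  have h2 : ∀ᵐ x ∂P, H.IsTable x.2.2.1 :=
    (Measure.quasiMeasurePreserving_fst.comp (Measure.quasiMeasurePreserving_snd.comp
      Measure.quasiMeasurePreserving_snd)).ae H.ae_isTable
  have h3 : ∀ᵐ x ∂P, ∀ j i, 0 ≤ x.2.1 j i :=
    (Measure.quasiMeasurePreserving_fst.comp Measure.quasiMeasurePreserving_snd).ae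
      H.ae_repl_nonneg
  calc _ ≤ ∫⁻ x, (ENNReal.ofReal (H.inv i) + ∑ t ∈ Finset.Iic j, ENNReal.ofReal (x.2.1 t i)) ∂P := by
        refine lintegral_mono_ae ?_
        filter_upwards [h2, h3] with x ho hζ
        rw [← ENNReal.ofReal_sum_of_nonneg fun t _ => hζ t i,
          ← ENNReal.ofReal_add (H.inv_nonneg i) (Finset.sum_nonneg fun t _ => hζ t i),
          ← ENNReal.ofReal_sum_of_nonneg fun t ht =>
            (ho t _ _).nonneg i (Finset.mem_Iio.1 ht).le]
        refine ENNReal.ofReal_le_ofReal ?_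
        -- The constraint holds on almost every path and is then integrated. Clairvoyance is
        -- harmless, since only the mean of the replenishment remains.
        have h := (π.feasible_trace x.1 x.2.1 x.2.2.1 x.2.2.2 ho j.2.le).remaining_nonneg
          (by simpa using hζ) i
        unfold Trace.remaining at h
        rw [repl_trace] at h
        have h4 : ∀ t ∈ Finset.Iio j, (π.trace x.1 x.2.1 x.2.2.1 x.2.2.2 j).cons t i j =
            (x.2.2.1 t (π.act x.2.2.2 t (π.trace x.1 x.2.1 x.2.2.1 x.2.2.2 t)) (x.1 t)).1 i j := by
          intro t ht
          rw [cons_trace π _ _ _ _ (Fin.lt_def.1 (Finset.mem_Iio.1 ht)), trace_succ,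
            Trace.cons_record_self]
        rw [Finset.sum_congr rfl h4] at h
        linarith
    _ = _ := by
        have hm : ∀ t, Measurable
            fun x : (Fin H.m → H.Z) × (Fin H.m → H.I → ℝ) × H.Table × π.Seed =>
              ENNReal.ofReal (x.2.1 t i) := fun t => by fun_prop
        rw [lintegral_add_left measurable_const, lintegral_finsetSum _ fun t _ => hm t,
          ENNReal.ofReal_add (H.inv_nonneg i) (Finset.sum_nonneg fun t _ => H.q_nonneg i t),
          ENNReal.ofReal_sum_of_nonneg fun t _ => H.q_nonneg i t]
        congr 1
        · simp only [P, lintegral_const, measure_univ, mul_one]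
        · refine Finset.sum_congr rfl fun t _ => ?_
          rw [π.lintegral_run (hm t)]
          simp only [lintegral_const, measure_univ, mul_one]
          rw [H.lintegral_replsLaw_eval i t (f := ENNReal.ofReal) ENNReal.measurable_ofReal,
            lintegral_replLaw, q, ENNReal.ofReal_mul (H.ρ_nonneg i t)]
          simp

/-! ### Independent proposals with the marginals of a policy -/

open Classical in
/-- The conditional law of the choice of `π` for request `j` given its type `z`, mixed with the
trivial action, which has weight `δ`. -/
noncomputable def proposalLaw (δ : ℝ) (j : Fin H.m) (z : H.Z) : Measure H.K :=
  -- Conditioning on a type of probability zero would give `0 / 0 = 0` and a measure of mass `δ`;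
  -- the Dirac measure keeps this a probability law.
  if H.typeProb j z = 0 then Measure.dirac H.k₀
  else ∑ k, (ENNReal.ofReal (1 - δ) * (π.choiceLaw j {(k, z)} / H.typeProb j z)) • Measure.dirac k
    + ENNReal.ofReal δ • Measure.dirac H.k₀

variable {δ : ℝ}

theorem lintegral_proposalLaw {j : Fin H.m} {z : H.Z} (hz : H.typeProb j z ≠ 0)
    (g : H.K → ℝ≥0∞) : ∫⁻ k, g k ∂π.proposalLaw δ j z =
      ENNReal.ofReal (1 - δ) * (∑ k, π.choiceLaw j {(k, z)} * g k) / H.typeProb j z +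
        ENNReal.ofReal δ * g H.k₀ := by
  rw [proposalLaw, if_neg hz, lintegral_add_measure, lintegral_smul_measure,
    lintegral_finsetSum_measure]
  simp only [lintegral_smul_measure, lintegral_dirac, smul_eq_mul, Finset.mul_sum, div_eq_mul_inv,
    Finset.sum_mul]
  congr 1
  exact Finset.sum_congr rfl fun k _ => by ring

theorem isProbabilityMeasure_proposalLaw (h0 : 0 ≤ δ) (h1 : δ ≤ 1) (j : Fin H.m) (z : H.Z) :
    IsProbabilityMeasure (π.proposalLaw δ j z) := by
  by_cases hz : H.typeProb j z = 0
  · rw [proposalLaw, if_pos hz]; infer_instance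
  · constructor
    have h := π.lintegral_proposalLaw (δ := δ) hz 1
    simp only [Pi.one_apply, lintegral_const, one_mul, mul_one, sum_choiceLaw] at h
    rw [h, mul_div_assoc, ENNReal.div_self hz (H.typeProb_ne_top j z), mul_one,
      ← ENNReal.ofReal_add (by linarith) h0]
    simp

/-- The expectation of a function of the proposal and of the type. -/
noncomputable def proposalMean (δ : ℝ) (j : Fin H.m) (g : H.K → H.Z → ℝ≥0∞) : ℝ≥0∞ :=
  ∫⁻ z, ∫⁻ k, g k z ∂π.proposalLaw δ j z ∂(H.p j).toMeasure

/-- Averaging the conditional laws over the type restores the joint choice law of `π`, thinned by `1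
- δ`. Types of probability zero contribute nothing on either side. -/
theorem proposalMean_eq (j : Fin H.m) (g : H.K → H.Z → ℝ≥0∞) : π.proposalMean δ j g =
    ENNReal.ofReal (1 - δ) * ∑ x, g x.1 x.2 * π.choiceLaw j {x} +
      ENNReal.ofReal δ * ∑ z, H.typeProb j z * g H.k₀ z := by
  rw [proposalMean, lintegral_fintype, Fintype.sum_prod_type_right, Finset.mul_sum, Finset.mul_sum,
    ← Finset.sum_add_distrib]
  refine Finset.sum_congr rfl fun z _ => ?_
  change _ * H.typeProb j z = _
  by_cases hz : H.typeProb j z = 0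
  · have h : ∀ k, π.choiceLaw j {(k, z)} = 0 := by
      have := π.sum_choiceLaw j z
      rw [hz] at this
      simpa using this
    simp [hz, h]
  · rw [π.lintegral_proposalLaw hz, add_mul,
      ENNReal.div_mul_cancel hz (H.typeProb_ne_top j z)]
    simp only [mul_comm (π.choiceLaw j _)]
    ring

theorem le_proposalMean (i : H.I) (j : Fin H.m) :
    ENNReal.ofReal (1 - δ) * π.profitAt i j ≤ π.proposalMean δ j (H.meanReward i j) := by
  rw [proposalMean_eq, profitAt_eq_sum]
  exact le_self_add

theorem proposalMean_ne_top (i : H.I) (j : Fin H.m) :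
    π.proposalMean δ j (H.meanReward i j) ≠ ⊤ := by
  rw [proposalMean_eq, ← profitAt_eq_sum]
  refine ENNReal.add_ne_top.2 ⟨ENNReal.mul_ne_top ENNReal.ofReal_ne_top (π.profitAt_ne_top i j),
    ENNReal.mul_ne_top ENNReal.ofReal_ne_top (ENNReal.sum_ne_top.2 fun z _ =>
      ENNReal.mul_ne_top (H.typeProb_ne_top j z) (H.meanReward_ne_top i j _ z))⟩

theorem proposalMean_mono {j : Fin H.m} {g g' : H.K → H.Z → ℝ≥0∞} (h : ∀ k z, g k z ≤ g' k z) :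
    π.proposalMean δ j g ≤ π.proposalMean δ j g' :=
  lintegral_mono fun z => lintegral_mono fun k => h k z

/-- The law of a table of independent proposals. -/
noncomputable def proposalsLaw (δ : ℝ) : Measure (Fin H.m → H.Z → H.K) :=
  Measure.pi fun j => Measure.pi fun z => π.proposalLaw δ j z

/-- Different requests read different coordinates of the types and of the proposals, so expectations
of products factor. The independence missing from the choices of `π` itself is gained here. -/
theorem lintegral_proposals_prod (h0 : 0 ≤ δ) (h1 : δ ≤ 1) (s : Finset (Fin H.m))
    (f : Fin H.m → H.K → H.Z → ℝ≥0∞) :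
    ∫⁻ z, ∫⁻ u, ∏ t ∈ s, f t (u t (z t)) (z t) ∂π.proposalsLaw δ ∂H.typesLaw =
      ∏ t ∈ s, π.proposalMean δ t (f t) := by
  have := fun j z => π.isProbabilityMeasure_proposalLaw h0 h1 j z
  unfold proposalsLaw typesLaw proposalMean
  rw [← lintegral_pi_prod (fun j => (H.p j).toMeasure) s
    (f := fun t z => ∫⁻ k, f t k z ∂π.proposalLaw δ t z) fun t => measurable_of_countable _]
  refine lintegral_congr fun z => ?_
  rw [lintegral_pi_prod (fun j => Measure.pi fun z => π.proposalLaw δ j z) s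
    (f := fun t r => f t (r (z t)) (z t)) fun t => measurable_of_countable _]
  refine Finset.prod_congr rfl fun t _ => ?_
  exact lintegral_pi_eval (fun z => π.proposalLaw δ t z) (z t) (f := fun k => f t k (z t))
    (measurable_of_countable _)

end Policy

/-! ### Exponential moments of consumptions -/

/-- The exponential moment of the consumption `A_{ijkz}(l)`. -/
noncomputable def expCons (H : AllocInstance) (r : ℝ) (i : H.I) (l j : Fin H.m) (k : H.K)
    (z : H.Z) : ℝ≥0∞ := ∫⁻ y, ENNReal.ofReal (Real.exp (r * y.1 i l)) ∂(H.law j k z)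

section ExpCons

variable (H : AllocInstance) {r : ℝ} (i : H.I) {l j : Fin H.m}

theorem one_le_expCons (hr : 0 ≤ r) (hl : j ≤ l) (k : H.K) (z : H.Z) : 1 ≤ H.expCons r i l j k z := by
  calc (1 : ℝ≥0∞) = ∫⁻ _, 1 ∂(H.law j k z) := by simp
    _ ≤ _ := by
      refine lintegral_mono_ae ?_
      filter_upwards [H.ae_isOutcome j k z] with y hy
      rw [ENNReal.one_le_ofReal, Real.one_le_exp_iff]
      exact mul_nonneg hr (hy.nonneg i hl)

/-- Used to see that refusing a proposal does not increase the exponential moment of the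
consumption. -/
theorem expCons_trivial_le (hr : 0 ≤ r) (hl : j ≤ l) (k : H.K) (z : H.Z) :
    H.expCons r i l j H.k₀ z ≤ H.expCons r i l j k z := by
  refine le_trans (le_of_eq ?_) (H.one_le_expCons i hr hl k z)
  calc H.expCons r i l j H.k₀ z = ∫⁻ _, 1 ∂(H.law j H.k₀ z) := by
        refine lintegral_congr_ae ?_
        filter_upwards [H.ae_isOutcome j H.k₀ z] with y hy
        rw [hy.eq_zero (H.b_trivial i j z j le_rfl) hl]
        simp
    _ = 1 := by simp

/-- On `[0, 1]` the convex function `a ↦ exp (r a)` lies below its chord, so the exponential moment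
is controlled by the mean, which is all that is known about the choices of `π`. -/
theorem expCons_le (hr : 0 ≤ r) (hl : j ≤ l) (k : H.K) (z : H.Z) :
    H.expCons r i l j k z ≤ 1 + ENNReal.ofReal (Real.exp r - 1) * H.meanCons i l j k z := by
  have h0 : 0 ≤ Real.exp r - 1 := by linarith [Real.add_one_le_exp r]
  calc H.expCons r i l j k z ≤
      ∫⁻ y, 1 + ENNReal.ofReal (Real.exp r - 1) * ENNReal.ofReal (y.1 i l) ∂(H.law j k z) := by
        refine lintegral_mono_ae ?_
        filter_upwards [H.ae_isOutcome j k z] with y hy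
        have h1 := hy.nonneg i hl
        have h2 := hy.le_one i hl
        rw [← ENNReal.ofReal_mul h0, ← ENNReal.ofReal_one,
          ← ENNReal.ofReal_add zero_le_one (mul_nonneg h0 h1)]
        refine ENNReal.ofReal_le_ofReal ?_
        have h3 := convexOn_exp.2 (Set.mem_univ 0) (Set.mem_univ r) (sub_nonneg.2 h2) h1 (by ring)
        simp only [smul_eq_mul, mul_zero, zero_add, Real.exp_zero, mul_one] at h3
        rw [mul_comm r]
        linarith
    _ = _ := by
        rw [lintegral_add_left measurable_const, lintegral_const_mul _ (by fun_prop)]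
        simp [meanCons]

end ExpCons

theorem meanCons_trivial (H : AllocInstance) (i : H.I) {l j : Fin H.m} (hl : j ≤ l) (z : H.Z) :
    H.meanCons i l j H.k₀ z = 0 := by
  calc H.meanCons i l j H.k₀ z = ∫⁻ _, 0 ∂(H.law j H.k₀ z) := by
        refine lintegral_congr_ae ?_
        filter_upwards [H.ae_isOutcome j H.k₀ z] with y hy
        rw [hy.eq_zero (H.b_trivial i j z j le_rfl) hl, ENNReal.ofReal_zero]
    _ = 0 := by simp

theorem Policy.proposalMean_expCons_le {H : AllocInstance} (π : Policy H) {r δ : ℝ}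
    (hr : 0 ≤ r) (h0 : 0 ≤ δ) (h1 : δ ≤ 1) (i : H.I) {l j : Fin H.m} (hl : j ≤ l) :
    π.proposalMean δ j (H.expCons r i l j) ≤ 1 + ENNReal.ofReal (Real.exp r - 1) *
      (ENNReal.ofReal (1 - δ) * ∑ x, H.meanCons i l j x.1 x.2 * π.choiceLaw j {x}) := by
  refine (π.proposalMean_mono fun k z => H.expCons_le i hr hl k z).trans (le_of_eq ?_)
  rw [proposalMean_eq]
  simp only [H.meanCons_trivial i hl, mul_zero, add_zero, mul_one, sum_typeProb, add_mul, one_mul,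
    Finset.sum_add_distrib, sum_choiceLaw_eq_one, mul_assoc, ← Finset.mul_sum]
  have h2 : ENNReal.ofReal (1 - δ) + ENNReal.ofReal δ = 1 := by
    rw [← ENNReal.ofReal_add (by linarith) h0]; simp
  rw [mul_add, mul_one, add_right_comm, h2]
  ring

/-- The exponential moments of the independent proposals. -/
theorem Policy.prod_proposalMean_expCons_le {H : AllocInstance} (π : Policy H) {r δ : ℝ}
    (hr : 0 ≤ r) (h0 : 0 ≤ δ) (h1 : δ ≤ 1) (i : H.I) (j : Fin H.m) :
    ∏ t ∈ Finset.Iio j, π.proposalMean δ t (H.expCons r i j t) ≤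
      ENNReal.ofReal (Real.exp ((Real.exp r - 1) * (1 - δ) *
        (H.inv i + ∑ t ∈ Finset.Iic j, H.q i t))) := by
  have hr' : 0 ≤ Real.exp r - 1 := by linarith [Real.add_one_le_exp r]
  have h1' : 0 ≤ 1 - δ := by linarith
  set A : Fin H.m → ℝ≥0∞ := fun t => ∑ x, H.meanCons i j t x.1 x.2 * π.choiceLaw t {x} with hA
  have hsum : ∑ t ∈ Finset.Iio j, A t ≤
      ENNReal.ofReal (H.inv i + ∑ t ∈ Finset.Iic j, H.q i t) := π.sum_meanCons_le i j
  have htop : ∀ t ∈ Finset.Iio j, A t ≠ ⊤ := fun t ht =>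
    ne_top_of_le_ne_top ENNReal.ofReal_ne_top
      ((Finset.single_le_sum (fun _ _ => zero_le) ht).trans hsum)
  have hW : 0 ≤ H.inv i + ∑ t ∈ Finset.Iic j, H.q i t :=
    add_nonneg (H.inv_nonneg i) (Finset.sum_nonneg fun t _ => H.q_nonneg i t)
  have hreal : ∑ t ∈ Finset.Iio j, (A t).toReal ≤ H.inv i + ∑ t ∈ Finset.Iic j, H.q i t := by
    rw [← ENNReal.toReal_sum htop]
    exact ENNReal.toReal_le_of_le_ofReal hW hsum
  calc _ ≤ ∏ t ∈ Finset.Iio j,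
        ENNReal.ofReal (Real.exp ((Real.exp r - 1) * (1 - δ) * (A t).toReal)) := by
        refine Finset.prod_le_prod' fun t ht => ?_
        refine (π.proposalMean_expCons_le hr h0 h1 i (Finset.mem_Iio.1 ht).le).trans ?_
        change 1 + ENNReal.ofReal (Real.exp r - 1) * (ENNReal.ofReal (1 - δ) * A t) ≤ _
        rw [← ENNReal.ofReal_toReal (htop t ht), ← ENNReal.ofReal_mul h1', ← ENNReal.ofReal_mul hr',
          ← ENNReal.ofReal_one, ← ENNReal.ofReal_add zero_le_one (by positivity),
          ENNReal.toReal_ofReal (by positivity)]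
        refine ENNReal.ofReal_le_ofReal ?_
        rw [mul_assoc, add_comm]
        exact Real.add_one_le_exp _
    _ = ENNReal.ofReal (Real.exp ((Real.exp r - 1) * (1 - δ) *
          ∑ t ∈ Finset.Iio j, (A t).toReal)) := by
        rw [← ENNReal.ofReal_prod_of_nonneg fun t _ => (Real.exp_pos _).le, ← Real.exp_sum,
          Finset.mul_sum]
    _ ≤ _ := by gcongr

end AllocInstance

namespace AllocInstance

/-! ### Serving independent proposals from the copies -/

section Serve

variable {H : AllocInstance} {stock : H.I → Fin H.m → ℝ}

open Classical in
/-- The proposal `k`, served from versions of the resources such that the action is among the given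
ones and uses only versions that have been introduced; the trivial action if this is impossible. -/
noncomputable def serve (stock : H.I → Fin H.m → ℝ) (j : Fin H.m) (k : H.K) (z : H.Z)
    (s : Set (H.CopyK stock)) : (H.addCopies stock).K :=
  if h : ∃ vs, H.Active (stock := stock) j (k, vs) z ∧ (k, vs) ∈ s then (k, h.choose)
  else (H.addCopies stock).k₀

theorem serve_spec {j : Fin H.m} {k : H.K} {z : H.Z} {s : Set (H.CopyK stock)}
    (h : ∃ vs, H.Active (stock := stock) j (k, vs) z ∧ (k, vs) ∈ s) :
    (serve stock j k z s).1 = k ∧ H.Active (stock := stock) j (serve stock j k z s) z ∧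
      serve stock j k z s ∈ s := by
  have e : serve stock j k z s = (k, h.choose) := dif_pos h
  rw [e]
  exact ⟨rfl, h.choose_spec⟩

theorem serve_mem_or (j : Fin H.m) (k : H.K) (z : H.Z) (s : Set (H.CopyK stock)) :
    ((serve stock j k z s).1 = k ∧ serve stock j k z s ∈ s) ∨
      serve stock j k z s = (H.addCopies stock).k₀ := by
  by_cases h : ∃ vs, H.Active (stock := stock) j (k, vs) z ∧ (k, vs) ∈ s
  · exact Or.inl ⟨(serve_spec h).1, (serve_spec h).2.2⟩
  · exact Or.inr (dif_neg h)

theorem serve_fst (j : Fin H.m) (k : H.K) (z : H.Z) (s : Set (H.CopyK stock)) :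
    (serve stock j k z s).1 = k ∨ (serve stock j k z s).1 = H.k₀ := by
  rcases serve_mem_or j k z s with h | h
  · exact Or.inl h.1
  · rw [h]
    exact Or.inr rfl

theorem implementable_trivial (H : AllocInstance) (τ : H.Trace) (j : Fin H.m) :
    Trace.Implementable τ j H.k₀ := fun i hi => absurd (H.b_trivial i j _ j le_rfl) hi

/-- The policy for the instance with copies that draws independent proposals from the conditional
laws of the choices of `π` and serves them as long as the inventory suffices. -/
noncomputable def servePolicy (π : Policy H) (stock : H.I → Fin H.m → ℝ) {δ : ℝ} (h0 : 0 ≤ δ)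
    (h1 : δ ≤ 1) : Policy (H.addCopies stock) where
  -- A proposal is drawn for every possible type of every request, because the seed is independent
  -- of the types; the run reads the entry of the actual type.
  Seed := Fin H.m → H.Z → H.K
  seedLaw := π.proposalsLaw δ
  seedLaw_prob := by
    have := fun j z => π.isProbabilityMeasure_proposalLaw h0 h1 j z
    unfold Policy.proposalsLaw
    infer_instance
  act := fun u j τ => serve stock j (u j (τ.types j)) (τ.types j)
    {κ | Trace.Implementable (H := H.addCopies stock) τ j κ}
  measurable_act := by
    intro j
    have hs : Measurable fun τ : (H.addCopies stock).Trace =>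
        {κ : H.CopyK stock | Trace.Implementable (H := H.addCopies stock) τ j κ} :=
      measurable_set_iff.2 fun κ => measurableSet_setOfPred.1
        (Trace.measurableSet_implementable (H := H.addCopies stock) j κ)
    have hz : Measurable fun τ : (H.addCopies stock).Trace => τ.types j :=
      (measurable_pi_apply j).comp (Trace.measurable_types (H := H.addCopies stock))
    have hk : Measurable fun x : (Fin H.m → H.Z → H.K) × (H.addCopies stock).Trace =>
        x.1 j (x.2.types j) := by
      have h : Measurable fun p : H.Z × (Fin H.m → H.Z → H.K) => p.2 j p.1 :=
        measurable_from_prod_countable_right fun z => by dsimp only; fun_prop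
      exact h.comp ((hz.comp measurable_snd).prodMk measurable_fst)
    have hserve : Measurable fun x : H.K × H.Z × Set (H.CopyK stock) =>
        serve stock j x.1 x.2.1 x.2.2 := measurable_of_countable _
    exact hserve.comp (hk.prodMk ((hz.comp measurable_snd).prodMk (hs.comp measurable_snd)))
  implementable := by
    intro u j τ
    rcases serve_mem_or (stock := stock) j (u j (τ.types j)) (τ.types j)
      {κ | Trace.Implementable (H := H.addCopies stock) τ j κ} with h | h
    · exact h.2
    · rw [h]
      exact implementable_trivial (H.addCopies stock) τ j
  nonanticipating := by
    intro u j τ τ' hz hr ho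
    have h : {κ : H.CopyK stock | Trace.Implementable (H := H.addCopies stock) τ j κ} =
        {κ | Trace.Implementable (H := H.addCopies stock) τ' j κ} := by
      ext κ
      exact Trace.implementable_congr hz hr ho κ
    rw [h, hz]
    rfl

/-- The amount of a resource used from the versions introduced by request `l`. -/
noncomputable def usage (i : H.I) (l : Fin H.m) (n : ℕ) (τ : (H.addCopies stock).Trace) : ℝ :=
  ∑ t : Fin H.m, if t.1 < n then ∑ v ∈ introduced stock i l, τ.cons t ⟨i, v⟩ l else 0

theorem usage_record (i : H.I) (l n : Fin H.m) (τ : (H.addCopies stock).Trace)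
    (y : Outcome (H.addCopies stock).I (H.addCopies stock).m) :
    usage i l (n + 1) (Trace.record (H := H.addCopies stock) τ n y) =
      usage i l n τ + ∑ v ∈ introduced stock i l, y.1 ⟨i, v⟩ l := by
  unfold usage
  rw [← Finset.sum_erase_add _ _ (Finset.mem_univ n),
    ← Finset.sum_erase_add (a := n) (f := fun t : Fin H.m => if t.1 < n.1 then
      ∑ v ∈ introduced stock i l, τ.cons t ⟨i, v⟩ l else 0) _ (Finset.mem_univ n)]
  rw [if_pos (Nat.lt_succ_self _), if_neg (lt_irrefl _), add_zero]
  congr 1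
  · refine Finset.sum_congr rfl fun t ht => ?_
    have hne : t ≠ n := Finset.ne_of_mem_erase ht
    have hiff : t.1 < n.1 + 1 ↔ t.1 < n.1 := by
      have : t.1 ≠ n.1 := fun e => hne (Fin.ext e)
      omega
    simp only [hiff]
    have e : (Trace.record (H := H.addCopies stock) τ n y).cons t = τ.cons t :=
      Trace.cons_record_of_ne (H := H.addCopies stock) τ hne y
    rw [e]
  · exact Finset.sum_congr rfl fun v _ => congrFun (congrFun
      (Trace.cons_record_self (H := H.addCopies stock) τ n y) ⟨i, v⟩) l

theorem measurable_usage (i : H.I) (l : Fin H.m) (n : ℕ) :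
    Measurable (usage (stock := stock) i l n) := by
  refine Finset.measurable_sum _ fun t _ => ?_
  split_ifs
  · refine Finset.measurable_sum _ fun v _ => ?_
    exact (measurable_pi_apply l).comp ((measurable_pi_apply (⟨i, v⟩ : (H.addCopies stock).I)).comp
      ((measurable_pi_apply t).comp (Trace.measurable_cons (H := H.addCopies stock))))
  · exact measurable_const

/-- A proposal is served if every resource that it uses has an introduced version with at least one
unit left. -/
theorem serve_of_remaining {τ : (H.addCopies stock).Trace} {j : Fin H.m} {k : H.K}
    (h : ∀ i, H.b i j k (τ.types j) j ≠ 0 → ∃ v ∈ introduced stock i j,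
      1 ≤ Trace.remaining (H := H.addCopies stock) τ j ⟨i, v⟩) :
    ∃ vs, H.Active (stock := stock) j (k, vs) (τ.types j) ∧
      (k, vs) ∈ {κ : H.CopyK stock | Trace.Implementable (H := H.addCopies stock) τ j κ} := by
  have h' : ∀ i, ∃ v : H.Version stock i, H.b i j k (τ.types j) j ≠ 0 →
      v ∈ introduced stock i j ∧ 1 ≤ Trace.remaining (H := H.addCopies stock) τ j ⟨i, v⟩ := by
    intro i
    by_cases hi : H.b i j k (τ.types j) j = 0
    · exact ⟨⟨none, by simp⟩, fun hn => absurd hi hn⟩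
    · obtain ⟨v, hv⟩ := h i hi
      exact ⟨v, fun _ => hv⟩
  choose vs hvs using h'
  refine ⟨vs, fun i hi => mem_introduced.1 (hvs i hi).1, ?_⟩
  rintro ⟨i, v⟩ hi
  by_cases hv : vs i = v
  · subst hv
    have e : (H.addCopies stock).b ⟨i, vs i⟩ j (k, vs) (τ.types j) j = H.b i j k (τ.types j) j :=
      addCopies_b_self j (k, vs) _ j i
    rw [e] at hi ⊢
    exact (H.b_le_one _ _ _ _ _ le_rfl).trans (hvs i hi).2
  · exact absurd (addCopies_b_of_ne j (k, vs) (τ.types j) j hv) hi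

/-- The exponential moment of the consumption of the introduced versions by one action. -/
theorem lintegral_exp_lift_le {r : ℝ} (hr : 0 ≤ r) (i : H.I) {l j : Fin H.m} (hl : j ≤ l)
    (κ : (H.addCopies stock).K) (z : H.Z) :
    ∫⁻ y, ENNReal.ofReal (Real.exp (r * ∑ v ∈ introduced stock i l, y.1 ⟨i, v⟩ l))
      ∂((H.addCopies stock).law j κ z) ≤ H.expCons r i l j κ.1 z := by
  classical
  have hm : Measurable fun y : Outcome (H.CopyI stock) H.m =>
      ENNReal.ofReal (Real.exp (r * ∑ v ∈ introduced stock i l, y.1 ⟨i, v⟩ l)) := by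
    fun_prop
  refine le_trans (le_of_eq (lintegral_map hm (H.measurable_lift (stock := stock) j κ z))) ?_
  by_cases hv : κ.2 i ∈ introduced stock i l
  · simp only [sum_introduced_lift j l κ z _ i _ hv]
    exact le_rfl
  -- If the charged version is not counted, the counted consumption is zero and its exponential
  -- moment is `1`.
  · refine le_trans (le_of_eq ?_) (H.one_le_expCons i hr hl κ.1 z)
    have h : ∀ y, ∑ v ∈ introduced stock i l, (H.lift (stock := stock) j κ z y).1 ⟨i, v⟩ l = 0 :=
      fun y => Finset.sum_eq_zero fun v hv' => if_neg (fun e => hv (by rw [e]; exact hv'))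
    simp only [h]
    simp

theorem profitAt_addCopies_eq (ρ : Policy (H.addCopies stock)) (x : (H.addCopies stock).I)
    (j : Fin H.m) : ρ.profitAt x j = ∫⁻ z, ∫⁻ u, ∫⁻ o,
      (H.addCopies stock).meanReward x j (ρ.act u j (ρ.trace z 0 o u j)) (z j)
        ∂(H.addCopies stock).tableLaw ∂ρ.seedLaw ∂(H.addCopies stock).typesLaw := by
  rw [profitAt_addCopies]
  refine lintegral_congr fun z => lintegral_congr fun u => ?_
  have h : ∀ o, ENNReal.ofReal ((ρ.trace z 0 o u (j + 1)).rew j x) = _ := fun o =>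
    congrArg (fun y => ENNReal.ofReal (y x)) (ρ.rew_trace_succ z 0 o u j)
  simp only [h]
  exact ρ.lintegral_trace_step z 0 u j (F := fun p => ENNReal.ofReal (p.2.2 x)) (by fun_prop)

variable (π : Policy H) {δ : ℝ} (h0 : 0 ≤ δ) (h1 : δ ≤ 1) (z : Fin H.m → H.Z)
  (u : Fin H.m → H.Z → H.K)

/-- The record of the run of `servePolicy` after `n` requests. -/
noncomputable def serveRun (o : (H.addCopies stock).Table) (n : ℕ) : (H.addCopies stock).Trace :=
  (servePolicy π stock h0 h1).trace z 0 o u n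

/-- The action of `servePolicy` at request `j`. -/
noncomputable def serveAct (o : (H.addCopies stock).Table) (j : Fin H.m) :
    (H.addCopies stock).K :=
  (servePolicy π stock h0 h1).act u j (serveRun π h0 h1 z u o j)

theorem serveAct_eq (o : (H.addCopies stock).Table) (j : Fin H.m) :
    serveAct π h0 h1 z u o j = serve stock j (u j (z j)) (z j) {κ |
      Trace.Implementable (H := H.addCopies stock) (serveRun π h0 h1 z u o j) j κ} := by
  have h : (serveRun π h0 h1 z u o j).types = z := Policy.types_trace _ _ _ _ _ _
  change serve stock j (u j ((serveRun π h0 h1 z u o j).types j))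
    ((serveRun π h0 h1 z u o j).types j) _ = _
  rw [h]

/-- With types and proposals fixed, only outcomes are random. Each step multiplies the exponential
moment by that of the served action, which is at most that of the proposal. This factor does not
depend on the record, so a product bound results although the served actions themselves are
dependent. -/
theorem lintegral_exp_usage_le {r : ℝ} (hr : 0 ≤ r) (i : H.I) (l : Fin H.m) {n : ℕ} (hn : n ≤ l) :
    ∫⁻ o, ENNReal.ofReal (Real.exp (r * usage i l n (serveRun π h0 h1 z u o n)))
      ∂(H.addCopies stock).tableLaw ≤
      ∏ t : Fin H.m, if t.1 < n then H.expCons r i l t (u t (z t)) (z t) else 1 := by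
  induction n with
  | zero => simp [usage]
  | succ n ih =>
    let j : Fin H.m := ⟨n, by omega⟩
    have hjl : j ≤ l := by rw [Fin.le_def]; simp only [j]; omega
    let ρ := servePolicy π stock h0 h1
    let F : (H.addCopies stock).Trace → ℝ≥0∞ := fun τ =>
      ENNReal.ofReal (Real.exp (r * usage i l n τ))
    let G : Outcome (H.addCopies stock).I (H.addCopies stock).m → ℝ≥0∞ := fun y =>
      ENNReal.ofReal (Real.exp (r * ∑ v ∈ introduced stock i l, y.1 ⟨i, v⟩ l))
    have hF : Measurable F := by
      have := measurable_usage (stock := stock) i l n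
      exact (Real.measurable_exp.comp (this.const_mul r)).ennreal_ofReal
    have hG : Measurable G := by
      have h : Measurable fun y : Outcome (H.addCopies stock).I (H.addCopies stock).m =>
          ∑ v ∈ introduced stock i l, y.1 ⟨i, v⟩ l :=
        Finset.measurable_sum _ fun v _ => (measurable_pi_apply l).comp
          ((measurable_pi_apply (⟨i, v⟩ : (H.addCopies stock).I)).comp measurable_fst)
      exact (Real.measurable_exp.comp (h.const_mul r)).ennreal_ofReal
    have hstep : ∀ o, ENNReal.ofReal (Real.exp (r * usage i l (n + 1)
        (serveRun π h0 h1 z u o (n + 1)))) =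
        F (serveRun π h0 h1 z u o n) * G (o j (serveAct π h0 h1 z u o j) (z j)) := by
      intro o
      have e : serveRun π h0 h1 z u o (n + 1) = Trace.record (H := H.addCopies stock)
          (serveRun π h0 h1 z u o n) j (o j (serveAct π h0 h1 z u o j) (z j)) :=
        ρ.trace_succ z 0 o u j
      have e2 := usage_record i l j (serveRun π h0 h1 z u o n)
        (o j (serveAct π h0 h1 z u o j) (z j))
      rw [e]
      refine (congrArg (fun x => ENNReal.ofReal (Real.exp (r * x))) e2).trans ?_
      simp only [F, G]
      rw [← ENNReal.ofReal_mul (Real.exp_pos _).le, ← Real.exp_add, mul_add]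
    have hprod : (∏ t : Fin H.m, if t.1 < n + 1 then H.expCons r i l t (u t (z t)) (z t) else 1) =
        (∏ t : Fin H.m, if t.1 < n then H.expCons r i l t (u t (z t)) (z t) else 1) *
          H.expCons r i l j (u j (z j)) (z j) := by
      rw [← Finset.prod_erase_mul _ _ (Finset.mem_univ j), if_pos (Nat.lt_succ_self _),
        ← Finset.prod_erase_mul (a := j) (f := fun t : Fin H.m =>
          if t.1 < n then H.expCons r i l t (u t (z t)) (z t) else 1) _ (Finset.mem_univ j),
        if_neg (lt_irrefl _), mul_one]
      congr 1
      refine Finset.prod_congr rfl fun t ht => ?_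
      have hne : t ≠ j := Finset.ne_of_mem_erase ht
      have hiff : t.1 < n + 1 ↔ t.1 < n := by
        have : t.1 ≠ n := fun e => hne (Fin.ext e)
        omega
      simp only [hiff]
    have hact : ∀ o : (H.addCopies stock).Table, H.expCons r i l j (serveAct (stock := stock) π h0 h1 z u o j).1 (z j) ≤
        H.expCons r i l j (u j (z j)) (z j) := by
      intro o
      rw [serveAct_eq]
      rcases serve_fst (stock := stock) j (u j (z j)) (z j) {κ |
        Trace.Implementable (H := H.addCopies stock) (serveRun π h0 h1 z u o j) j κ} with h | h
      · rw [h]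
      · rw [h]
        exact H.expCons_trivial_le i hr hjl _ _
    simp only [hstep]
    calc _ = ∫⁻ o, ∫⁻ y, F (serveRun π h0 h1 z u o n) * G y
          ∂((H.addCopies stock).law j (serveAct π h0 h1 z u o j) (z j))
          ∂(H.addCopies stock).tableLaw :=
          ρ.lintegral_trace_step z 0 u j (F := fun p => F p.1 * G p.2)
            ((hF.comp measurable_fst).mul (hG.comp measurable_snd))
      _ ≤ ∫⁻ o, F (serveRun π h0 h1 z u o n) * H.expCons r i l j (u j (z j)) (z j)
          ∂(H.addCopies stock).tableLaw := by
          refine lintegral_mono fun o => ?_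
          rw [lintegral_const_mul _ hG]
          gcongr
          exact (lintegral_exp_lift_le hr i hjl _ _).trans (hact o)
      _ = (∫⁻ o, F (serveRun π h0 h1 z u o n) ∂(H.addCopies stock).tableLaw) *
            H.expCons r i l j (u j (z j)) (z j) :=
          lintegral_mul_const _ (hF.comp (ρ.measurable_trace_table z 0 u n))
      _ ≤ _ := by
          rw [hprod]
          gcongr
          exact ih (by omega)

/-- The event that no introduced version of resource `i` has one unit left. -/
def scarce (i : H.I) (j : Fin H.m) : Set (H.addCopies stock).Trace :=
  {τ | ∀ v ∈ introduced stock i j, Trace.remaining (H := H.addCopies stock) τ j ⟨i, v⟩ < 1}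

theorem measurableSet_scarce (i : H.I) (j : Fin H.m) :
    MeasurableSet (scarce (stock := stock) i j) := by
  simp only [scarce, Set.ofPred_forall]
  exact MeasurableSet.iInter fun v => MeasurableSet.iInter fun _ =>
    measurableSet_lt (Trace.measurable_remaining (H := H.addCopies stock) j ⟨i, v⟩)
      measurable_const

/-- A resource is scarce only if most of the inventory of its introduced versions is in use. -/
theorem le_usage_of_scarce (hs : ∀ i j, 0 ≤ stock i j) {i : H.I} {j : Fin H.m}
    {τ : (H.addCopies stock).Trace} (hr : τ.repl = 0) (h : τ ∈ scarce i j) :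
    H.inv i + ∑ t ∈ Finset.Iic j, stock i t - (introduced stock i j).card ≤ usage i j j τ := by
  have h1 := sum_introduced_remaining hs hr i j
  have h2 : ∑ v ∈ introduced stock i j, Trace.remaining (H := H.addCopies stock) τ j ⟨i, v⟩ ≤
      ∑ v ∈ introduced stock i j, 1 := Finset.sum_le_sum fun v hv => (h v hv).le
  have h3 : usage i j j τ = ∑ t ∈ Finset.Iio j,
      ∑ v ∈ introduced stock i j, τ.cons t ⟨i, v⟩ j := by
    unfold usage
    rw [← Finset.sum_filter]
    congr 1
    ext t
    simp only [Finset.mem_filter, Finset.mem_univ, true_and, Finset.mem_Iio, Fin.val_fin_lt]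
  rw [h3]
  rw [h1, Finset.sum_const, nsmul_eq_mul, mul_one] at h2
  linarith

/-- Markov's inequality for the exponential of the usage. The bound keeps the product over the
proposals before `j`, to be averaged over types and proposals only afterwards. -/
theorem tableLaw_scarce_le (hs : ∀ i j, 0 ≤ stock i j) {r : ℝ} (hr : 0 ≤ r) (i : H.I)
    (j : Fin H.m) : (H.addCopies stock).tableLaw {o | serveRun π h0 h1 z u o j ∈ scarce i j} ≤
      ENNReal.ofReal (Real.exp (-(r * (H.inv i + ∑ t ∈ Finset.Iic j, stock i t -
        (introduced stock i j).card)))) *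
      ∏ t ∈ Finset.Iio j, H.expCons r i j t (u t (z t)) (z t) := by
  classical
  have hmeas : Measurable fun o => serveRun (stock := stock) π h0 h1 z u o j :=
    (servePolicy π stock h0 h1).measurable_trace_table z 0 u j
  have hS : MeasurableSet {o | serveRun (stock := stock) π h0 h1 z u o j ∈ scarce i j} :=
    hmeas (measurableSet_scarce i j)
  rw [← lintegral_indicator_one hS]
  set θ := H.inv i + ∑ t ∈ Finset.Iic j, stock i t - (introduced stock i j).card with hθ
  have hprod : ∏ t ∈ Finset.Iio j, H.expCons r i j t (u t (z t)) (z t) =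
      ∏ t : Fin H.m, if t.1 < j.1 then H.expCons r i j t (u t (z t)) (z t) else 1 := by
    rw [← Finset.prod_filter]
    congr 1
    ext t
    simp only [Finset.mem_filter, Finset.mem_univ, true_and, Finset.mem_Iio, Fin.val_fin_lt]
  rw [hprod]
  calc _ ≤ ∫⁻ o, ENNReal.ofReal (Real.exp (-(r * θ))) *
        ENNReal.ofReal (Real.exp (r * usage i j j (serveRun π h0 h1 z u o j)))
          ∂(H.addCopies stock).tableLaw := by
        refine lintegral_mono fun o => ?_
        rw [Set.indicator_apply]
        split_ifs with h
        · have hrepl : (serveRun π h0 h1 z u o j).repl = 0 := Policy.repl_trace _ _ _ _ _ _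
          have h2 := mul_le_mul_of_nonneg_left (le_usage_of_scarce hs hrepl h) hr
          rw [← ENNReal.ofReal_mul (Real.exp_pos _).le, ← Real.exp_add, Pi.one_apply,
            ENNReal.one_le_ofReal, Real.one_le_exp_iff]
          linarith
        · exact zero_le
    _ = _ := lintegral_const_mul _ (Real.measurable_exp.comp
        (((measurable_usage i j j).comp hmeas).const_mul r)).ennreal_ofReal
    _ ≤ _ := by
        gcongr
        exact lintegral_exp_usage_le π h0 h1 z u hr i j le_rfl

/-- The profit of the proposal is lost only if one of the resources that it uses is scarce. -/
theorem meanReward_le_of_not_scarce (i₀ : H.I) (v : H.Version stock i₀) (j : Fin H.m)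
    (o : (H.addCopies stock).Table)
    (h : ∀ i, H.b i j (u j (z j)) (z j) j ≠ 0 → serveRun π h0 h1 z u o j ∉ scarce i j) :
    H.meanReward i₀ j (u j (z j)) (z j) ≤
      (H.addCopies stock).meanReward ⟨i₀, v⟩ j (serveAct π h0 h1 z u o j) (z j) := by
  have hz : (serveRun π h0 h1 z u o j).types = z := Policy.types_trace _ _ _ _ _ _
  have hex := serve_of_remaining (τ := serveRun π h0 h1 z u o j) (j := j) (k := u j (z j))
    (by
      rw [hz]
      intro i hi
      have := h i hi
      simp only [scarce, Set.mem_ofPred_eq, not_forall, not_lt] at this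
      obtain ⟨v, hv, hv'⟩ := this
      exact ⟨v, hv, hv'⟩)
  rw [hz] at hex
  obtain ⟨e1, e2, -⟩ := serve_spec hex
  rw [← serveAct_eq] at e1 e2
  have hm : Measurable fun y : Outcome (H.CopyI stock) H.m =>
      ENNReal.ofReal (y.2 (⟨i₀, v⟩ : H.CopyI stock)) := by fun_prop
  refine le_of_eq ?_
  refine Eq.trans ?_ (lintegral_map hm
    (H.measurable_lift (stock := stock) j (serveAct π h0 h1 z u o j) (z j))).symm
  rw [e1]
  refine lintegral_congr fun y => congrArg ENNReal.ofReal ?_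
  exact (if_pos e2).symm

/-- The proposed profit is either earned or charged to a scarce resource that the proposal uses. The
scarcity bound involves only requests before `j` and therefore averages independently of the
proposal at `j`. The hypothesis `hq` bounds the resulting Chernoff exponent uniformly, and summing
over the used resources costs the factor `d`. -/
theorem proposalMean_le_profitAt {d : ℕ} (hd : ∀ j k z, {i | H.b i j k z j ≠ 0}.ncard ≤ d)
    (hs : ∀ i j, 0 ≤ stock i j) {r : ℝ} (hr : 0 ≤ r) {q : ℝ}
    (hq : ∀ i j, -(r * (H.inv i + ∑ t ∈ Finset.Iic j, stock i t - (introduced stock i j).card)) +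
      (Real.exp r - 1) * (1 - δ) * (H.inv i + ∑ t ∈ Finset.Iic j, H.q i t) ≤ q)
    (i₀ : H.I) (v : H.Version stock i₀) (j : Fin H.m) :
    π.proposalMean δ j (H.meanReward i₀ j) ≤ (servePolicy π stock h0 h1).profitAt ⟨i₀, v⟩ j +
      d * ENNReal.ofReal (Real.exp q) * π.proposalMean δ j (H.meanReward i₀ j) := by
  classical
  let R := H.meanReward i₀ j
  let U : H.I → H.K → H.Z → ℝ≥0∞ := fun i k z => if H.b i j k z j ≠ 0 then R k z else 0
  let e : H.I → ℝ≥0∞ := fun i => ENNReal.ofReal (Real.exp (-(r * (H.inv i +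
    ∑ t ∈ Finset.Iic j, stock i t - (introduced stock i j).card))))
  let T := (H.addCopies stock).tableLaw
  let A : (Fin H.m → H.Z) → (Fin H.m → H.Z → H.K) → ℝ≥0∞ := fun z u =>
    ∫⁻ o, (H.addCopies stock).meanReward ⟨i₀, v⟩ j (serveAct π h0 h1 z u o j) (z j) ∂T
  let B : H.I → (Fin H.m → H.Z) → (Fin H.m → H.Z → H.K) → ℝ≥0∞ := fun i z u =>
    U i (u j (z j)) (z j) * ∏ t ∈ Finset.Iio j, H.expCons r i j t (u t (z t)) (z t)
  have hpoint : ∀ z u, R (u j (z j)) (z j) ≤ A z u + ∑ i, e i * B i z u := by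
    intro z u
    have hS : ∀ i, MeasurableSet {o | serveRun (stock := stock) π h0 h1 z u o j ∈ scarce i j} :=
      fun i => (servePolicy π stock h0 h1).measurable_trace_table z 0 u j (measurableSet_scarce i j)
    calc R (u j (z j)) (z j) = ∫⁻ _, R (u j (z j)) (z j) ∂T := by simp [T]
      _ ≤ ∫⁻ o, (H.addCopies stock).meanReward ⟨i₀, v⟩ j (serveAct π h0 h1 z u o j) (z j) +
          ∑ i, U i (u j (z j)) (z j) *
            {o | serveRun π h0 h1 z u o j ∈ scarce i j}.indicator 1 o ∂T := by
          refine lintegral_mono fun o => ?_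
          by_cases h : ∀ i, H.b i j (u j (z j)) (z j) j ≠ 0 →
              serveRun π h0 h1 z u o j ∉ scarce i j
          · exact le_add_right (meanReward_le_of_not_scarce π h0 h1 z u i₀ v j o h)
          · push Not at h
            obtain ⟨i, hi, hi'⟩ := h
            refine le_add_left (le_trans ?_ (Finset.single_le_sum
              (f := fun i => U i (u j (z j)) (z j) *
                {o | serveRun π h0 h1 z u o j ∈ scarce i j}.indicator 1 o)
              (fun _ _ => zero_le) (Finset.mem_univ i)))
            have h2 : o ∈ {o | serveRun (stock := stock) π h0 h1 z u o j ∈ scarce i j} := hi'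
            simp only [Set.indicator_of_mem h2, U, if_pos hi, Pi.one_apply, mul_one]
            exact le_rfl
      _ = A z u + ∑ i, U i (u j (z j)) (z j) *
            T {o | serveRun π h0 h1 z u o j ∈ scarce i j} := by
          rw [lintegral_add_right _ (Finset.measurable_sum _ fun i _ =>
              (measurable_one.indicator (hS i)).const_mul _),
            lintegral_finsetSum _ fun i _ => (measurable_one.indicator (hS i)).const_mul _]
          congr 1
          refine Finset.sum_congr rfl fun i _ => ?_
          rw [lintegral_const_mul _ (measurable_one.indicator (hS i)),
            lintegral_indicator_one (hS i)]
      _ ≤ _ := by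
          refine add_le_add le_rfl (Finset.sum_le_sum fun i _ => ?_)
          calc _ ≤ U i (u j (z j)) (z j) * (e i *
                ∏ t ∈ Finset.Iio j, H.expCons r i j t (u t (z t)) (z t)) := by
                gcongr
                exact tableLaw_scarce_le π h0 h1 z u hs hr i j
            _ = _ := by simp only [B]; ring
  have hR : π.proposalMean δ j R = ∫⁻ z, ∫⁻ u, R (u j (z j)) (z j)
      ∂π.proposalsLaw δ ∂H.typesLaw := by
    have := π.lintegral_proposals_prod h0 h1 {j} (fun _ => R)
    simpa using this.symm
  have hA : ∫⁻ z, ∫⁻ u, A z u ∂π.proposalsLaw δ ∂H.typesLaw =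
      (servePolicy π stock h0 h1).profitAt ⟨i₀, v⟩ j :=
    (profitAt_addCopies_eq (servePolicy π stock h0 h1) ⟨i₀, v⟩ j).symm
  have hB : ∀ i, ∫⁻ z, ∫⁻ u, B i z u ∂π.proposalsLaw δ ∂H.typesLaw =
      π.proposalMean δ j (U i) * ∏ t ∈ Finset.Iio j, π.proposalMean δ t (H.expCons r i j t) := by
    intro i
    -- One family holds the lost profit at `j` and the exponential moments before `j`, so the
    -- product formula separates them in one application.
    let f : Fin H.m → H.K → H.Z → ℝ≥0∞ := fun t => if t = j then U i else H.expCons r i j t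
    have hj : j ∉ Finset.Iio j := by simp
    have hf : ∀ t ∈ Finset.Iio j, f t = H.expCons r i j t := fun t ht =>
      if_neg (Finset.mem_Iio.1 ht).ne
    have hfj : f j = U i := if_pos rfl
    have := π.lintegral_proposals_prod h0 h1 (insert j (Finset.Iio j)) f
    simp only [Finset.prod_insert hj, hfj] at this
    rw [Finset.prod_congr rfl fun t ht => by rw [hf t ht]] at this
    rw [← this]
    refine lintegral_congr fun z => lintegral_congr fun u => ?_
    refine congrArg (_ * ·) (Finset.prod_congr rfl fun t ht => ?_)
    rw [hf t ht]
  have hsum : ∑ i, π.proposalMean δ j (U i) ≤ d * π.proposalMean δ j R := by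
    have h2 : ∑ i, π.proposalMean δ j (U i) = π.proposalMean δ j fun k z => ∑ i, U i k z := by
      unfold Policy.proposalMean
      rw [← lintegral_finsetSum _ fun i _ => measurable_of_countable _]
      refine lintegral_congr fun z => ?_
      rw [← lintegral_finsetSum _ fun i _ => measurable_of_countable _]
    have h3 : d * π.proposalMean δ j R = π.proposalMean δ j fun k z => d * R k z := by
      unfold Policy.proposalMean
      rw [← lintegral_const_mul _ (measurable_of_countable _)]
      refine lintegral_congr fun z => ?_
      rw [← lintegral_const_mul _ (measurable_of_countable _)]
    rw [h2, h3]
    refine π.proposalMean_mono fun k z => ?_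
    have := sum_indicator_le (U := fun i => {x : H.K × H.Z | H.b i j x.1 x.2 j ≠ 0}) (x := (k, z))
      (hd j k z) fun x => R x.1 x.2
    simpa only [Set.indicator_apply, Set.mem_ofPred_eq] using this
  have heB : ∀ i, e i * (π.proposalMean δ j (U i) *
      ∏ t ∈ Finset.Iio j, π.proposalMean δ t (H.expCons r i j t)) ≤
      ENNReal.ofReal (Real.exp q) * π.proposalMean δ j (U i) := by
    intro i
    have h2 := π.prod_proposalMean_expCons_le hr h0 h1 i j
    calc _ ≤ e i * (π.proposalMean δ j (U i) * ENNReal.ofReal (Real.exp ((Real.exp r - 1) *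
            (1 - δ) * (H.inv i + ∑ t ∈ Finset.Iic j, H.q i t)))) := by gcongr
      _ = (e i * ENNReal.ofReal (Real.exp ((Real.exp r - 1) * (1 - δ) *
            (H.inv i + ∑ t ∈ Finset.Iic j, H.q i t)))) * π.proposalMean δ j (U i) := by ring
      _ ≤ _ := by
        gcongr
        simp only [e]
        rw [← ENNReal.ofReal_mul (Real.exp_pos _).le, ← Real.exp_add]
        exact ENNReal.ofReal_le_ofReal (Real.exp_le_exp.2 (hq i j))
  calc π.proposalMean δ j R = _ := hR
    _ ≤ ∫⁻ z, ∫⁻ u, A z u + ∑ i, e i * B i z u ∂π.proposalsLaw δ ∂H.typesLaw :=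
        lintegral_mono fun z => lintegral_mono fun u => hpoint z u
    _ = ∫⁻ z, ∫⁻ u, A z u ∂π.proposalsLaw δ ∂H.typesLaw +
          ∑ i, e i * ∫⁻ z, ∫⁻ u, B i z u ∂π.proposalsLaw δ ∂H.typesLaw := by
        have h2 : ∀ z, ∫⁻ u, A z u + ∑ i, e i * B i z u ∂π.proposalsLaw δ =
            ∫⁻ u, A z u ∂π.proposalsLaw δ + ∑ i, e i * ∫⁻ u, B i z u ∂π.proposalsLaw δ := by
          intro z
          rw [lintegral_add_left (measurable_of_countable _),
            lintegral_finsetSum _ fun i _ => measurable_of_countable _]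
          congr 1
          exact Finset.sum_congr rfl fun i _ => lintegral_const_mul _ (measurable_of_countable _)
        simp only [h2]
        rw [lintegral_add_left (measurable_of_countable _),
          lintegral_finsetSum _ fun i _ => measurable_of_countable _]
        congr 1
        exact Finset.sum_congr rfl fun i _ => lintegral_const_mul _ (measurable_of_countable _)
    _ ≤ (servePolicy π stock h0 h1).profitAt ⟨i₀, v⟩ j +
          ∑ i, ENNReal.ofReal (Real.exp q) * π.proposalMean δ j (U i) := by
        rw [hA]
        refine add_le_add le_rfl (Finset.sum_le_sum fun i _ => ?_)
        rw [hB]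
        exact heB i
    _ ≤ _ := by
        rw [← Finset.mul_sum, mul_comm (d : ℝ≥0∞), mul_assoc]
        gcongr

end Serve

end AllocInstance

namespace AllocInstance

/-! ### Numerical estimates for the batching parameter. -/

section Numerics

theorem cube_rpow_third {y : ℝ} (hy : 0 ≤ y) : (y ^ (1 / 3 : ℝ)) ^ 3 = y := by
  rw [← Real.rpow_natCast, ← Real.rpow_mul hy]
  norm_num

/-- After cubing, this is `3 ≤ 8 l²`. Replacing the cube root of the logarithm by the logarithm
itself is allowed because the latter is at least `1`. -/
theorem rpow_third_le {M c l : ℝ} (hM : 0 < M) (hc : 0 < c) (hl : 1 ≤ l) :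
    (3 * M / c * l) ^ (1 / 3 : ℝ) ≤ 2 * (M ^ (1 / 3 : ℝ) * c ^ (-(1 / 3) : ℝ) * l) := by
  have h1 : 0 ≤ M / c * l := by positivity
  have h2 : (2 * (M ^ (1 / 3 : ℝ) * c ^ (-(1 / 3) : ℝ) * l)) ^ 3 = 8 * (M / c * l) * l ^ 2 := by
    rw [mul_pow, mul_pow, mul_pow, cube_rpow_third hM.le, Real.rpow_neg hc.le, inv_pow,
      cube_rpow_third hc.le]
    ring
  refine le_of_pow_le_pow_left₀ three_ne_zero (by positivity) ?_
  rw [h2, cube_rpow_third (by positivity)]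
  have h3 : 3 * M / c * l = 3 * (M / c * l) := by ring
  nlinarith [mul_le_mul_of_nonneg_left (one_le_pow₀ hl : 1 ≤ l ^ 2) h1]

/-- The function `log y / y` decreases from `e` on, and `3` exceeds `e`; it is applied at `y = c d`
and `y = x d`. It transfers smallness of `ε` from `c` to every larger inventory. -/
theorem log_mul_div_le {c x d : ℝ} (hc : 3 ≤ c) (hcx : c ≤ x) (hd : 1 ≤ d) :
    Real.log (x * d) / x ≤ Real.log (c * d) / c := by
  have hc0 : 0 < c := by linarith
  have h1 : Real.exp 1 ≤ c * d := by nlinarith [Real.exp_one_lt_d9]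
  have h2 : c * d ≤ x * d := by gcongr
  have h3 := mul_le_mul_of_nonneg_right (Real.log_div_self_antitoneOn h1 (h1.trans h2) h2)
    (by linarith : (0 : ℝ) ≤ d)
  have hx0 : 0 < x := by linarith
  have hd0 : 0 < d := by linarith
  have e : ∀ y : ℝ, 0 < y → Real.log (y * d) / (y * d) * d = Real.log (y * d) / y := by
    intro y hy
    field_simp
  simpa only [e x hx0, e c hc0] using h3

theorem one_le_log_mul {c d : ℝ} (hc : 3 ≤ c) (hd : 1 ≤ d) : 1 ≤ Real.log (c * d) := by
  rw [Real.le_log_iff_exp_le (by positivity)]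
  nlinarith [Real.exp_one_lt_d9]

/-- The threshold is the minimum of `x` and the cube root of `3 M x² log (x d)`, and both increase.
Hence the threshold of an instance with larger minimum inventory is at least `g`. -/
theorem eps_mul_mono {M c x : ℝ} {d : ℕ} (hM : 0 ≤ M) (hc : 3 ≤ c) (hcx : c ≤ x) (hd : 1 ≤ d) :
    eps M d c * c ≤ eps M d x * x := by
  have hd' : (1 : ℝ) ≤ d := by exact_mod_cast hd
  have h1 := one_le_log_mul hc hd'
  have h2 := one_le_log_mul (hc.trans hcx) hd'
  have h3 : Real.log (c * d) ≤ Real.log (x * d) := Real.log_le_log (by positivity) (by gcongr)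
  have hx0 : 0 < x := by linarith
  have hc0 : 0 < c := by linarith
  unfold eps
  rw [min_mul_of_nonneg _ _ hx0.le, min_mul_of_nonneg _ _ hc0.le, one_mul, one_mul]
  refine min_le_min ?_ hcx
  refine le_of_pow_le_pow_left₀ three_ne_zero (by positivity) ?_
  rw [mul_pow, mul_pow, cube_rpow_third (by positivity), cube_rpow_third (by positivity)]
  calc 3 * M / c * Real.log (c * d) * c ^ 3 = 3 * M * Real.log (c * d) * c ^ 2 := by
        field_simp
    _ ≤ 3 * M * Real.log (x * d) * x ^ 2 := by gcongr
    _ = _ := by field_simp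

/-- What the smallness of `ε` is used for. -/
structure EpsSmall (M : ℝ) (d : ℕ) (x : ℝ) : Prop where
  pos : 0 < eps M d x
  le_third : 3 * eps M d x ≤ 1
  one_le : 1 ≤ eps M d x ^ 2 * x
  scarce : d * Real.exp (-(eps M d x ^ 2 * x / 4)) ≤ eps M d x
  shortage : d * Real.exp (-(eps M d x ^ 3 * x / (2 * M))) ≤ eps M d x

/-- When the minimum in `eps` is the cube root, `ε³ x = 3 M log (x d)`. The shortage exponent is
then `(3/2) log (x d)`, which fixes the role of the constant `3`. The bound `ε ≤ M / 3` gives `ε² x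
≥ 9 log (x d)`, more than the scarcity exponent needs. Finally `d * exp (-log (x d)) = 1 / x ≤ ε`.
-/
theorem epsSmall {M x : ℝ} {d : ℕ} (hM : 0 < M) (hx : 3 ≤ x) (hd : 1 ≤ d)
    (h1 : (3 * M / x * Real.log (x * d)) ^ (1 / 3 : ℝ) ≤ 1 / 3)
    (h2 : (3 * M / x * Real.log (x * d)) ^ (1 / 3 : ℝ) ≤ M / 3) : EpsSmall M d x := by
  have hd' : (1 : ℝ) ≤ d := by exact_mod_cast hd
  have hL := one_le_log_mul hx hd'
  have he : eps M d x = (3 * M / x * Real.log (x * d)) ^ (1 / 3 : ℝ) :=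
    min_eq_left (h1.trans (by norm_num))
  have hx0 : 0 < x := by linarith
  have hpos : 0 < eps M d x := he ▸ by positivity
  have hcube : eps M d x ^ 3 * x = 3 * M * Real.log (x * d) := by
    rw [he, cube_rpow_third (by positivity)]
    field_simp
  rw [← he] at h1 h2
  set e := eps M d x with he'
  have hexp : d * Real.exp (-Real.log (x * d)) = 1 / x := by
    rw [Real.exp_neg, Real.exp_log (by positivity)]
    field_simp
  have hsq : 4 * Real.log (x * d) ≤ e ^ 2 * x / 2 := by
    have : e * (9 * Real.log (x * d)) ≤ e * (e ^ 2 * x) := by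
      nlinarith [mul_le_mul_of_nonneg_right h2 (by linarith : 0 ≤ Real.log (x * d))]
    linarith [le_of_mul_le_mul_left this hpos]
  have hone : 1 ≤ e ^ 2 * x := by linarith
  have hinv : 1 / x ≤ e := by
    rw [div_le_iff₀ hx0]
    nlinarith [mul_pos hpos hx0]
  have key : ∀ y, Real.log (x * d) ≤ y → d * Real.exp (-y) ≤ e := fun y hy =>
    le_trans (by gcongr) (hexp.le.trans hinv)
  refine ⟨hpos, by linarith, hone, key _ (by linarith), key _ ?_⟩
  rw [hcube, le_div_iff₀ (by positivity)]
  nlinarith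

end Numerics

theorem mul_toReal_sum_le {ι : Type*} [Fintype ι] {a b : ι → ℝ≥0∞} (ha : ∀ j, a j ≠ ⊤)
    (hb : ∀ j, b j ≠ ⊤) {e : ℝ} {p : ℝ≥0∞} (he : 0 ≤ e) (hp : p ≤ ENNReal.ofReal e)
    (h : ∀ j, a j ≤ b j + p * a j) : (1 - e) * (∑ j, a j).toReal ≤ (∑ j, b j).toReal := by
  rw [ENNReal.toReal_sum fun j _ => ha j, ENNReal.toReal_sum fun j _ => hb j, Finset.mul_sum]
  refine Finset.sum_le_sum fun j _ => ?_
  have h1 : a j ≤ b j + ENNReal.ofReal e * a j := (h j).trans (by gcongr)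
  have h2 := ENNReal.toReal_mono (ENNReal.add_ne_top.2
    ⟨hb j, ENNReal.mul_ne_top ENNReal.ofReal_ne_top (ha j)⟩) h1
  rw [ENNReal.toReal_add (hb j) (ENNReal.mul_ne_top ENNReal.ofReal_ne_top (ha j)),
    ENNReal.toReal_mul, ENNReal.toReal_ofReal he] at h2
  linarith

/-! ### The two comparisons between an instance and its batched version. -/

section Comparison

variable {H : AllocInstance} {M : ℝ} {d : ℕ}

theorem cMin_le (i : H.I) : H.cMin ≤ H.inv i := ciInf_le (Set.finite_range _).bddBelow i

theorem threshold_le_cMin_batched (hx : 0 ≤ H.cMin) :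
    H.threshold M d ≤ (H.batched M d).cMin := by
  have h1 : H.threshold M d ≤ H.cMin := mul_le_of_le_one_left hx (eps_le_one _ _ _)
  refine le_ciInf ?_
  rintro ⟨i, v, hv⟩
  cases v with
  | none => exact h1.trans (cMin_le i)
  | some j => exact H.threshold_le_batch M d i (hv j rfl)

/-- Adding copies discards the replenishment data, so `H` and `H.noRepl` yield definitionally the
same instance for the same stock, even though the batches are computed from the replenishment of
`H`. -/
theorem batched_mem {F : Set AllocInstance} (hF : ClosedFamily F) (h : H ∈ F) :
    H.batched M d ∈ withoutReplenishment F :=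
  hF.2 _ ⟨hF.1 H h, fun _ _ => mul_zero _⟩ (H.batch M d)

theorem mul_value_le_extend (hM : 0 < M) (hw : ∀ i j, H.w i j ≤ M)
    (hd : ∀ j k z, {i | H.b i j k z j ≠ 0}.ncard ≤ d) (he : EpsSmall M d H.cMin)
    (π : OnlinePolicy (H.batched M d)) :
    (1 - eps M d H.cMin) * π.value ≤ (extend π).value := by
  refine le_ciInf fun i => ?_
  -- The value on the batched instance is a minimum over all versions, so it is enough to compare
  -- with one, and the original version always exists.
  let v : H.Version (H.batch M d) i := ⟨none, by simp⟩
  have h1 : (1 - eps M d H.cMin) * π.profit ⟨i, v⟩ ≤ (extend π).profit i := by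
    have e1 : π.profit ⟨i, v⟩ = (∑ j, π.profitAt ⟨i, v⟩ j).toReal := π.profit_eq _
    rw [(extend π).profit_eq]
    refine le_of_eq_of_le (congrArg _ e1) ?_
    refine mul_toReal_sum_le (fun j => π.profitAt_ne_top _ j)
      (fun j => (extend π).profitAt_ne_top i j) he.pos.le ?_ fun j =>
      profitAt_extend π hd (fun i j => H.batch_nonneg M d i j)
        (H.replsLaw_shortage_le hM he.pos hw) j i v
    rw [← ENNReal.ofReal_natCast, ← ENNReal.ofReal_mul (Nat.cast_nonneg d)]
    exact ENNReal.ofReal_le_ofReal he.shortage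
  refine le_trans ?_ h1
  exact mul_le_mul_of_nonneg_left (π.value_le_profit _) (by linarith [he.le_third, he.pos])

/-- Each copy holds at least one threshold, so the copies cannot be numerous relative to their total
stock; the subtracted `1` is the original version. -/
theorem card_introduced_mul_le (i : H.I) (j : Fin H.m) :
    ((introduced (H.batch M d) i j).card - 1) * H.threshold M d ≤
      ∑ t ∈ Finset.Iic j, H.batch M d i t := by
  classical
  have h1 := sum_introduced (stock := H.batch M d) i j fun _ => (1 : ℝ)
  rw [Finset.sum_const, nsmul_eq_mul, mul_one] at h1
  rw [h1, add_sub_cancel_left, Finset.sum_mul]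
  refine Finset.sum_le_sum fun t _ => ?_
  split_ifs with ht
  · rw [one_mul]
    exact H.threshold_le_batch M d i ht
  · rw [zero_mul]
    exact H.batch_nonneg M d i t

/-- Compare everything with the fluid capacity `W = inv + Q`. After the batching lag and one unit
lost per version, at least `(1 - 2ε) W` is usable, while the thinned mean demand is at most `(1 -
3ε) W`. The tilt `ε / 2` turns this gap into an exponent of at most `-ε² W / 4`, and `W` is at least
the minimum inventory. -/
theorem exponent_le (he : EpsSmall M d H.cMin) (i : H.I) (j : Fin H.m) :
    -(eps M d H.cMin / 2 * (H.inv i + ∑ t ∈ Finset.Iic j, H.batch M d i t -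
        (introduced (H.batch M d) i j).card)) +
      (Real.exp (eps M d H.cMin / 2) - 1) * (1 - 3 * eps M d H.cMin) *
        (H.inv i + ∑ t ∈ Finset.Iic j, H.q i t) ≤ -(eps M d H.cMin ^ 2 * H.cMin / 4) := by
  have hx := cMin_le i
  have hpos := he.pos
  have h3 := he.le_third
  have h1 := he.one_le
  have hx0 : 0 ≤ H.cMin := by
    by_contra h
    nlinarith [sq_nonneg (eps M d H.cMin)]
  have hthr : 0 ≤ H.threshold M d := mul_nonneg hpos.le hx0
  have hS := H.le_sum_batch M d i hthr j
  have hS' := H.sum_batch_le M d i j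
  have hN := card_introduced_mul_le (M := M) (d := d) i j
  have hQ : 0 ≤ ∑ t ∈ Finset.Iic j, H.q i t := Finset.sum_nonneg fun t _ => H.q_nonneg i t
  have hexp := (abs_le.1 (Real.abs_exp_sub_one_sub_id_le (x := eps M d H.cMin / 2)
    (by rw [abs_of_nonneg (by linarith)]; linarith))).2
  unfold threshold at hS hN
  generalize ∑ t ∈ Finset.Iic j, H.batch M d i t = S at hS hS' hN ⊢
  generalize ∑ t ∈ Finset.Iic j, H.q i t = Q at hS hS' hQ ⊢
  generalize ((introduced (H.batch M d) i j).card : ℝ) = N at hN ⊢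
  generalize Real.exp (eps M d H.cMin / 2) = E at hexp ⊢
  generalize eps M d H.cMin = e at *
  generalize H.cMin = x at *
  generalize H.inv i = c at *
  -- One unit per copy is an `e` fraction of the copies' stock, because a copy holds at least `e x`
  -- units and `e² x ≥ 1`.
  have hN2 : N - 1 ≤ e * ((1 - e) * Q) := by
    rcases le_total (N - 1) 0 with h | h
    · exact h.trans (by have : 0 ≤ 1 - e := by linarith
                        positivity)
    · calc N - 1 ≤ (N - 1) * (e ^ 2 * x) := le_mul_of_one_le_right h h1
        _ = e * ((N - 1) * (e * x)) := by ring
        _ ≤ e * ((1 - e) * Q) := by exact mul_le_mul_of_nonneg_left (hN.trans hS') hpos.le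
  -- The stock of the copies keeps the factor `(1 - e)² ≥ 1 - 2e`. The pending fluid `e x` and the
  -- unit of the original version are paid from `2 e c`, since `e x ≥ e² x ≥ 1` and `c ≥ x`.
  have hcap : (1 - 2 * e) * (c + Q) ≤ c + S - N := by
    nlinarith [mul_nonneg (mul_nonneg hpos.le hpos.le) hQ, mul_nonneg hpos.le hx0,
      mul_nonneg hpos.le (sub_nonneg.2 hx)]
  have hW : x ≤ c + Q := by linarith
  generalize c + Q = W at *
  have h4 := mul_le_mul_of_nonneg_left hcap (by linarith : 0 ≤ e / 2)
  have hW0 : 0 ≤ W := hx0.trans hW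
  have h5 : (E - 1) * (1 - 3 * e) * W ≤ (e / 2 + (e / 2) ^ 2) * (1 - 3 * e) * W := by
    have : 0 ≤ 1 - 3 * e := by linarith
    gcongr
    linarith
  have h6 : 0 ≤ e ^ 2 * (W - x) := mul_nonneg (sq_nonneg e) (sub_nonneg.2 hW)
  have h7 : 0 ≤ e ^ 3 * W := by positivity
  -- The coefficient of `W` is `-(e/2)(1 - 2e) + (e/2 + e²/4)(1 - 3e) = -e²/4 - 3e³/4`.
  nlinarith

/-- The factor `1 - 3ε` is the thinning of the proposals, and `1 - ε` accounts for the proposals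
lost to scarcity. -/
theorem mul_value_le_OPT_batched (hd : ∀ j k z, {i | H.b i j k z j ≠ 0}.ncard ≤ d)
    (he : EpsSmall M d H.cMin) (π : Policy H) :
    (1 - 3 * eps M d H.cMin) * (1 - eps M d H.cMin) * π.value ≤ (H.batched M d).OPT := by
  have hpos := he.pos
  have h0 : 0 ≤ 3 * eps M d H.cMin := by linarith
  have h1 := he.le_third
  refine le_trans ?_ (le_csSup (bddAbove_values (H.batched M d))
    ⟨servePolicy π (H.batch M d) h0 h1, rfl⟩)
  refine le_ciInf ?_
  rintro ⟨i, v⟩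
  let a := fun j => π.proposalMean (3 * eps M d H.cMin) j (H.meanReward i j)
  have hA : (1 - 3 * eps M d H.cMin) * π.profit i ≤ (∑ j, a j).toReal := by
    rw [Policy.profit_eq, ENNReal.toReal_sum fun j _ => π.profitAt_ne_top i j,
      ENNReal.toReal_sum fun j _ => π.proposalMean_ne_top i j, Finset.mul_sum]
    refine Finset.sum_le_sum fun j _ => ?_
    have := ENNReal.toReal_mono (π.proposalMean_ne_top i j)
      (π.le_proposalMean (δ := 3 * eps M d H.cMin) i j)
    rwa [ENNReal.toReal_mul, ENNReal.toReal_ofReal (by linarith)] at this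
  have hB : (1 - eps M d H.cMin) * (∑ j, a j).toReal ≤
      (servePolicy π (H.batch M d) h0 h1).profit ⟨i, v⟩ := by
    refine le_of_le_of_eq ?_ ((servePolicy π (H.batch M d) h0 h1).profit_eq ⟨i, v⟩).symm
    refine mul_toReal_sum_le (fun j => π.proposalMean_ne_top i j)
      (fun j => (servePolicy π (H.batch M d) h0 h1).profitAt_ne_top ⟨i, v⟩ j) hpos.le ?_ fun j =>
      proposalMean_le_profitAt π h0 h1 hd (fun i j => H.batch_nonneg M d i j)
        (by linarith : 0 ≤ eps M d H.cMin / 2) (exponent_le he) i v j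
    rw [← ENNReal.ofReal_natCast, ← ENNReal.ofReal_mul (Nat.cast_nonneg d)]
    exact ENNReal.ofReal_le_ofReal he.scarce
  refine le_trans ?_ hB
  have h2 : 0 ≤ 1 - eps M d H.cMin := by linarith
  calc _ = (1 - eps M d H.cMin) * ((1 - 3 * eps M d H.cMin) * π.value) := by ring
    _ ≤ (1 - eps M d H.cMin) * ((1 - 3 * eps M d H.cMin) * π.profit i) := by
      have := π.value_le_profit i
      gcongr
    _ ≤ _ := by gcongr

theorem mul_OPT_le_OPT_batched (hd : ∀ j k z, {i | H.b i j k z j ≠ 0}.ncard ≤ d)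
    (he : EpsSmall M d H.cMin) :
    (1 - 3 * eps M d H.cMin) * (1 - eps M d H.cMin) * H.OPT ≤ (H.batched M d).OPT := by
  have h0 := he.pos
  have h1 := he.le_third
  rcases eq_or_lt_of_le h1 with h | h
  · rw [h, sub_self, zero_mul, zero_mul]
    exact OPT_nonneg _
  have h2 : 0 < (1 - 3 * eps M d H.cMin) * (1 - eps M d H.cMin) :=
    mul_pos (by linarith) (by linarith)
  rw [mul_comm, ← le_div_iff₀ h2]
  refine Real.sSup_le ?_ (div_nonneg (OPT_nonneg _) h2.le)
  rintro _ ⟨π, rfl⟩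
  rw [le_div_iff₀ h2, mul_comm]
  exact mul_value_le_OPT_batched hd he π

end Comparison

end AllocInstance

/-! ### Assembly of the theorem. -/

theorem theorem2p2 (M₀ : ℝ) (hM₀ : 0 < M₀) :
    ∃ C c₀ : ℝ, 0 < C ∧ 0 < c₀ ∧
      ∀ (F : Set AllocInstance) (M c : ℝ) (d : ℕ) (ALG : AllocInstance.Algorithm) (α : ℝ → ℝ),
        M₀ ≤ M → 1 ≤ d → c₀ ≤ c →
        AllocInstance.ReplBoundedBy F M →
        AllocInstance.UsesAtMost F d →
        AllocInstance.ClosedFamily F →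
        (∀ x, 0 < x → 0 ≤ α x ∧
          AllocInstance.HasRatio ALG
            (AllocInstance.withInventory (AllocInstance.withoutReplenishment F) x) (α x)) →
        AllocInstance.eps M d c * c ≤
            C * (M ^ (1 / 3 : ℝ) * c ^ (2 / 3 : ℝ) * Real.log (c * d)) ∧
          AllocInstance.HasRatio (AllocInstance.batchingExtension M d ALG)
            (AllocInstance.withInventory F c)
            (α (AllocInstance.eps M d c * c) *
              (1 - C * (M ^ (1 / 3 : ℝ) * c ^ (-(1 / 3) : ℝ) * Real.log (c * d)))) := by
  -- With `E` the error term, a positive ratio forces `16 E ≤ 1` and `6 E ≤ M₀`, so `ε ≤ 2 E` lies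
  -- below `1/3` and below `M / 3`; the `16` also covers the total loss `5ε ≤ 10 E`. The bound `3 >
  -- e` ensures `log (c d) ≥ 1` and the monotonicity of `log y / y`.
  refine ⟨16 + 6 / M₀, 3, by positivity, by norm_num, ?_⟩
  intro F M c d ALG α hM hd hc hrepl huse hF hα
  have hd' : (1 : ℝ) ≤ d := by exact_mod_cast hd
  have hM0 : 0 < M := hM₀.trans_le hM
  have hc0 : 0 < c := by linarith
  have hL := AllocInstance.one_le_log_mul hc hd'
  have hroot := AllocInstance.rpow_third_le hM0 hc0 hL
  have hC : 16 ≤ 16 + 6 / M₀ := le_add_of_nonneg_right (by positivity)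
  have hE : 0 < M ^ (1 / 3 : ℝ) * c ^ (-(1 / 3) : ℝ) * Real.log (c * d) := by positivity
  refine ⟨?_, ?_⟩
  · have h1 : c ^ (-(1 / 3) : ℝ) * c = c ^ (2 / 3 : ℝ) := by
      rw [← Real.rpow_add_one hc0.ne']
      norm_num
    calc AllocInstance.eps M d c * c
        ≤ 2 * (M ^ (1 / 3 : ℝ) * c ^ (-(1 / 3) : ℝ) * Real.log (c * d)) * c := by
          gcongr
          exact (min_le_left _ _).trans hroot
      _ = 2 * (M ^ (1 / 3 : ℝ) * c ^ (2 / 3 : ℝ) * Real.log (c * d)) := by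
          rw [← h1]
          ring
      _ ≤ _ := by
          gcongr
          linarith
  rintro H ⟨hH, hcH⟩
  have hg : 0 < AllocInstance.eps M d c * c :=
    mul_pos (lt_min (by positivity) one_pos) hc0
  obtain ⟨hα0, hratio⟩ := hα _ hg
  generalize hEdef : M ^ (1 / 3 : ℝ) * c ^ (-(1 / 3) : ℝ) * Real.log (c * d) = E at *
  have hOPT := AllocInstance.OPT_nonneg H
  -- A nonpositive ratio is trivial because values are nonnegative; otherwise `E`, and with it `ε`,
  -- is small.
  rcases le_total (1 - (16 + 6 / M₀) * E) 0 with hneg | hposC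
  · exact (mul_nonpos_of_nonpos_of_nonneg (mul_nonpos_of_nonneg_of_nonpos hα0 hneg) hOPT).trans
      (AllocInstance.Policy.value_nonneg _)
  set x := H.cMin with hx
  have hroot' : (3 * M / x * Real.log (x * d)) ^ (1 / 3 : ℝ) ≤ 2 * E := by
    refine le_trans (Real.rpow_le_rpow ?_ ?_ (by norm_num)) hroot
    · have := AllocInstance.one_le_log_mul (hc.trans hcH) hd'
      have hx0 : 0 < x := by linarith
      positivity
    · have := AllocInstance.log_mul_div_le hc hcH hd'
      calc 3 * M / x * Real.log (x * d) = 3 * M * (Real.log (x * d) / x) := by ring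
        _ ≤ 3 * M * (Real.log (c * d) / c) := by gcongr
        _ = _ := by ring
  have hE1 : 16 * E ≤ 1 := by nlinarith
  have hE2 : 6 * E ≤ M₀ := by
    have h1 : 6 / M₀ * E ≤ 1 := by nlinarith
    have h2 : 6 / M₀ * E = 6 * E / M₀ := by ring
    rwa [h2, div_le_one hM₀] at h1
  have he : AllocInstance.EpsSmall M d H.cMin :=
    AllocInstance.epsSmall hM0 (hc.trans hcH) hd (hroot'.trans (by linarith))
      (hroot'.trans (by linarith))
  have hxe : AllocInstance.eps M d x ≤ 2 * E := (min_le_left _ _).trans hroot'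
  have hmem : H.batched M d ∈ AllocInstance.withInventory (AllocInstance.withoutReplenishment F)
      (AllocInstance.eps M d c * c) :=
    ⟨AllocInstance.batched_mem hF hH, (AllocInstance.eps_mul_mono hM0.le hc hcH hd).trans
      (AllocInstance.threshold_le_cMin_batched (by linarith))⟩
  have hbatched := hratio _ hmem
  have hlower := AllocInstance.mul_OPT_le_OPT_batched (huse H hH) he
  have hupper := AllocInstance.mul_value_le_extend hM0 (hrepl H hH) (huse H hH) he
    (ALG (H.batched M d))
  refine le_trans ?_ hupper
  have he0 := he.pos
  have he1 := he.le_third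
  generalize α (AllocInstance.eps M d c * c) = a at *
  rw [← hx] at he0 he1 hlower ⊢
  generalize AllocInstance.eps M d x = e at *
  -- The product equals `1 - 5e + 4e² + 3e²(1 - e)`, hence is at least `1 - 5e ≥ 1 - 10 E`.
  have hCe : 1 - (16 + 6 / M₀) * E ≤ (1 - e) * ((1 - 3 * e) * (1 - e)) := by
    nlinarith [mul_nonneg he0.le he0.le, mul_nonneg (sub_nonneg.2 hC) hE.le,
      mul_nonneg (mul_nonneg he0.le he0.le) (by linarith : 0 ≤ 1 - e)]
  have h1e : 0 ≤ 1 - e := by linarith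
  calc a * (1 - (16 + 6 / M₀) * E) * H.OPT
      ≤ a * ((1 - e) * ((1 - 3 * e) * (1 - e))) * H.OPT := by gcongr
    _ = (1 - e) * (a * ((1 - 3 * e) * (1 - e) * H.OPT)) := by ring
    _ ≤ (1 - e) * (a * (H.batched M d).OPT) := by gcongr
    _ ≤ _ := by gcongr
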